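/- **Conventions.** Digraphs are finite, loopless, and may have parallel edges. For a vertex set $U$ of a digraph $G=(V,E)$, $\delta(U)$ is the set of edges with exactly one endpoint in $U$. A multi-set $F$ of edges is *Eulerian* if every vertex has as many entering as leaving edges of $F$ (counted with multiplicity), and it is a *tour* if in addition $(V,F)$ is connected. For a cost function $c$ on $E$, $c(F)$ is the sum of the costs of the elements of $F$ with multiplicity. A *strongly laminar ATSP instance* is $\mathcal I=(G,\mathcal L,x,y)$ where $G=(V,E)$ is a strongly connected digraph; $\mathcal L$ is a laminar family of subsets of $V$ such that $G[U]$ is strongly connected for all $U\in\mathcal L$; $x\in\mathbb Q_{>0}^E$ satisfies $x(\delta^-(v))=x(\delta^+(v))$ for all $v\in V$, $x(\delta(U))\ge 2$ for all $\emptyset\ne U\subsetneq V$, and $x(\delta(U))=2$ for all $U\in\mathcal L$; and $y:\mathcal L\to\mathbb Q_{>0}$. It induces the costs $c(e)=\sum_{U\in\mathcal L:\,e\in\delta(U)}y_U$, and $\mathrm{LP}(\mathcal I)=c(x)=\sum_{e\in E}c(e)x_e$. Write $\mathcal L_{\ge2}=\{L\in\mathcal L:|L|\ge2\}$, and $y_v=y_{\{v\}}$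 if $\{v\}\in\mathcal L$, $y_v=0$ otherwise. A *vertebrate pair* $(\mathcal I,B)$ consists of such an $\mathcal I$ and a (nonempty) connected Eulerian multi-subgraph $B$ of $G$ with $V(B)\cap L\neq\emptyset$ for all $L\in\mathcal L_{\ge 2}$. For $\kappa,\eta\ge0$, a *polynomial-time $(\kappa,\eta)$-algorithm for vertebrate pairs* is a polynomial-time algorithm that computes, for every vertebrate pair $(\mathcal I,B)$, a multi-set $F$ of edges such that $E(B)\mathbin{\dot\cup}F$ is a tour and $$c(F)\le\kappa\cdot\mathrm{LP}(\mathcal I)+\eta\cdot\sum_{v\in V\setminus V(B)}2y_v .$$ An *instance of Subtour Cover* is $(\mathcal I,B,H)$ where $(\mathcal I,B)$ is a vertebrate pair and $H$ is an Eulerian multi-subset of $E[V\setminus V(B)]$ with $H\cap\delta(L)=\emptyset$ for all $L\in\mathcal L_{\ge2}$. A *solution* is a multi-set $F$ of edges such that (i) $(V,F)$ is Eulerian; (ii) $\delta(W)\cap F\ne\emptyset$ for the vertex set $W$ of every connected component of $(V\setminus V(B),H)$; (iii) every connected component $D$ of $(V,F)$ with $E(D)\cap\delta(L)\neq\emptyset$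 for some $L\in\mathcal L_{\ge2}$ satisfies $V(D)\cap V(B)\ne\emptyset$. For $\alpha,\kappa,\beta\ge0$, an *$(\alpha,\kappa,\beta)$-algorithm for Subtour Cover* is a polynomial-time algorithm that computes, for every instance $(\mathcal I,B,H)$, a solution $F$ such that $$c(F)\le\kappa\cdot\mathrm{LP}(\mathcal I)+\beta\cdot\sum_{v\in V\setminus V(B)}2y_v$$ and, for every connected component $D$ of $(V,F)$ with $V(D)\cap V(B)=\emptyset$, $$c(E(D))\le\alpha\cdot\sum_{v\in V(D)}2y_v .$$ Polynomial time refers to a deterministic machine model that is polynomially equivalent to Turing machines and to the length of the encoded input, in which rational numbers are given in binary and multi-sets of edges are given by listing their elements with repetition. **Theorem.** Let $\alpha,\kappa,\beta\ge0$ be real numbers such that there is an $(\alpha,\kappa,\beta)$-algorithm for Subtour Cover, and let $\epsilon>0$ be a fixed constant. Then there is a polynomial-time $(\kappa,\,4\alpha+\beta+1+\epsilon)$-algorithm for vertebrate pairs. -/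

import Mathlib

namespace ATSP

/-! Digraphs, multisets of edges, connectivity -/

/-- A digraph with vertex set `V` and edge set `E`. Parallel edges are allowed, loops are not. -/
structure MultiDigraph (V E : Type) where
  tail : E → V
  head : E → V
  loopless : ∀ e, tail e ≠ head e

namespace MultiDigraph

variable {V E : Type} (G : MultiDigraph V E)

/-- `δ(U)`: the edges with exactly one endpoint in `U`. -/
def cut (U : Set V) : Set E :=
  {e | ¬ (G.tail e ∈ U ↔ G.head e ∈ U)}

/-- The induced subgraph `G[U]` is strongly connected. -/
def StronglyConnectedOn (U : Set V) : Prop :=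
  U.Nonempty ∧ ∀ u ∈ U, ∀ v ∈ U,
    Relation.ReflTransGen
      (fun a b => a ∈ U ∧ b ∈ U ∧ ∃ e, G.tail e = a ∧ G.head e = b) u v

/-! A multiset `F` of edges is given by its multiplicity function `F : E → ℕ`. -/

/-- The underlying undirected simple graph of `(V, F)`. It has the same connected components
as `(V, F)`. -/
def graph (F : E → ℕ) : SimpleGraph V :=
  SimpleGraph.fromRel fun u v => ∃ e, F e ≠ 0 ∧ G.tail e = u ∧ G.head e = v

/-- `(V, F)` is Eulerian: every vertex has as many entering as leaving edges. -/
def Eulerian [DecidableEq V] [Fintype E] (F : E → ℕ) : Prop :=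
  ∀ v, ∑ e with G.head e = v, F e = ∑ e with G.tail e = v, F e

/-- `F` is a tour: `(V, F)` is connected and Eulerian. -/
def IsTour [DecidableEq V] [Fintype E] (F : E → ℕ) : Prop :=
  (G.graph F).Connected ∧ G.Eulerian F

end MultiDigraph

/-! Strongly laminar instances, vertebrate pairs, Subtour Cover -/

open scoped Classical in
/-- A strongly laminar ATSP instance `(G, 𝓛, x, y)` with rational data. The family `𝓛` is listed
without repetition as `L 0, …, L (k - 1)`, and `y i` is the weight of the set `L i`. -/
structure StronglyLaminarInstance where
  n : ℕ
  m : ℕ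
  k : ℕ
  G : MultiDigraph (Fin n) (Fin m)
  L : Fin k → Finset (Fin n)
  x : Fin m → ℚ
  y : Fin k → ℚ
  stronglyConnected : G.StronglyConnectedOn Set.univ
  L_injective : Function.Injective L
  laminar : ∀ i j, L i ⊆ L j ∨ L j ⊆ L i ∨ Disjoint (L i) (L j)
  stronglyConnected_L : ∀ i, G.StronglyConnectedOn (L i : Set (Fin n))
  x_pos : ∀ e, 0 < x e
  x_balanced : ∀ v, ∑ e with G.head e = v, x e = ∑ e with G.tail e = v, x e
  x_cut : ∀ U : Set (Fin n), U.Nonempty → U ≠ Set.univ → 2 ≤ ∑ e with e ∈ G.cut U, x e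
  x_tight : ∀ i, ∑ e with e ∈ G.cut (L i : Set (Fin n)), x e = 2
  y_pos : ∀ i, 0 < y i

namespace StronglyLaminarInstance

variable (I : StronglyLaminarInstance)

open scoped Classical in
/-- The induced cost `c(e)`: the total weight of the sets whose boundary contains `e`. -/
noncomputable def cost (e : Fin I.m) : ℚ :=
  ∑ i with e ∈ I.G.cut (I.L i : Set (Fin I.n)), I.y i

/-- `LP(𝓘) = c(x)`. -/
noncomputable def lpValue : ℚ :=
  ∑ e, I.cost e * I.x e

/-- `c(F)` for a multiset `F` of edges. -/
noncomputable def totalCost (F : Fin I.m → ℕ) : ℚ :=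
  ∑ e, F e * I.cost e

open scoped Classical in
/-- The cost of the edges of `F` that lie in the connected component `D` of `(V, F)`. -/
noncomputable def componentCost (F : Fin I.m → ℕ) (D : (I.G.graph F).ConnectedComponent) : ℚ :=
  ∑ e with I.G.tail e ∈ D.supp, F e * I.cost e

/-- `y_v`: the weight of `{v}` if `{v} ∈ 𝓛`, and `0` otherwise. -/
def vertexWeight (v : Fin I.n) : ℚ :=
  ∑ i with I.L i = {v}, I.y i

end StronglyLaminarInstance

/-- A vertebrate pair `(𝓘, B)`; the backbone `B` has vertex set `VB` and edge multiset `EB`. -/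
structure VertebratePair extends StronglyLaminarInstance where
  VB : Finset (Fin n)
  EB : Fin m → ℕ
  EB_endpoints : ∀ e, EB e ≠ 0 → G.tail e ∈ VB ∧ G.head e ∈ VB
  EB_eulerian : G.Eulerian EB
  EB_connected : ((G.graph EB).induce (VB : Set (Fin n))).Connected
  VB_meets : ∀ i, 2 ≤ (L i).card → ∃ v ∈ VB, v ∈ L i

namespace VertebratePair

variable (J : VertebratePair)

/-- `∑ 2 y_v` over the vertices outside the backbone. -/
def outsideWeight : ℚ :=
  ∑ v with v ∉ J.VB, 2 * J.vertexWeight v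

/-- `F` is a solution of the vertebrate pair: `E(B) ⊎ F` is a tour. -/
def IsSolution (F : Fin J.m → ℕ) : Prop :=
  J.G.IsTour (J.EB + F)

end VertebratePair

/-- An instance `(𝓘, B, H)` of Subtour Cover. -/
structure SubtourCoverInstance extends VertebratePair where
  H : Fin m → ℕ
  H_endpoints : ∀ e, H e ≠ 0 → G.tail e ∉ VB ∧ G.head e ∉ VB
  H_eulerian : G.Eulerian H
  H_cut : ∀ i, 2 ≤ (L i).card → ∀ e, H e ≠ 0 → e ∉ G.cut (L i : Set (Fin n))

namespace SubtourCoverInstance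

variable (S : SubtourCoverInstance)

/-- `F` is a solution of the Subtour Cover instance. In `covers`, no edge of `H` touches `V(B)`,
so the connected components of `(V ∖ V(B), H)` are those of `(V, H)` that avoid `V(B)`. -/
structure IsSolution (F : Fin S.m → ℕ) : Prop where
  eulerian : S.G.Eulerian F
  covers : ∀ W : (S.G.graph S.H).ConnectedComponent,
    Disjoint W.supp (S.VB : Set (Fin S.n)) → ∃ e, F e ≠ 0 ∧ e ∈ S.G.cut W.supp
  meets_backbone : ∀ D : (S.G.graph F).ConnectedComponent,
    (∃ i, 2 ≤ (S.L i).card ∧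
      ∃ e, F e ≠ 0 ∧ S.G.tail e ∈ D.supp ∧ e ∈ S.G.cut (S.L i : Set (Fin S.n))) →
    ∃ v ∈ S.VB, v ∈ D.supp

open scoped Classical in
/-- The two cost bounds required of an `(α, κ, β)`-algorithm. -/
structure CostBounds (α κ β : ℝ) (F : Fin S.m → ℕ) : Prop where
  total : (S.totalCost F : ℝ) ≤ κ * S.lpValue + β * S.outsideWeight
  component : ∀ D : (S.G.graph F).ConnectedComponent,
    Disjoint D.supp (S.VB : Set (Fin S.n)) →
      (S.componentCost F D : ℝ) ≤
        α * ((∑ v with v ∈ D.supp, 2 * S.vertexWeight v : ℚ) : ℝ)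

end SubtourCoverInstance

/-! The machine model: structured programs on binary trees -/

/-- Data are finite binary trees. -/
inductive Data where
  | nil : Data
  | cons : Data → Data → Data

namespace Data

/-- The number of nodes of a tree. -/
def size : Data → ℕ
  | nil => 1
  | cons a b => a.size + b.size + 1

def fst : Data → Data
  | nil => nil
  | cons a _ => a

def snd : Data → Data
  | nil => nil
  | cons _ b => b

end Data

/-- Programs: pure Lisp without recursion but with a while loop. -/
inductive Prog where
  | id : Prog
  | nil : Prog
  | fst : Prog
  | snd : Prog
  | pair : Prog → Prog → Prog
  | seq : Prog → Prog → Prog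
  | ite : Prog → Prog → Prog → Prog
  | loop : Prog → Prog → Prog

/-- `Runs p a b t`: started on input `a`, the program `p` halts with output `b` after time `t`.
Each executed instruction is charged the number of nodes of the tree on which it operates, so time
and space agree with those of a Turing machine up to a polynomial.
The value `nil` counts as false, every other value as true. -/
inductive Runs : Prog → Data → Data → ℕ → Prop where
  | id (a : Data) : Runs .id a a a.size
  | nil (a : Data) : Runs .nil a .nil a.size
  | fst (a : Data) : Runs .fst a a.fst a.size
  | snd (a : Data) : Runs .snd a a.snd a.size
  | pair {p q : Prog} {a b c : Data} {s t : ℕ} :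
      Runs p a b s → Runs q a c t → Runs (.pair p q) a (.cons b c) (s + t + a.size)
  | seq {p q : Prog} {a b c : Data} {s t : ℕ} :
      Runs p a b s → Runs q b c t → Runs (.seq p q) a c (s + t + a.size)
  | ite_true {r p q : Prog} {a b u v : Data} {s t : ℕ} :
      Runs r a (.cons u v) s → Runs p a b t → Runs (.ite r p q) a b (s + t + a.size)
  | ite_false {r p q : Prog} {a b : Data} {s t : ℕ} :
      Runs r a .nil s → Runs q a b t → Runs (.ite r p q) a b (s + t + a.size)
  | loop_done {r p : Prog} {a : Data} {s : ℕ} :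
      Runs r a .nil s → Runs (.loop r p) a a (s + a.size)
  | loop_step {r p : Prog} {a b c u v : Data} {s t w : ℕ} :
      Runs r a (.cons u v) s → Runs p a b t → Runs (.loop r p) b c w →
        Runs (.loop r p) a c (s + t + w + a.size)

/-! Encodings -/

namespace Data

def list : List Data → Data
  | [] => nil
  | a :: l => cons a (list l)

def bit : Bool → Data
  | false => nil
  | true => cons nil nil

/-- Unary natural numbers, used for vertex names and multiplicities. -/
def unary : ℕ → Data
  | 0 => nil
  | k + 1 => cons nil (unary k)

/-- Binary natural numbers, least significant bit first. -/
def binary (k : ℕ) : Data :=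
  list (k.bits.map bit)

/-- Positive rationals, as reduced fractions in binary. -/
def rat (q : ℚ) : Data :=
  cons (binary q.num.natAbs) (binary q.den)

/-- Vertex sets, as characteristic vectors. -/
def vertexSet {n : ℕ} (U : Finset (Fin n)) : Data :=
  list (List.ofFn fun v => bit (decide (v ∈ U)))

/-- Multisets of edges, as vectors of unary multiplicities. Up to the number of edges of the graph,
the size is that of a list of all elements with repetition. -/
def edgeMultiset {m : ℕ} (F : Fin m → ℕ) : Data :=
  list (List.ofFn fun e => unary (F e))

end Data

def StronglyLaminarInstance.encode (I : StronglyLaminarInstance) : Data :=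
  .cons (.unary I.n) (.cons
    (.list (List.ofFn fun e =>
      .cons (.cons (.unary (I.G.tail e)) (.unary (I.G.head e))) (.rat (I.x e))))
    (.list (List.ofFn fun i => .cons (.vertexSet (I.L i)) (.rat (I.y i)))))

def VertebratePair.encode (J : VertebratePair) : Data :=
  .cons J.toStronglyLaminarInstance.encode (.cons (.vertexSet J.VB) (.edgeMultiset J.EB))

def SubtourCoverInstance.encode (S : SubtourCoverInstance) : Data :=
  .cons S.toVertebratePair.encode (.edgeMultiset S.H)

/-! Algorithms -/

/-- `A` is an `(α, κ, β)`-algorithm for Subtour Cover (polynomial time is part of the notion). -/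
def IsSubtourCoverAlgorithm (α κ β : ℝ) (A : Prog) : Prop :=
  ∃ P : Polynomial ℕ, ∀ S : SubtourCoverInstance, ∃ (F : Fin S.m → ℕ) (t : ℕ),
    Runs A S.encode (.edgeMultiset F) t ∧ t ≤ P.eval S.encode.size ∧
      S.IsSolution F ∧ S.CostBounds α κ β F

/-- `A` is a polynomial-time `(κ, η)`-algorithm for vertebrate pairs. -/
def IsPolyTimeVertebratePairAlgorithm (κ η : ℝ) (A : Prog) : Prop :=
  ∃ P : Polynomial ℕ, ∀ J : VertebratePair, ∃ (F : Fin J.m → ℕ) (t : ℕ),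
    Runs A J.encode (.edgeMultiset F) t ∧ t ≤ P.eval J.encode.size ∧
      J.IsSolution F ∧ (J.totalCost F : ℝ) ≤ κ * J.lpValue + η * J.outsideWeight

end ATSP

/-! The algorithm keeps a partition of the vertices into entities. An entity carries an Eulerian
edge set connecting it and remembers its weight `w` at creation; measured in the weights `2 y_v`,
this edge set costs at most `2α w`. Initially `H` is the sum of these edge sets. Subtour Cover is
called on `H`, and one of three things happens.

Restart. Some entity is "bad": the solution components off the backbone that join components of `H`
and have it as their heaviest entity add weight at least `(1 + 2/d) w`. Or some cycle outweighs
every entity it meets by a factor `1 + 1/d`. In both cases a heavy new entity is formed, again of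
cost at most `2α` times its weight (`bad_cost`, `big_cost`). Entities that have lost more than the
fraction `1/d` of `w` dissolve into single vertices. The potential `∑ w^p (d · current weight - (d -
1) w)` rises, because for large `p` the gain from the new entity beats the loss of the others
(`potential_restart`). Weights are rounded to integers of polynomial size, so restarts are few.

Adding a cycle. Otherwise, among the components of all collected edges that avoid the backbone, take
one whose heaviest vertex is as light as possible. If an edge crossing its boundary lies on a
directed cycle through vertices no heavier than this top, the cycle is added and paid by the top
entity, at most `(1 + 1/d) w`. If the union still avoids the backbone, it contains another top that
is no lighter and has not paid (`costInv_addCycle`). So an entity pays for at most one cycle.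

Finalizing. If there is no such edge, the component becomes part of `H`. Each solution component
that joins components of `H` is charged to its heaviest entity, which pays at most `(2 + 2/d) α w`
since it is not bad. It is never charged again before a restart: a later component with this entity
as heaviest would be Eulerian, hence strongly connected by light edges, hence already inside one
component of `H` (`heaviest_not_mem`).

When every component meets the backbone, the last solution and the cycles are added. The solution
costs at most `κ LP + β ∑ 2 y_v`; the entities account for `2α` (their edge sets), `2α` (finalized
components) and `1` (cycles), up to factors that tend to 1 as `d → ∞`. Cycles require `2α ≥ 1`. If
`α < 1`, components off the backbone turn out to be free (`CostBounds.zero`), so for `2α < 1` the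
algorithm runs with `α = 0` and without cycles.

Polynomial time is derived in a small calculus of computable families (`PT`, `Poly`). Subtour Cover
is called on `cycleCover H` instead of `H`, which has the same components but bounded
multiplicities, so that sizes do not compound over the calls. -/

namespace ATSP

open Polynomial

/-! Polynomial-time computability of one family of data from another -/

theorem eval_mono_nat (P : ℕ[X]) : Monotone fun k : ℕ => P.eval k := by
  intro a b h
  simp only [eval_eq_sum, Polynomial.sum]
  gcongr

theorem eval_le_eval (P : ℕ[X]) {a b : ℕ} (h : a ≤ b) : P.eval a ≤ P.eval b :=
  eval_mono_nat P h

theorem Data.size_pos (a : Data) : 1 ≤ a.size := by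
  cases a <;> simp [Data.size]

theorem Data.size_fst_le (a : Data) : a.fst.size ≤ a.size := by
  cases a <;> simp [Data.size, Data.fst]; omega

theorem Data.size_snd_le (a : Data) : a.snd.size ≤ a.size := by
  cases a <;> simp [Data.size, Data.snd]; omega

/-- Every instruction is charged the size of its operand, which also covers the one node that `pair`
creates. Time bounds are therefore size bounds, and this makes compositions of polynomial-time
programs polynomial. -/
theorem Runs.size_le {p : Prog} {a b : Data} {t : ℕ} (h : Runs p a b t) : b.size ≤ t := by
  induction h with
  | id a => exact le_rfl
  | nil a => exact a.size_pos
  | fst a => exact a.size_fst_le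
  | snd a => exact a.size_snd_le
  | @pair p q a b c s t _ _ h1 h2 =>
    have := a.size_pos
    simp only [Data.size]; omega
  | seq => omega
  | ite_true => omega
  | ite_false => omega
  | loop_done => omega
  | loop_step => omega

/-- A single program computes `o c` from `i c`, for all `c`, in polynomial time. -/
def PT {γ : Type} (i o : γ → Data) : Prop :=
  ∃ (p : Prog) (P : ℕ[X]), ∀ c, ∃ t, Runs p (i c) (o c) t ∧ t ≤ P.eval (i c).size

/-- The function `f` is bounded by a polynomial in the size of `i`. -/
def PolyBdd {γ : Type} (i : γ → Data) (f : γ → ℕ) : Prop :=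
  ∃ P : ℕ[X], ∀ c, f c ≤ P.eval (i c).size

namespace PolyBdd

variable {γ γ' : Type} {i j : γ → Data} {f g : γ → ℕ}

theorem mono (h : PolyBdd i f) (hgf : ∀ c, g c ≤ f c) : PolyBdd i g :=
  let ⟨P, hP⟩ := h
  ⟨P, fun c => (hgf c).trans (hP c)⟩

theorem add (hf : PolyBdd i f) (hg : PolyBdd i g) : PolyBdd i fun c => f c + g c :=
  let ⟨P, hP⟩ := hf
  let ⟨Q, hQ⟩ := hg
  ⟨P + Q, fun c => by rw [eval_add]; exact add_le_add (hP c) (hQ c)⟩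

theorem mul (hf : PolyBdd i f) (hg : PolyBdd i g) : PolyBdd i fun c => f c * g c :=
  let ⟨P, hP⟩ := hf
  let ⟨Q, hQ⟩ := hg
  ⟨P * Q, fun c => by rw [eval_mul]; exact Nat.mul_le_mul (hP c) (hQ c)⟩

theorem const (k : ℕ) : PolyBdd i fun _ => k := ⟨C k, fun c => by simp⟩

theorem size : PolyBdd i fun c => (i c).size := ⟨X, fun c => by simp⟩

theorem trans (h : PolyBdd j f) (hj : PolyBdd i fun c => (j c).size) : PolyBdd i f :=
  let ⟨P, hP⟩ := h
  let ⟨Q, hQ⟩ := hj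
  ⟨P.comp Q, fun c => by rw [eval_comp]; exact (hP c).trans (eval_le_eval P (hQ c))⟩

end PolyBdd

namespace PT

variable {γ γ' : Type} {i j o a b : γ → Data}

theorem size_bdd (h : PT i o) : PolyBdd i fun c => (o c).size :=
  let ⟨_, P, hP⟩ := h
  ⟨P, fun c => let ⟨_, ht, htP⟩ := hP c; ht.size_le.trans htP⟩

/-- The index type carries no data. Passing to a subtype or to dependent pairs restricts the inputs
on which a program has to be correct. -/
theorem reindex (h : PT i o) (g : γ' → γ) : PT (fun c => i (g c)) fun c => o (g c) :=
  let ⟨p, P, hP⟩ := h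
  ⟨p, P, fun c => hP (g c)⟩

theorem congr (h : PT i o) (ho : ∀ c, o c = a c) : PT i a := by
  obtain rfl : o = a := funext ho
  exact h

theorem of_runs (p : Prog) {f : γ → ℕ} (hf : PolyBdd i f) (h : ∀ c, ∃ t, Runs p (i c) (o c) t ∧ t ≤ f c) :
    PT i o :=
  let ⟨P, hP⟩ := hf
  ⟨p, P, fun c => let ⟨t, ht, htf⟩ := h c; ⟨t, ht, htf.trans (hP c)⟩⟩

theorem refl : PT i i := ⟨.id, X, fun c => ⟨_, .id _, by simp⟩⟩

theorem nil : PT i fun _ => .nil := ⟨.nil, X, fun c => ⟨_, .nil _, by simp⟩⟩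

theorem trans (h1 : PT i j) (h2 : PT j o) : PT i o := by
  have hj := h1.size_bdd
  obtain ⟨p, P, hp⟩ := h1
  obtain ⟨q, Q, hq⟩ := h2
  have b1 : PolyBdd i fun c => P.eval (i c).size := ⟨P, fun _ => le_rfl⟩
  have b2 : PolyBdd i fun c => Q.eval (j c).size := PolyBdd.trans ⟨Q, fun _ => le_rfl⟩ hj
  refine of_runs (.seq p q) ((b1.add b2).add .size) fun c => ?_
  obtain ⟨s, hs, hs'⟩ := hp c
  obtain ⟨t, ht, ht'⟩ := hq c
  exact ⟨_, .seq hs ht, by omega⟩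

theorem cons (h1 : PT i a) (h2 : PT i b) : PT i fun c => .cons (a c) (b c) := by
  obtain ⟨p, P, hp⟩ := h1
  obtain ⟨q, Q, hq⟩ := h2
  have b1 : PolyBdd i fun c => P.eval (i c).size := ⟨P, fun _ => le_rfl⟩
  have b2 : PolyBdd i fun c => Q.eval (i c).size := ⟨Q, fun _ => le_rfl⟩
  refine of_runs (.pair p q) ((b1.add b2).add .size) fun c => ?_
  obtain ⟨s, hs, hs'⟩ := hp c
  obtain ⟨t, ht, ht'⟩ := hq c
  exact ⟨_, .pair hs ht, by omega⟩

theorem dfst (h : PT i a) : PT i fun c => (a c).fst :=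
  h.trans ⟨.fst, X, fun c => ⟨_, .fst _, by simp⟩⟩

theorem dsnd (h : PT i a) : PT i fun c => (a c).snd :=
  h.trans ⟨.snd, X, fun c => ⟨_, .snd _, by simp⟩⟩

theorem left (h : PT i fun c => .cons (a c) (b c)) : PT i a := h.dfst

theorem right (h : PT i fun c => .cons (a c) (b c)) : PT i b := h.dsnd

theorem const (d : Data) : PT i fun _ => d := by
  induction d with
  | nil => exact nil
  | cons a b ha hb => exact ha.cons hb

/-- Definition by cases according to a computed test. -/
theorem cases {t : γ → Data} (p : γ → Prop) (ht : PT i t) (hp : ∀ c, t c = .nil ↔ ¬ p c)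
    (h1 : PT (γ := {c // p c}) (fun c => i c) fun c => o c)
    (h2 : PT (γ := {c // ¬ p c}) (fun c => i c) fun c => o c) : PT i o := by
  obtain ⟨r, R, hr⟩ := ht
  obtain ⟨q1, Q1, hq1⟩ := h1
  obtain ⟨q2, Q2, hq2⟩ := h2
  refine ⟨.ite r q1 q2, R + (Q1 + Q2) + X, fun c => ?_⟩
  obtain ⟨s, hs, hs'⟩ := hr c
  simp only [eval_add, eval_X]
  by_cases h : p c
  · obtain ⟨t', ht, ht'⟩ := hq1 ⟨c, h⟩
    dsimp only at ht'
    have hn : t c ≠ .nil := by rw [Ne, hp]; simpa using h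
    cases htc : t c with
    | nil => exact absurd htc hn
    | cons u v =>
      rw [htc] at hs
      exact ⟨_, .ite_true hs ht, by omega⟩
  · obtain ⟨t', ht, ht'⟩ := hq2 ⟨c, h⟩
    dsimp only at ht'
    rw [(hp c).2 h] at hs
    exact ⟨_, .ite_false hs ht, by omega⟩

/-- Bounded recursion. The list-like tree `T c k` is the counter when `k` steps remain, and
`S c k` is the intermediate result at that moment. -/
theorem loop (n : γ → ℕ) (T S : γ → ℕ → Data) (hT0 : ∀ c, T c 0 = .nil)
    (hTs : ∀ c k, k < n c → ∃ e, T c (k + 1) = .cons e (T c k))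
    (hT : PT i fun c => T c (n c)) (hS : PT i fun c => S c (n c))
    (hstep : PT (γ := {x : γ × ℕ // x.2 < n x.1})
      (fun x => .cons (i x.1.1) (.cons (T x.1.1 (x.1.2 + 1)) (S x.1.1 (x.1.2 + 1))))
      fun x => S x.1.1 x.1.2)
    (hb : ∃ f, PolyBdd i f ∧ ∀ c k, k ≤ n c → (S c k).size ≤ f c) :
    PT i fun c => S c 0 := by
  obtain ⟨f, hf, hfS⟩ := hb
  have hTle : ∀ c k, k ≤ n c → (T c k).size ≤ (T c (n c)).size := by
    intro c k hk
    induction h : n c - k generalizing k with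
    | zero => rw [show k = n c by omega]
    | succ l ih =>
      obtain ⟨e, he⟩ := hTs c k (by omega)
      have := ih (k + 1) (by omega) (by omega)
      rw [he] at this
      simp only [Data.size] at this
      omega
  have hle : ∀ c k, k ≤ n c → k ≤ (T c k).size := by
    intro c k hk
    induction k with
    | zero => simp
    | succ k ih =>
      obtain ⟨e, he⟩ := hTs c k (by omega)
      have := ih (by omega)
      rw [he]; simp only [Data.size]; omega
  -- The original input travels with the counter and the intermediate result, so that the body can
  -- consult it.
  let st : γ → ℕ → Data := fun c k => .cons (i c) (.cons (T c k) (S c k))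
  have hstsize : ∃ g, PolyBdd i g ∧ ∀ c k, k ≤ n c → (st c k).size ≤ g c := by
    refine ⟨_, (PolyBdd.size.add (hT.size_bdd.add hf)).add (.const 2), fun c k hk => ?_⟩
    have h1 := hTle c k hk
    have h2 := hfS c k hk
    simp only [st, Data.size]; omega
  obtain ⟨g, hg, hgs⟩ := hstsize
  have htest : PT (γ := {x : γ × ℕ // x.2 ≤ n x.1}) (fun x => st x.1.1 x.1.2)
      fun x => T x.1.1 x.1.2 := PT.refl.dsnd.dfst
  have hbody : PT (γ := {x : γ × ℕ // x.2 < n x.1}) (fun x => st x.1.1 (x.1.2 + 1))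
      fun x => st x.1.1 x.1.2 := by
    refine PT.refl.dfst.cons (cons (PT.refl.dsnd.dfst.dsnd.congr fun x => ?_) hstep)
    obtain ⟨e, he⟩ := hTs x.1.1 x.1.2 x.2
    simp [st, Data.fst, Data.snd, he]
  obtain ⟨r, R, hr⟩ := htest
  obtain ⟨q, Q, hq⟩ := hbody
  -- All states have size at most `g c`, so every round costs at most the last factor. The extra
  -- round is the final, failing test.
  have hloop : ∀ c k, k ≤ n c → ∃ t, Runs (.loop r q) (st c k) (st c 0) t ∧
      t ≤ (k + 1) * (R.eval (g c) + Q.eval (g c) + g c) := by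
    intro c k
    induction k with
    | zero =>
      intro hk
      obtain ⟨s, hs, hs'⟩ := hr ⟨(c, 0), hk⟩
      simp only [hT0] at hs
      have h1 := eval_le_eval R (hgs c 0 hk)
      have h2 := hgs c 0 hk
      exact ⟨_, .loop_done hs, by simp only [] at hs'; omega⟩
    | succ k ih =>
      intro hk
      obtain ⟨w, hw, hw'⟩ := ih (by omega)
      obtain ⟨s, hs, hs'⟩ := hr ⟨(c, k + 1), hk⟩
      obtain ⟨t, ht, ht'⟩ := hq ⟨(c, k), by simpa using hk⟩
      obtain ⟨e, he⟩ := hTs c k (by omega)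
      simp only [he] at hs
      have h1 := eval_le_eval R (hgs c (k + 1) hk)
      have h2 := hgs c (k + 1) hk
      have h3 := eval_le_eval Q (hgs c (k + 1) hk)
      refine ⟨_, .loop_step hs ht hw, ?_⟩
      simp only [] at hs' ht'
      rw [add_mul, one_mul]
      omega
  have hinit : PT i fun c => st c (n c) := PT.refl.cons (hT.cons hS)
  have hmain : PT (fun c => st c (n c)) fun c => st c 0 := by
    have hpoly : PolyBdd i fun c =>
        ((T c (n c)).size + 1) * (R.eval (g c) + Q.eval (g c) + g c) := by
      obtain ⟨G, hG⟩ := hg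
      refine PolyBdd.mul (hT.size_bdd.add (.const 1)) (PolyBdd.add (PolyBdd.add ?_ ?_) ⟨G, hG⟩)
      · exact ⟨R.comp G, fun c => by rw [eval_comp]; exact eval_le_eval R (hG c)⟩
      · exact ⟨Q.comp G, fun c => by rw [eval_comp]; exact eval_le_eval Q (hG c)⟩
    refine of_runs (.loop r q) (hpoly.trans ⟨X, fun c => ?_⟩) fun c => ?_
    · simp [st, Data.size]; omega
    · obtain ⟨t, ht, ht'⟩ := hloop c (n c) le_rfl
      refine ⟨t, ht, ht'.trans (Nat.mul_le_mul_right _ ?_)⟩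
      have := hle c (n c) le_rfl
      omega
  exact (hinit.trans hmain).dsnd.dsnd

end PT

end ATSP

namespace ATSP

/-! Encodings of the types that algorithms manipulate -/

/-- A type with a fixed encoding of its elements as data. -/
class Enc (α : Type) where
  enc : α → Data

open Enc (enc)

instance : Enc ℕ := ⟨Data.unary⟩

instance {n : ℕ} : Enc (Fin n) := ⟨fun v => Data.unary v⟩

-- Every proposition has an encoding; it is a `Poly` statement that asserts that truth values can be
-- computed from the input.
open scoped Classical in
noncomputable instance : Enc Prop := ⟨fun p => Data.bit (decide p)⟩

instance {α β : Type} [Enc α] [Enc β] : Enc (α × β) := ⟨fun x => .cons (enc x.1) (enc x.2)⟩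

instance {n : ℕ} {α : Type} [Enc α] : Enc (Fin n → α) :=
  ⟨fun f => Data.list (List.ofFn fun v => enc (f v))⟩

/-- The value of type `β c` is computed from `i c` in polynomial time. -/
abbrev Poly {γ : Type} {β : γ → Type} [∀ c, Enc (β c)] (i : γ → Data) (f : ∀ c, β c) : Prop :=
  PT i fun c => enc (f c)

/-- The input `i` extended by one more variable. -/
abbrev Ext {γ : Type} (i : γ → Data) (β : γ → Type) [∀ c, Enc (β c)] : (Σ c, β c) → Data :=
  fun x => .cons (i x.1) (enc x.2)

namespace Data

theorem size_list_le {l : List Data} {B : ℕ} (h : ∀ a ∈ l, a.size ≤ B) :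
    (list l).size ≤ l.length * (B + 1) + 1 := by
  induction l with
  | nil => simp [list, size]
  | cons a l ih =>
    have h1 := h a (by simp)
    have h2 := ih fun b hb => h b (by simp [hb])
    simp only [list, size, List.length_cons, add_mul]
    omega

theorem size_unary (k : ℕ) : (unary k).size = 2 * k + 1 := by
  induction k with
  | zero => rfl
  | succ k ih => simp only [unary, size, ih]; omega

theorem size_bit_le (b : Bool) : (bit b).size ≤ 3 := by
  cases b <;> simp [bit, size]

theorem list_drop_succ (l : List Data) (k : ℕ) :
    list (l.drop (k + 1)) = (list (l.drop k)).snd := by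
  induction l generalizing k with
  | nil => simp [list, snd]
  | cons a l ih =>
    cases k with
    | zero => simp [list, snd]
    | succ k => simpa using ih k

theorem size_list_drop_le (l : List Data) (k : ℕ) : (list (l.drop k)).size ≤ (list l).size := by
  induction k with
  | zero => simp
  | succ k ih => rw [list_drop_succ]; exact (size_snd_le _).trans ih

end Data

theorem size_enc_prop (p : Prop) : (enc p).size ≤ 3 := Data.size_bit_le _

theorem enc_prop_eq_nil {p : Prop} : enc p = Data.nil ↔ ¬ p := by
  by_cases h : p <;> simp [enc, h, Data.bit]

theorem size_enc_nat (k : ℕ) : (enc k).size = 2 * k + 1 := Data.size_unary k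

theorem size_enc_fin {n : ℕ} (v : Fin n) : (enc v).size = 2 * v + 1 := Data.size_unary v

theorem size_enc_pi_le {n : ℕ} {α : Type} [Enc α] {f : Fin n → α} {B : ℕ}
    (h : ∀ v, (enc (f v)).size ≤ B) : (enc f).size ≤ n * (B + 1) + 1 := by
  refine (Data.size_list_le (B := B) ?_).trans (by simp)
  intro a ha
  obtain ⟨v, rfl⟩ := (List.mem_ofFn' _ _).1 ha
  exact h v

variable {γ : Type} {i : γ → Data}

theorem PolyBdd.of_unary {n : γ → ℕ} (h : Poly i n) : PolyBdd i n :=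
  h.size_bdd.mono fun c => by rw [size_enc_nat]; omega

/-! ### Access to variables, subfamilies and list entries. -/

namespace PT

variable {o : γ → Data} {β : γ → Type} [∀ c, Enc (β c)]

theorem up (h : PT i o) : PT (Ext i β) fun x => o x.1 :=
  PT.refl.left.trans (h.reindex Sigma.fst)

theorem var : PT (Ext i β) fun x => enc x.2 := PT.refl.right

theorem sub (h : PT i o) (p : γ → Prop) : PT (γ := {c // p c}) (fun c => i c) fun c => o c :=
  h.reindex Subtype.val

theorem pull {γ' : Type} {j : γ' → Data} (h : PT i o) (g : γ' → γ) (hj : PT j fun c => i (g c)) :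
    PT j fun c => o (g c) := hj.trans (h.reindex g)

theorem listGet {l : γ → List Data} {k : γ → ℕ} (hl : PT i fun c => Data.list (l c))
    (hk : Poly i k) : PT i fun c => (Data.list ((l c).drop (k c))).fst := by
  refine dfst ?_
  -- The counter runs downwards, so with `j` rounds left exactly `k c - j` entries have been
  -- dropped.
  have := loop (i := i) k (fun c j => Data.unary j)
    (fun c j => Data.list ((l c).drop (k c - j))) (fun c => rfl)
    (fun c j _ => ⟨_, rfl⟩) hk (by simpa using hl) ?_ ⟨_, hl.size_bdd, fun c j _ => ?_⟩
  · simpa using this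
  · refine (PT.refl.right.right.dsnd).congr fun x => ?_
    rw [← Data.list_drop_succ]
    have := x.2
    congr 2; omega
  · exact Data.size_list_drop_le _ _

end PT

/-! ### Tables, propositions, unary arithmetic and bounded quantifiers. -/

namespace Poly

variable {α : γ → Type} [∀ c, Enc (α c)] {n : γ → ℕ} {p q : γ → Prop}

open PT

theorem _root_.ATSP.PT.app {f : ∀ c, Fin (n c) → α c} {v : ∀ c, Fin (n c)} (hf : Poly i f) (hv : Poly i v) :
    Poly i fun c => f c (v c) := by
  refine (listGet (l := fun c => List.ofFn fun v => enc (f c v)) (k := fun c => (v c : ℕ)) hf hv).congr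
    fun c => ?_
  rw [List.drop_eq_getElem_cons (by simp)]
  simp [Data.list, Data.fst]

theorem tab' {n : γ → ℕ} {o : ∀ c, Fin (n c) → Data} (hn : Poly i n)
    (ho : PT (Ext i fun c => Fin (n c)) fun x => o x.1 x.2) :
    PT i fun c => Data.list (List.ofFn (o c)) := by
  have := PT.loop (i := i) n (fun c j => Data.unary j)
    (fun c j => Data.list ((List.ofFn (o c)).drop j)) (fun c => rfl)
    (fun c j _ => ⟨_, rfl⟩) hn ?_ ?_ ?_
  · simpa using this
  · refine PT.nil.congr fun c => ?_
    rw [List.drop_of_length_le (by simp)]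
    rfl
  -- The tail of the unary counter `j + 1` encodes the index `j`, so the counter itself supplies the
  -- argument of `o`. The list is built from its last entry.
  · have h : PT (γ := {x : γ × ℕ // x.2 < n x.1})
        (fun x => .cons (i x.1.1) (.cons (Data.unary (x.1.2 + 1))
          (Data.list ((List.ofFn (o x.1.1)).drop (x.1.2 + 1)))))
        fun x => o x.1.1 ⟨x.1.2, x.2⟩ :=
      (PT.refl.left.cons PT.refl.right.left.dsnd).trans
        (ho.reindex fun x : {x : γ × ℕ // x.2 < n x.1} => ⟨x.1.1, ⟨x.1.2, x.2⟩⟩)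
    refine (h.cons PT.refl.right.right).congr fun x => ?_
    rw [List.drop_eq_getElem_cons (i := x.1.2) (by simpa using x.2)]
    simp only [Data.list, List.getElem_ofFn]
  · obtain ⟨P, hP⟩ := ho.size_bdd
    have hn' := PolyBdd.of_unary hn
    have h1 : PolyBdd i fun c => P.eval ((i c).size + (2 * n c + 1) + 1) := by
      obtain ⟨N, hN⟩ := hn'
      refine ⟨P.comp (.X + (2 * N + 1) + 1), fun c => ?_⟩
      rw [Polynomial.eval_comp]
      refine eval_le_eval P ?_
      have := hN c
      simp; omega
    refine ⟨_, (hn'.mul (h1.add (.const 1))).add (.const 1), fun c k hk => ?_⟩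
    refine (Data.size_list_drop_le _ _).trans ((Data.size_list_le ?_).trans (by simp; rfl))
    intro a ha
    obtain ⟨v, rfl⟩ := (List.mem_ofFn' _ _).1 ha
    refine (hP ⟨c, v⟩).trans (eval_le_eval P ?_)
    simp only [Data.size, size_enc_fin]
    have := v.2
    omega

theorem tab {f : ∀ c, Fin (n c) → α c} (hn : Poly i n)
    (hf : PT (Ext i fun c => Fin (n c)) fun x => enc (f x.1 x.2)) : Poly i f :=
  tab' hn hf

theorem cases (hp : Poly i p) {o : γ → Data}
    (h1 : PT (γ := {c // p c}) (fun c => i c) fun c => o c)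
    (h2 : PT (γ := {c // ¬ p c}) (fun c => i c) fun c => o c) : PT i o :=
  PT.cases p hp (fun _ => enc_prop_eq_nil) h1 h2

theorem true : Poly i fun _ => True := PT.const _

theorem false : Poly i fun _ => False := PT.const _

theorem constProp (a : Prop) : Poly i fun _ => a := PT.const _

theorem iffProp (hp : Poly i p) (h : ∀ c, p c ↔ q c) : Poly i q :=
  hp.congr fun c => by rw [propext (h c)]

theorem not (hp : Poly i p) : Poly i fun c => ¬ p c :=
  cases hp (Poly.false.congr fun c => by simp [c.2]) (Poly.true.congr fun c => by simp [c.2])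

theorem and (hp : Poly i p) (hq : Poly i q) : Poly i fun c => p c ∧ q c :=
  cases hp ((hq.sub _).congr fun c => by simp [c.2]) (Poly.false.congr fun c => by simp [c.2])

theorem or (hp : Poly i p) (hq : Poly i q) : Poly i fun c => p c ∨ q c :=
  cases hp (Poly.true.congr fun c => by simp [c.2]) ((hq.sub _).congr fun c => by simp [c.2])

theorem imp (hp : Poly i p) (hq : Poly i q) : Poly i fun c => p c → q c :=
  cases hp ((hq.sub _).congr fun c => by simp [c.2]) (Poly.true.congr fun c => by simp [c.2])

theorem iff (hp : Poly i p) (hq : Poly i q) : Poly i fun c => (p c ↔ q c) :=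
  cases hp ((hq.sub _).congr fun c => by simp [c.2]) ((hq.not.sub _).congr fun c => by simp [c.2])

theorem ite {β : γ → Type} [∀ c, Enc (β c)] {f g : ∀ c, β c} [∀ c, Decidable (p c)] (hp : Poly i p)
    (hf : PT (γ := {c // p c}) (fun c => i c) fun c => enc (f c))
    (hg : PT (γ := {c // ¬ p c}) (fun c => i c) fun c => enc (g c)) :
    Poly i fun c => if p c then f c else g c :=
  cases hp (hf.congr fun c => by simp [c.2]) (hg.congr fun c => by simp [c.2])

/-- Iteration, with the index of the current step available. -/
theorem iterate {σ : γ → Type} [∀ c, Enc (σ c)] {T : γ → ℕ} (s : ∀ c, ℕ → σ c) (hT : Poly i T)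
    (h0 : Poly i fun c => s c 0)
    (hs : PT (γ := {x : γ × ℕ // x.2 < T x.1})
      (fun x => .cons (i x.1.1) (.cons (enc x.1.2) (enc (s x.1.1 x.1.2))))
      fun x => enc (s x.1.1 (x.1.2 + 1)))
    (hb : ∃ f, PolyBdd i f ∧ ∀ c k, k ≤ T c → (enc (s c k)).size ≤ f c) :
    Poly i fun c => s c (T c) := by
  obtain ⟨f, hf, hfs⟩ := hb
  -- The loop counts the remaining rounds while the recursion counts upwards; the index `T c - j` is
  -- therefore kept in the state.
  have := PT.loop (i := i) T (fun c j => Data.unary j)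
    (fun c j => .cons (enc (T c - j)) (enc (s c (T c - j)))) (fun c => rfl)
    (fun c j _ => ⟨_, rfl⟩) hT ?_ ?_ ?_
  · exact (this.right).congr fun c => by simp
  · exact ((PT.const (enc (0 : ℕ))).cons h0).congr fun c => by simp
  · have h := hs.reindex fun x : {x : γ × ℕ // x.2 < T x.1} =>
      (⟨(x.1.1, T x.1.1 - (x.1.2 + 1)), by have := x.2; simp only; omega⟩ : {x : γ × ℕ // x.2 < T x.1})
    have h' := PT.trans (i := fun x : {x : γ × ℕ // x.2 < T x.1} => .cons (i x.1.1)
      (.cons (Data.unary (x.1.2 + 1)) (.cons (enc (T x.1.1 - (x.1.2 + 1)))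
        (enc (s x.1.1 (T x.1.1 - (x.1.2 + 1))))))) (PT.refl.left.cons PT.refl.right.right) h
    refine (PT.cons ((PT.nil).cons PT.refl.right.right.left) h').congr fun x => ?_
    have e : T x.1.1 - x.1.2 = T x.1.1 - (x.1.2 + 1) + 1 := by have := x.2; omega
    simp only [e]
    rfl
  · refine ⟨_, ((PolyBdd.of_unary hT).add (PolyBdd.of_unary hT)).add (hf.add (.const 2)), fun c k hk => ?_⟩
    have := hfs c (T c - k) (by omega)
    simp only [Data.size, size_enc_nat]
    omega

theorem add {a b : γ → ℕ} (ha : Poly i a) (hb : Poly i b) : Poly i fun c => a c + b c := by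
  have := iterate (i := i) (T := a) (fun c k => k + b c) ha (by simpa using hb)
    ((PT.nil.cons PT.refl.right.right).congr fun x => ?_) ?_
  · exact this
  · rw [Nat.add_right_comm]; rfl
  · refine ⟨_, (((PolyBdd.of_unary ha).add (.of_unary hb)).mul (.const 2)).add (.const 1), fun c k hk => ?_⟩
    simp only [size_enc_nat]; omega

theorem natSub {a b : γ → ℕ} (ha : Poly i a) (hb : Poly i b) : Poly i fun c => a c - b c := by
  refine iterate (i := i) (T := b) (fun c k => a c - k) hb (by simpa using ha)
    ((PT.refl.right.right.dsnd).congr fun x => ?_) ?_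
  · rw [← Nat.sub_sub]
    generalize a x.1.1 - x.1.2 = l
    cases l <;> rfl
  · refine ⟨_, (((PolyBdd.of_unary ha)).mul (.const 2)).add (.const 1), fun c k hk => ?_⟩
    simp only [size_enc_nat]; omega

theorem constNat (k : ℕ) : Poly i fun _ => k := PT.const _

/-- Truncated subtraction gives `0`, encoded by `nil`, exactly when `a ≤ b`. -/
theorem le {a b : γ → ℕ} (ha : Poly i a) (hb : Poly i b) : Poly i fun c => a c ≤ b c := by
  refine not (p := fun c => ¬ a c ≤ b c) ?_ |>.iffProp fun c => not_not
  refine PT.cases (fun c => ¬ a c ≤ b c) (ha.natSub hb) (fun c => ?_) (Poly.true.congr fun c => ?_)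
    (Poly.false.congr fun c => ?_)
  · rw [not_not, ← Nat.sub_eq_zero_iff_le]
    change Data.unary (a c - b c) = _ ↔ _
    generalize a c - b c = l
    cases l <;> simp [Data.unary]
  · simp [c.2]
  · simp [c.2]

theorem natEq {a b : γ → ℕ} (ha : Poly i a) (hb : Poly i b) : Poly i fun c => a c = b c :=
  ((ha.le hb).and (hb.le ha)).iffProp fun _ => le_antisymm_iff.symm

theorem finVal {v : ∀ c, Fin (n c)} (hv : Poly i v) : Poly i fun c => (v c : ℕ) := hv

theorem finEq {v w : ∀ c, Fin (n c)} (hv : Poly i v) (hw : Poly i w) : Poly i fun c => v c = w c :=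
  (natEq (finVal hv) (finVal hw)).iffProp fun _ => Fin.ext_iff.symm

/-- Recursion over `Fin n` from the last index to the first. -/
theorem descend {σ : γ → Type} [∀ c, Enc (σ c)] (s : ∀ c, ℕ → σ c) (hn : Poly i n)
    (h0 : Poly i fun c => s c (n c))
    (hs : PT (γ := Σ c, (Fin (n c)))
      (fun x => .cons (.cons (i x.1) (enc x.2)) (enc (s x.1 (x.2 + 1))))
      fun x => enc (s x.1 x.2))
    (hb : ∃ f, PolyBdd i f ∧ ∀ c k, k ≤ n c → (enc (s c k)).size ≤ f c) :
    Poly i fun c => s c 0 := by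
  refine PT.loop (i := i) n (fun c j => Data.unary j) (fun c j => enc (s c j)) (fun c => rfl)
    (fun c j _ => ⟨_, rfl⟩) hn h0 ?_ hb
  exact ((PT.refl.left.cons PT.refl.right.left.dsnd).cons PT.refl.right.right).trans
    (hs.reindex fun x : {x : γ × ℕ // x.2 < n x.1} => ⟨x.1.1, ⟨x.1.2, x.2⟩⟩)

theorem ex {p : ∀ c, Fin (n c) → Prop} (hn : Poly i n)
    (hp : PT (Ext i fun c => Fin (n c)) fun x => enc (p x.1 x.2)) : Poly i fun c => ∃ v, p c v := by
  have := descend (i := i) (fun c k => ∃ v, k ≤ v.val ∧ p c v) hn ?_ ?_ ⟨fun _ => 3, .const 3, fun c k _ => size_enc_prop _⟩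
  · exact this.iffProp fun c => by simp
  · exact Poly.false.iffProp fun c => by simp
  · refine iffProp (or (p := fun x : (Σ c, Fin (n c)) => p x.1 x.2) ?_ PT.refl.right) fun x => ?_
    · exact PT.refl.left.trans hp
    · constructor
      · rintro (h | ⟨v, hv, h⟩)
        · exact ⟨x.2, le_rfl, h⟩
        · exact ⟨v, by omega, h⟩
      · rintro ⟨v, hv, h⟩
        rcases hv.eq_or_lt with h' | h'
        · left; rwa [Fin.ext h']
        · exact Or.inr ⟨v, h', h⟩

theorem all {p : ∀ c, Fin (n c) → Prop} (hn : Poly i n)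
    (hp : PT (Ext i fun c => Fin (n c)) fun x => enc (p x.1 x.2)) : Poly i fun c => ∀ v, p c v :=
  (ex (p := fun c v => ¬ p c v) hn (not (p := fun x : (Σ c, Fin (n c)) => p x.1 x.2) hp)).not.iffProp fun _ => by simp

theorem sum {f : ∀ c, Fin (n c) → ℕ} (hn : Poly i n)
    (hf : PT (Ext i fun c => Fin (n c)) fun x => enc (f x.1 x.2)) : Poly i fun c => ∑ v, f c v := by
  -- The table of the values is computable and written in unary, so its size bounds all partial
  -- sums.
  have htot : PolyBdd i fun c => ∑ v, f c v := by
    have h := (tab hn hf).size_bdd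
    refine h.mono fun c => ?_
    have : ∀ l : List ℕ, l.sum ≤ (Data.list (l.map enc)).size := by
      intro l
      induction l with
      | nil => simp
      | cons a l ih =>
        simp only [List.sum_cons, List.map_cons, Data.list, Data.size, size_enc_nat]; omega
    have h2 := this (List.ofFn (f c))
    rw [List.sum_ofFn] at h2
    simpa [enc, List.map_ofFn, Function.comp_def] using h2
  have := descend (i := i) (fun c k => ∑ v : Fin (n c), if k ≤ v.val then f c v else 0) hn ?_ ?_
    ⟨_, (htot.mul (.const 2)).add (.const 1), fun c k _ => ?_⟩
  · exact this.congr fun c => by simp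
  · refine (constNat 0).congr fun c => ?_
    dsimp only
    rw [Finset.sum_eq_zero]
    intro v _
    rw [if_neg (by omega)]
  · refine (add (a := fun x : (Σ c, Fin (n c)) => f x.1 x.2) (PT.refl.left.trans hf) PT.refl.right).congr
      fun x => congrArg enc ?_
    dsimp only
    rw [← Finset.add_sum_erase _ _ (Finset.mem_univ x.2), ← Finset.add_sum_erase _ _ (Finset.mem_univ x.2)]
    simp only [if_neg (show ¬ (x.2.val + 1 ≤ x.2.val) by omega), le_refl, if_true, zero_add]
    congr 1
    refine Finset.sum_congr rfl fun v hv => ?_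
    have : v ≠ x.2 := Finset.ne_of_mem_erase hv
    have : v.val ≠ x.2.val := fun h => this (Fin.ext h)
    simp only [show (x.2.val + 1 ≤ v.val ↔ x.2.val ≤ v.val) by omega]
  · rw [size_enc_nat]
    have : (∑ v : Fin (n c), if k ≤ v.val then f c v else 0) ≤ ∑ v, f c v :=
      Finset.sum_le_sum fun v _ => by split_ifs <;> simp
    omega

theorem mul {a b : γ → ℕ} (ha : Poly i a) (hb : Poly i b) : Poly i fun c => a c * b c :=
  (sum (f := fun c (_ : Fin (a c)) => b c) ha hb.up).congr fun c => by simp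

theorem pow {a : γ → ℕ} (ha : Poly i a) (k : ℕ) : Poly i fun c => a c ^ k := by
  induction k with
  | zero => simpa using constNat 1
  | succ k ih => simpa [pow_succ] using ih.mul ha

/-- The number of indices with a given property. -/
theorem sumIte {p : ∀ c, Fin (n c) → Prop} [∀ c v, Decidable (p c v)] {f : ∀ c, Fin (n c) → ℕ}
    (hn : Poly i n) (hp : PT (Ext i fun c => Fin (n c)) fun x => enc (p x.1 x.2))
    (hf : PT (Ext i fun c => Fin (n c)) fun x => enc (f x.1 x.2)) :
    Poly i fun c => ∑ v, if p c v then f c v else 0 :=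
  sum hn (ite (p := fun x : (Σ c, Fin (n c)) => p x.1 x.2) hp (hf.sub _) (constNat 0))

end Poly

/-- The least element of `Fin n` with a given property. -/
noncomputable def least {n : ℕ} (p : Fin n → Prop) (h : ∃ v, p v) : Fin n :=
  ⟨sInf {j | ∃ hj : j < n, p ⟨j, hj⟩},
    (Nat.sInf_mem (s := {j | ∃ hj : j < n, p ⟨j, hj⟩}) ⟨h.choose, h.choose.2, h.choose_spec⟩).choose⟩

theorem least_spec {n : ℕ} (p : Fin n → Prop) (h : ∃ v, p v) : p (least p h) :=
  (Nat.sInf_mem (s := {j | ∃ hj : j < n, p ⟨j, hj⟩}) ⟨h.choose, h.choose.2, h.choose_spec⟩).choose_spec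

theorem Poly.least {n : γ → ℕ} {p : ∀ c, Fin (n c) → Prop} (h : ∀ c, ∃ v, p c v) (hn : Poly i n)
    (hp : PT (Ext i fun c => Fin (n c)) fun x => enc (p x.1 x.2)) :
    Poly i fun c => least (p c) (h c) := by
  -- The default `sInf ∅ = 0` starts the recursion; it is overwritten at the first hit from above,
  -- which exists by `h`.
  have := Poly.descend (i := i) (fun c k => sInf {j | k ≤ j ∧ ∃ hj : j < n c, p c ⟨j, hj⟩}) hn ?_ ?_
    ⟨_, ((PolyBdd.of_unary hn).mul (.const 2)).add (.const 1), fun c k _ => ?_⟩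
  · exact this.congr fun c => by simp [enc, ATSP.least]
  · refine (Poly.constNat 0).congr fun c => congrArg enc ?_
    dsimp only
    rw [show {j | n c ≤ j ∧ ∃ hj : j < n c, p c ⟨j, hj⟩} = ∅ from ?_, Nat.sInf_empty]
    ext j
    simp only [Set.mem_ofPred_eq, Set.mem_empty_iff_false, iff_false, not_and, not_exists]
    intro h1 h2; omega
  · classical
    refine (Poly.ite (p := fun x : (Σ c, Fin (n c)) => p x.1 x.2) (PT.refl.left.trans hp)
      (f := fun x => (x.2 : ℕ))
      (g := fun x => sInf {j | x.2 + 1 ≤ j ∧ ∃ hj : j < n x.1, p x.1 ⟨j, hj⟩})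
      PT.refl.left.right PT.refl.right).congr fun x => congrArg enc ?_
    dsimp only
    split_ifs with hx
    · symm
      apply le_antisymm
      · exact Nat.sInf_le ⟨le_rfl, x.2.2, hx⟩
      · exact le_csInf ⟨x.2, le_rfl, x.2.2, hx⟩ fun j hj => hj.1
    · congr 1
      ext j
      constructor
      · rintro ⟨h1, h2⟩
        exact ⟨by omega, h2⟩
      · rintro ⟨h1, h2, h3⟩
        refine ⟨lt_of_le_of_ne h1 ?_, h2, h3⟩
        rintro rfl
        exact hx h3
  · rw [size_enc_nat]
    have : sInf {j | k ≤ j ∧ ∃ hj : j < n c, p c ⟨j, hj⟩} ≤ n c := by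
      rcases Set.eq_empty_or_nonempty {j | k ≤ j ∧ ∃ hj : j < n c, p c ⟨j, hj⟩} with h | h
      · rw [h]; simp
      · obtain ⟨_, h', _⟩ := Nat.sInf_mem h
        exact h'.le
    omega

end ATSP

namespace ATSP

open Relation
open scoped Classical

/-! Connectivity and Eulerian multisets of edges -/

namespace MultiDigraph

variable {n m : ℕ} (G : MultiDigraph (Fin n) (Fin m))

/-- Undirected connectivity in `(V, F)`. -/
def Conn (F : Fin m → ℕ) : Fin n → Fin n → Prop :=
  ReflTransGen fun a b => ∃ e, F e ≠ 0 ∧ (G.tail e = a ∧ G.head e = b ∨ G.tail e = b ∧ G.head e = a)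

/-- Directed reachability along edges of the set `S`. -/
def DReach (S : Fin m → Prop) : Fin n → Fin n → Prop :=
  ReflTransGen fun a b => ∃ e, S e ∧ G.tail e = a ∧ G.head e = b

/-- No edge of `F` leaves or enters `Y`. -/
def Closed (F : Fin m → ℕ) (Y : Set (Fin n)) : Prop :=
  ∀ e, F e ≠ 0 → (G.tail e ∈ Y ↔ G.head e ∈ Y)

/-- The edges of `F` that start in `Y`. -/
noncomputable def restrict (F : Fin m → ℕ) (Y : Set (Fin n)) : Fin m → ℕ :=
  fun e => if G.tail e ∈ Y then F e else 0

variable {G} {F F' : Fin m → ℕ} {S S' : Fin m → Prop} {Y : Set (Fin n)} {u v w : Fin n}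

theorem Conn.refl (v : Fin n) : G.Conn F v v := ReflTransGen.refl

theorem Conn.symm (h : G.Conn F u v) : G.Conn F v u := by
  induction h with
  | refl => exact ReflTransGen.refl
  | tail _ hbc ih =>
    obtain ⟨e, he, h⟩ := hbc
    exact ReflTransGen.head ⟨e, he, h.symm⟩ ih

theorem Conn.trans (h : G.Conn F u v) (h' : G.Conn F v w) : G.Conn F u w := ReflTransGen.trans h h'

theorem conn_edge {e : Fin m} (h : F e ≠ 0) : G.Conn F (G.tail e) (G.head e) :=
  .single ⟨e, h, Or.inl ⟨rfl, rfl⟩⟩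

theorem Closed.mem (h : G.Closed F Y) (hc : G.Conn F u v) (hu : u ∈ Y) : v ∈ Y := by
  induction hc with
  | refl => exact hu
  | tail _ hbc ih =>
    obtain ⟨e, he, ⟨rfl, rfl⟩ | ⟨rfl, rfl⟩⟩ := hbc
    · exact (h e he).1 ih
    · exact (h e he).2 ih

theorem closed_conn (u : Fin n) : G.Closed F {v | G.Conn F u v} := fun _ he =>
  ⟨fun h => Conn.trans h (conn_edge he), fun h => Conn.trans h (conn_edge he).symm⟩

theorem Conn.of_edges (h : ∀ e, F e ≠ 0 → G.Conn F' (G.tail e) (G.head e)) (hc : G.Conn F u v) :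
    G.Conn F' u v := by
  have : G.Closed F {v | G.Conn F' u v} := fun e he =>
    ⟨fun h' => Conn.trans h' (h e he), fun h' => Conn.trans h' (h e he).symm⟩
  exact this.mem hc (Conn.refl u)

theorem Conn.mono (h : ∀ e, F e ≠ 0 → F' e ≠ 0) (hc : G.Conn F u v) : G.Conn F' u v :=
  hc.of_edges fun e he => conn_edge (h e he)

theorem Closed.anti (h : ∀ e, F e ≠ 0 → F' e ≠ 0) (hc : G.Closed F' Y) : G.Closed F Y :=
  fun e he => hc e (h e he)

theorem conn_iff_reachable : G.Conn F u v ↔ (G.graph F).Reachable u v := by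
  rw [SimpleGraph.reachable_iff_reflTransGen]
  constructor
  · intro h
    refine ReflTransGen.mono ?_ _ _ h
    rintro a b ⟨e, he, ⟨rfl, rfl⟩ | ⟨rfl, rfl⟩⟩
    · exact ⟨G.loopless e, Or.inl ⟨e, he, rfl, rfl⟩⟩
    · exact ⟨(G.loopless e).symm, Or.inr ⟨e, he, rfl, rfl⟩⟩
  · intro h
    refine ReflTransGen.mono ?_ _ _ h
    rintro a b ⟨_, ⟨e, he, rfl, rfl⟩ | ⟨e, he, rfl, rfl⟩⟩
    · exact ⟨e, he, Or.inl ⟨rfl, rfl⟩⟩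
    · exact ⟨e, he, Or.inr ⟨rfl, rfl⟩⟩

theorem DReach.trans (h : G.DReach S u v) (h' : G.DReach S v w) : G.DReach S u w :=
  ReflTransGen.trans h h'

theorem DReach.edge {e : Fin m} (h : S e) : G.DReach S (G.tail e) (G.head e) :=
  .single ⟨e, h, rfl, rfl⟩

theorem DReach.mono (h : ∀ e, S e → S' e) (hc : G.DReach S u v) : G.DReach S' u v :=
  ReflTransGen.mono (fun _ _ ⟨e, he, h'⟩ => ⟨e, h e he, h'⟩) _ _ hc

theorem eulerian_zero : G.Eulerian (0 : Fin m → ℕ) := fun v => by simp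

theorem Eulerian.add (h : G.Eulerian F) (h' : G.Eulerian F') : G.Eulerian (F + F') := fun v => by
  simp only [Pi.add_apply, Finset.sum_add_distrib, h v, h' v]

theorem eulerian_sum {ι : Type} (s : Finset ι) (K : ι → Fin m → ℕ) (h : ∀ i ∈ s, G.Eulerian (K i)) :
    G.Eulerian (∑ i ∈ s, K i) := by
  induction s using Finset.induction_on with
  | empty => simpa using eulerian_zero
  | insert i s hi ih =>
    rw [Finset.sum_insert hi]
    exact (h i (by simp)).add (ih fun j hj => h j (by simp [hj]))

theorem Eulerian.restrict (h : G.Eulerian F) (hY : G.Closed F Y) : G.Eulerian (G.restrict F Y) := by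
  intro v
  by_cases hv : v ∈ Y
  · rw [show (∑ e with G.head e = v, G.restrict F Y e) = ∑ e with G.head e = v, F e from ?_, h v]
    · refine Finset.sum_congr rfl fun e he => ?_
      simp only [Finset.mem_filter, Finset.mem_univ, true_and] at he
      simp [MultiDigraph.restrict, he, hv]
    · refine Finset.sum_congr rfl fun e he => ?_
      simp only [Finset.mem_filter, Finset.mem_univ, true_and] at he
      simp only [MultiDigraph.restrict]
      split_ifs with ht
      · rfl
      · by_contra h0
        exact ht ((hY e (Ne.symm h0)).2 (he ▸ hv))
  · rw [Finset.sum_eq_zero, Finset.sum_eq_zero]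
    · intro e he
      simp only [Finset.mem_filter, Finset.mem_univ, true_and] at he
      simp [MultiDigraph.restrict, he, hv]
    · intro e he
      simp only [Finset.mem_filter, Finset.mem_univ, true_and] at he
      simp only [MultiDigraph.restrict]
      split_ifs with ht
      · by_contra h0
        exact hv (he ▸ (hY e h0).1 ht)
      · rfl

theorem restrict_ne_zero {e : Fin m} : G.restrict F Y e ≠ 0 ↔ G.tail e ∈ Y ∧ F e ≠ 0 := by
  simp [restrict]

theorem Eulerian.sum_eq (h : G.Eulerian F) (Y : Set (Fin n)) :
    ∑ e with G.head e ∈ Y, F e = ∑ e with G.tail e ∈ Y, F e := by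
  have key : ∀ f : Fin m → Fin n, ∑ e with f e ∈ Y, F e = ∑ v with v ∈ Y, ∑ e with f e = v, F e := by
    intro f
    rw [Finset.sum_comm' (t' := Finset.univ.filter fun e => f e ∈ Y) (s' := fun e => {f e})]
    · simp
    · intro v e
      simp only [Finset.mem_filter, Finset.mem_univ, true_and, Finset.mem_singleton]
      constructor
      · rintro ⟨h1, rfl⟩; exact ⟨rfl, h1⟩
      · rintro ⟨rfl, h1⟩; exact ⟨h1, rfl⟩
  rw [key G.head, key G.tail]
  exact Finset.sum_congr rfl fun v _ => h v

/-- If no edge of an Eulerian multiset leaves `Y`, then none enters `Y`. -/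
theorem Eulerian.no_entering (h : G.Eulerian F)
    (hY : ∀ e, F e ≠ 0 → G.tail e ∈ Y → G.head e ∈ Y) {e : Fin m} (he : F e ≠ 0)
    (hh : G.head e ∈ Y) : G.tail e ∈ Y := by
  by_contra ht
  have h1 := h.sum_eq Y
  -- Every edge that starts in `Y` also ends there, while `e` ends there without starting there;
  -- this would make the heads in `Y` outnumber the tails.
  have h2 : ∑ e with G.tail e ∈ Y, F e ≤ ∑ e' ∈ (Finset.univ.filter fun e => G.head e ∈ Y).erase e, F e' := by
    refine (Finset.sum_le_sum_of_ne_zero fun e' he' h0 => ?_)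
    simp only [Finset.mem_filter, Finset.mem_univ, true_and, Finset.mem_erase] at he' ⊢
    exact ⟨fun h' => ht (h' ▸ he'), hY e' h0 he'⟩
  have h3 := Finset.add_sum_erase (Finset.univ.filter fun e => G.head e ∈ Y) F (a := e) (by simp [hh])
  omega

/-- The set reachable from the head is left by no edge, hence entered by none, and so it contains
the tail. -/
theorem Eulerian.dreach_edge (h : G.Eulerian F) {e : Fin m} (he : F e ≠ 0) :
    G.DReach (fun e => F e ≠ 0) (G.head e) (G.tail e) :=
  h.no_entering (Y := {v | G.DReach (fun e => F e ≠ 0) (G.head e) v})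
    (fun _ h0 ht => DReach.trans ht (.edge h0)) he ReflTransGen.refl

/-- Connected Eulerian multisets are strongly connected. In the cost analysis this prevents an
entity from being charged twice. -/
theorem Eulerian.dreach (h : G.Eulerian F) (hc : G.Conn F u v) : G.DReach (fun e => F e ≠ 0) u v := by
  induction hc with
  | refl => exact ReflTransGen.refl
  | tail _ hbc ih =>
    obtain ⟨e, he, ⟨rfl, rfl⟩ | ⟨rfl, rfl⟩⟩ := hbc
    · exact ih.trans (.edge he)
    · exact ih.trans (h.dreach_edge he)

/-! Simple paths and cycles -/

variable (G) in
/-- `P` is the edge set of a simple path from `u` to `v`. -/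
inductive IsPath (u : Fin n) : Finset (Fin m) → Fin n → Prop
  | nil : IsPath u ∅ u
  | snoc {P : Finset (Fin m)} {e : Fin m} : IsPath u P (G.tail e) → G.head e ≠ u →
      (∀ e' ∈ P, G.head e' ≠ G.head e) → IsPath u (insert e P) (G.head e)

theorem IsPath.prefix {P : Finset (Fin m)} (h : G.IsPath u P v) {e : Fin m} (he : e ∈ P) :
    ∃ P' ⊆ P, G.IsPath u P' (G.head e) := by
  induction h with
  | nil => simp at he
  | @snoc P e' hP h1 h2 ih =>
    rcases Finset.mem_insert.1 he with rfl | he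
    · exact ⟨_, subset_rfl, .snoc hP h1 h2⟩
    · obtain ⟨P', hP', h'⟩ := ih he
      exact ⟨P', hP'.trans (Finset.subset_insert _ _), h'⟩

theorem DReach.exists_isPath (h : G.DReach S u v) : ∃ P, G.IsPath u P v ∧ ∀ e ∈ P, S e := by
  induction h with
  | refl => exact ⟨∅, .nil, by simp⟩
  | tail _ hbc ih =>
    obtain ⟨e, he, rfl, rfl⟩ := hbc
    obtain ⟨P, hP, hS⟩ := ih
    by_cases h1 : G.head e = u
    · exact ⟨∅, h1 ▸ .nil, by simp⟩
    by_cases h2 : ∃ e' ∈ P, G.head e' = G.head e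
    · obtain ⟨e', he', h2⟩ := h2
      obtain ⟨P', hP', h'⟩ := hP.prefix he'
      exact ⟨P', h2 ▸ h', fun f hf => hS f (hP' hf)⟩
    · push Not at h2
      refine ⟨_, .snoc hP h1 h2, fun f hf => ?_⟩
      rcases Finset.mem_insert.1 hf with rfl | hf
      exacts [he, hS f hf]

theorem IsPath.dreach {P : Finset (Fin m)} (h : G.IsPath u P v) : G.DReach (· ∈ P) u v := by
  induction h with
  | nil => exact ReflTransGen.refl
  | @snoc P e' hP h1 h2 ih =>
    exact (ih.mono fun e he => Finset.mem_insert_of_mem he).trans (.edge (Finset.mem_insert_self _ _))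

theorem IsPath.head_ne {P : Finset (Fin m)} (h : G.IsPath u P v) : ∀ e ∈ P, G.head e ≠ u := by
  induction h with
  | nil => simp
  | snoc hP h1 h2 ih =>
    intro f hf
    rcases Finset.mem_insert.1 hf with rfl | hf
    exacts [h1, ih f hf]

theorem IsPath.head_inj {P : Finset (Fin m)} (h : G.IsPath u P v) :
    ∀ e ∈ P, ∀ e' ∈ P, G.head e = G.head e' → e = e' := by
  induction h with
  | nil => simp
  | snoc hP h1 h2 ih =>
    intro f hf f' hf' hff
    rcases Finset.mem_insert.1 hf with rfl | hf1 <;> rcases Finset.mem_insert.1 hf' with rfl | hf1'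
    · rfl
    · exact absurd hff.symm (h2 _ hf1')
    · exact absurd hff (h2 _ hf1)
    · exact ih f hf1 f' hf1' hff

theorem card_filter_insert {P : Finset (Fin m)} {e : Fin m} (he : e ∉ P) (f : Fin m → Fin n) (w : Fin n) :
    ((insert e P).filter fun e => f e = w).card =
      (P.filter fun e => f e = w).card + if w = f e then 1 else 0 := by
  rw [Finset.filter_insert]
  by_cases h : f e = w
  · rw [if_pos h, if_pos h.symm, Finset.card_insert_of_notMem (by simp [he])]
  · rw [if_neg h, if_neg (Ne.symm h), add_zero]

theorem IsPath.balance {P : Finset (Fin m)} (h : G.IsPath u P v) (w : Fin n) :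
    (P.filter fun e => G.head e = w).card + (if w = u then 1 else 0) =
      (P.filter fun e => G.tail e = w).card + (if w = v then 1 else 0) := by
  induction h with
  | nil => simp
  | @snoc P e hP h1 h2 ih =>
    have he : e ∉ P := fun he => h2 e he rfl
    rw [card_filter_insert he, card_filter_insert he]
    omega

variable (G) in
/-- The edges that remain after the first `k` edges have been tested: an edge is deleted
if `v` remains reachable from `u` without it. -/
def pruneAux (S : Fin m → Prop) (u v : Fin n) : ℕ → Fin m → Prop
  | 0 => S
  | k + 1 => fun e => pruneAux S u v k e ∧
      (e.val = k → ¬ G.DReach (fun e' => pruneAux S u v k e' ∧ e'.val ≠ k) u v)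

variable (G) in
/-- A minimal subset of `S` along which `v` is reachable from `u`. -/
def prune (S : Fin m → Prop) (u v : Fin n) : Fin m → Prop := G.pruneAux S u v m

theorem pruneAux_anti {k l : ℕ} (h : k ≤ l) {e : Fin m} (he : G.pruneAux S u v l e) :
    G.pruneAux S u v k e := by
  induction h with
  | refl => exact he
  | step _ ih => exact ih he.1

theorem pruneAux_dreach (h : G.DReach S u v) (k : ℕ) : G.DReach (G.pruneAux S u v k) u v := by
  induction k with
  | zero => exact h
  | succ k ih =>
    by_cases hk : G.DReach (fun e' => G.pruneAux S u v k e' ∧ e'.val ≠ k) u v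
    · exact hk.mono fun e he => ⟨he.1, fun h' => absurd h' he.2⟩
    · exact ih.mono fun e he => ⟨he, fun _ => hk⟩

/-- The surviving edges contain a simple path. A survivor off this path would have been deleted when
it was tested, since the path was already available then; so the survivors form the path. This makes
the choice of a path a computable function. -/
theorem exists_isPath_prune (h : G.DReach S u v) :
    ∃ P, G.IsPath u P v ∧ (∀ e, G.prune S u v e ↔ e ∈ P) ∧ ∀ e ∈ P, S e := by
  obtain ⟨P, hP, hPS⟩ := (pruneAux_dreach h m).exists_isPath
  refine ⟨P, hP, fun e => ⟨fun he => ?_, fun he => hPS e he⟩, fun e he => pruneAux_anti (Nat.zero_le m) (hPS e he)⟩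
  by_contra heP
  refine (pruneAux_anti (k := e + 1) e.2 he).2 rfl (hP.dreach.mono fun e' he' => ⟨?_, ?_⟩)
  · exact pruneAux_anti e.2.le (hPS e' he')
  · intro h'; exact heP (Fin.ext h' ▸ he')

variable (G) in
/-- The edge `e₀` together with a simple path in `S` from its head to its tail. -/
noncomputable def cycle (S : Fin m → Prop) (e₀ : Fin m) : Fin m → ℕ :=
  fun e => if e = e₀ ∨ G.prune S (G.head e₀) (G.tail e₀) e then 1 else 0

theorem cycle_le_one (e₀ e : Fin m) : G.cycle S e₀ e ≤ 1 := by
  unfold cycle; split_ifs <;> simp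

theorem cycle_self (e₀ : Fin m) : G.cycle S e₀ e₀ ≠ 0 := by simp [cycle]

theorem cycle_subset {e₀ e : Fin m} (h₀ : S e₀) (he : G.cycle S e₀ e ≠ 0) : S e := by
  unfold cycle at he
  split_ifs at he with h
  · rcases h with rfl | h
    · exact h₀
    · exact pruneAux_anti (Nat.zero_le m) h
  · exact absurd rfl he

theorem exists_cycle_eq {e₀ : Fin m} (h : G.DReach S (G.head e₀) (G.tail e₀)) : ∃ P, G.IsPath (G.head e₀) P (G.tail e₀) ∧ e₀ ∉ P ∧
    ∀ e, G.cycle S e₀ e = if e ∈ insert e₀ P then 1 else 0 := by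
  obtain ⟨P, hP, h1, h2⟩ := exists_isPath_prune h
  exact ⟨P, hP, fun h' => hP.head_ne e₀ h' rfl, fun e => by simp [cycle, h1]⟩

theorem sum_cycle_eq {e₀ : Fin m} {P : Finset (Fin m)} (hP : ∀ e, G.cycle S e₀ e = if e ∈ insert e₀ P then 1 else 0)
    (f : Fin m → Fin n) (w : Fin n) :
    ∑ e with f e = w, G.cycle S e₀ e = ((insert e₀ P).filter fun e => f e = w).card := by
  simp only [hP, Finset.sum_ite, Finset.sum_const_zero, add_zero, Finset.sum_const, smul_eq_mul, mul_one]
  congr 1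
  ext e
  simp [and_comm]

theorem eulerian_cycle {e₀ : Fin m} (h : G.DReach S (G.head e₀) (G.tail e₀)) : G.Eulerian (G.cycle S e₀) := by
  obtain ⟨P, hP, h0, h1⟩ := exists_cycle_eq h
  intro w
  rw [sum_cycle_eq h1, sum_cycle_eq h1]
  have hb := hP.balance w
  rw [card_filter_insert h0, card_filter_insert h0]
  exact hb

/-- The heads on a simple path are distinct and differ from its start, so the cycle enters each
vertex at most once, and by balance it leaves each at most once. This bounds its cost by the weight
of its vertices. -/
theorem cycle_out_le_one {e₀ : Fin m} (h : G.DReach S (G.head e₀) (G.tail e₀)) (w : Fin n) : ∑ e with G.tail e = w, G.cycle S e₀ e ≤ 1 := by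
  obtain ⟨P, hP, h0, h1⟩ := exists_cycle_eq h
  rw [← eulerian_cycle h w, sum_cycle_eq h1, Finset.card_le_one]
  intro e he e' he'
  simp only [Finset.mem_filter, Finset.mem_insert] at he he'
  obtain ⟨rfl | he, hw⟩ := he <;> obtain ⟨rfl | he', hw'⟩ := he'
  · rfl
  · exact absurd (hw'.trans hw.symm) (hP.head_ne _ he')
  · exact absurd (hw.trans hw'.symm) (hP.head_ne _ he)
  · exact hP.head_inj e he e' he' (hw.trans hw'.symm)

theorem cycle_conn {e₀ e : Fin m} (h : G.DReach S (G.head e₀) (G.tail e₀))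
    (he : G.cycle S e₀ e ≠ 0) :
    G.Conn (G.cycle S e₀) (G.tail e) (G.tail e₀) := by
  obtain ⟨P, hP, h0, h1⟩ := exists_cycle_eq h
  have hsub : ∀ f ∈ P, G.cycle S e₀ f ≠ 0 := fun f hf => by simp [h1, hf]
  have key : ∀ (Q : Finset (Fin m)) w, G.IsPath (G.head e₀) Q w → Q ⊆ P →
      G.Conn (G.cycle S e₀) (G.head e₀) w ∧ ∀ f ∈ Q, G.Conn (G.cycle S e₀) (G.head e₀) (G.tail f) := by
    intro Q w hQ hQP
    induction hQ with
    | nil => exact ⟨Conn.refl _, by simp⟩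
    | @snoc Q e hQ h1 h2 ih =>
      obtain ⟨ih1, ih2⟩ := ih ((Finset.subset_insert _ _).trans hQP)
      refine ⟨ih1.trans (conn_edge (hsub e (hQP (by simp)))), fun f hf => ?_⟩
      rcases Finset.mem_insert.1 hf with rfl | hf
      exacts [ih1, ih2 f hf]
  obtain ⟨k1, k2⟩ := key P _ hP subset_rfl
  rw [h1] at he
  have he : e ∈ insert e₀ P := by by_contra h'; simp [h'] at he
  rcases Finset.mem_insert.1 he with rfl | he
  · exact Conn.refl _
  · exact (k2 e he).symm.trans k1

end MultiDigraph

end ATSP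

namespace ATSP

open Relation MultiDigraph
open scoped Classical

/-! The algorithm on an abstract instance -/

namespace MultiDigraph

variable {n m : ℕ} {G : MultiDigraph (Fin n) (Fin m)} {F F' : Fin m → ℕ} {Y : Set (Fin n)} {u v : Fin n}

theorem Conn.restrict (hY : G.Closed F Y) (hu : u ∈ Y) (h : G.Conn F u v) :
    G.Conn (G.restrict F Y) u v := by
  have : G.Closed F {w | w ∈ Y → G.Conn (G.restrict F Y) u w} := by
    intro e he
    constructor
    · intro h1 h2
      have := (hY e he).2 h2
      exact (h1 this).trans (conn_edge (restrict_ne_zero.2 ⟨this, he⟩))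
    · intro h1 h2
      exact (h1 ((hY e he).1 h2)).trans (conn_edge (restrict_ne_zero.2 ⟨h2, he⟩)).symm
  exact this.mem h (fun _ => Conn.refl u) (hY.mem h hu)

/-- The vertices from which edges of `F` start. -/
def verts (G : MultiDigraph (Fin n) (Fin m)) (F : Fin m → ℕ) : Set (Fin n) :=
  {v | ∃ e, F e ≠ 0 ∧ G.tail e = v}

end MultiDigraph

/-- The data on which the algorithm operates: the backbone, the edges `A` that neither touch the
backbone nor cross large laminar sets, those edges `Ac` that may be used for cycles, vertex
weights, and an algorithm for Subtour Cover. -/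
structure Setup (n m : ℕ) where
  G : MultiDigraph (Fin n) (Fin m)
  VB : Set (Fin n)
  EB : Fin m → ℕ
  A : Fin m → Prop
  Ac : Fin m → Prop
  ℓ : Fin n → ℕ
  orc : (Fin m → ℕ) → Fin m → ℕ
  d : ℕ

/-- The vertices are partitioned into entities, represented by `id`. Every vertex knows the edges
`K` and the original weight `w` of its entity. -/
structure St (n m : ℕ) where
  id : Fin n → Fin n
  K : Fin n → Fin m → ℕ
  w : Fin n → ℕ
  H : Fin m → ℕ
  X : Fin m → ℕ
  done : Prop

/-! ### Entities, restarts, steps of the algorithm, and their invariants. -/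

namespace Setup

variable {n m : ℕ} (C : Setup n m) (s : St n m)

noncomputable def wt (U : Set (Fin n)) : ℕ := ∑ v, if v ∈ U then C.ℓ v else 0

def own (s : St n m) (v : Fin n) : Set (Fin n) := {u | s.id u = s.id v}

/-- The component of `u` in the current Subtour Cover solution joins components of `H`. -/
def useful : Set (Fin n) := {u | ∃ u', C.G.Conn (C.orc s.H) u u' ∧ ¬ C.G.Conn s.H u u'}

/-- The vertices of the useful components off the backbone whose heaviest entity is that of `v`. -/
def attached (v : Fin n) : Set (Fin n) :=
  {u | (∀ b ∈ C.VB, ¬ C.G.Conn (C.orc s.H) u b) ∧ u ∈ C.useful s ∧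
    (∃ u', C.G.Conn (C.orc s.H) u u' ∧ s.id u' = s.id v) ∧
    ∀ u', C.G.Conn (C.orc s.H) u u' → s.w u' ≤ s.w v}

/-- The surplus `2/d` in the threshold `1 + 2/d` makes up for the fraction `1/d` that the entity may
have lost since its creation; see `bad_cost`. -/
def bad (v : Fin n) : Prop :=
  v ∉ C.VB ∧ (C.d + 2) * s.w v ≤ C.d * C.wt (C.attached s v \ own s v)

/-- All edges collected so far, together with the backbone. -/
def merged : Fin m → ℕ := s.H + C.orc s.H + s.X + C.EB

def outside (z : Fin n) : Prop := ∀ b ∈ C.VB, ¬ C.G.Conn (C.merged s) z b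

def top (t : Fin n) : Prop :=
  C.outside s t ∧ ∀ u, C.G.Conn (C.merged s) t u → s.w u ≤ s.w t

/-- Any other component off the backbone has a top at least as heavy, which can take over after a
union. -/
def lowest (t : Fin n) : Prop := C.top s t ∧ ∀ t', C.top s t' → s.w t ≤ s.w t'

/-- The edges between vertices of weight at most `τ` that may be used for cycles. -/
def light (τ : ℕ) (e : Fin m) : Prop :=
  C.Ac e ∧ s.w (C.G.tail e) ≤ τ ∧ s.w (C.G.head e) ≤ τ

/-- A chord gives a cycle through light vertices that joins the component of `t` to another one.
Without chords, light strong components do not cross its boundary, and it is safe to finalize. -/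
def chord (t : Fin n) (e : Fin m) : Prop :=
  C.light s (s.w t) e ∧ C.G.DReach (C.light s (s.w t)) (C.G.head e) (C.G.tail e) ∧
    ¬ (C.G.Conn (C.merged s) t (C.G.tail e) ↔ C.G.Conn (C.merged s) t (C.G.head e))

/-- A big cycle raises the potential when it becomes an entity; the cost of any other one can be
paid by a single entity. -/
def big (F : Fin m → ℕ) : Prop :=
  ∀ e, F e ≠ 0 → (C.d + 1) * s.w (C.G.tail e) ≤ C.d * C.wt (C.G.verts F)

/-- The entity of `v` has not lost too much when it loses `U`. -/
def alive (U : Set (Fin n)) (v : Fin n) : Prop :=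
  C.d * s.w v ≤ C.d * C.wt (own s v \ U) + s.w v

def newClass (U : Set (Fin n)) (v : Fin n) : Set (Fin n) :=
  {u | (v ∈ U ∧ u ∈ U) ∨ (v ∉ U ∧ C.alive s U v ∧ u ∈ own s v \ U) ∨
    (v ∉ U ∧ ¬ C.alive s U v ∧ u = v)}

theorem mem_newClass (U : Set (Fin n)) (v : Fin n) : v ∈ C.newClass s U v := by
  by_cases h : v ∈ U
  · exact Or.inl ⟨h, h⟩
  · by_cases h' : C.alive s U v
    · exact Or.inr (Or.inl ⟨h, h', rfl, h⟩)
    · exact Or.inr (Or.inr ⟨h, h', rfl⟩)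

noncomputable def newId (U : Set (Fin n)) (v : Fin n) : Fin n :=
  least (fun u => u ∈ C.newClass s U v) ⟨v, C.mem_newClass s U v⟩

/-- A surviving entity keeps all its edges, even those that now run through `U`, since they still
connect what is left of it. -/
noncomputable def newK (U : Set (Fin n)) (K : Fin m → ℕ) (v : Fin n) : Fin m → ℕ :=
  if v ∈ U then K else if C.alive s U v then s.K v else 0

/-- Make `U` with the edges `K` a new entity and start again. -/
noncomputable def restart (U : Set (Fin n)) (K : Fin m → ℕ) : St n m where
  id := C.newId s U
  K := C.newK s U K
  w v := if v ∈ U then C.wt U else if C.alive s U v then s.w v else C.ℓ v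
  H e := ∑ v, if C.newId s U v = v then C.newK s U K v e else 0
  X := 0
  done := False

/-- Solution components that join nothing are omitted: `H` already connects their vertices, and
nobody would pay for them. -/
noncomputable def finalEdges (t : Fin n) : Fin m → ℕ :=
  C.G.restrict (s.X + C.G.restrict (C.orc s.H) (C.useful s)) {u | C.G.Conn (C.merged s) t u}

/-- All choices are made by `least`, so that a program can reproduce them. When `H` grows, the
cycles outside the finalized component are discarded with the old solution. -/
noncomputable def step : St n m :=
  if s.done then s
  else if h : ∃ v, C.bad s v then
    C.restart s (own s (least _ h) ∪ C.attached s (least _ h))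
      (s.K (least _ h) + C.G.restrict (C.orc s.H) (C.attached s (least _ h)))
  else if ht : ∃ t, C.lowest s t then
    if hc : ∃ e, C.chord s (least _ ht) e then
      if C.big s (C.G.cycle (C.light s (s.w (least _ ht))) (least _ hc)) then
        C.restart s (C.G.verts (C.G.cycle (C.light s (s.w (least _ ht))) (least _ hc)))
          (C.G.cycle (C.light s (s.w (least _ ht))) (least _ hc))
      else { s with X := s.X + C.G.cycle (C.light s (s.w (least _ ht))) (least _ hc) }
    else { s with H := s.H + C.finalEdges s (least _ ht), X := 0 }
  else { s with H := s.H + C.orc s.H + s.X, done := True }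

noncomputable def init : St n m where
  id v := v
  K := 0
  w := C.ℓ
  H := 0
  X := 0
  done := False

/-- A case analysis of one step. -/
theorem step_cases {P : St n m → Prop} (hs : ¬ s.done)
    (h1 : ∀ v, C.bad s v → P (C.restart s (own s v ∪ C.attached s v)
      (s.K v + C.G.restrict (C.orc s.H) (C.attached s v))))
    (h2 : ∀ t e, (∀ v, ¬ C.bad s v) → C.lowest s t → C.chord s t e →
      C.big s (C.G.cycle (C.light s (s.w t)) e) →
      P (C.restart s (C.G.verts (C.G.cycle (C.light s (s.w t)) e)) (C.G.cycle (C.light s (s.w t)) e)))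
    (h3 : ∀ t e, (∀ v, ¬ C.bad s v) → C.lowest s t → C.chord s t e →
      ¬ C.big s (C.G.cycle (C.light s (s.w t)) e) →
      P { s with X := s.X + C.G.cycle (C.light s (s.w t)) e })
    (h4 : ∀ t, (∀ v, ¬ C.bad s v) → C.lowest s t → (∀ e, ¬ C.chord s t e) →
      P { s with H := s.H + C.finalEdges s t, X := 0 })
    (h5 : (∀ v, ¬ C.bad s v) → (∀ t, ¬ C.lowest s t) →
      P { s with H := s.H + C.orc s.H + s.X, done := True }) : P (C.step s) := by
  unfold step
  rw [if_neg hs]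
  split_ifs with a b c e
  · exact h1 _ (least_spec _ a)
  · exact h2 _ _ (not_exists.1 a) (least_spec _ b) (least_spec _ c) e
  · exact h3 _ _ (not_exists.1 a) (least_spec _ b) (least_spec _ c) e
  · exact h4 _ (not_exists.1 a) (least_spec _ b) (not_exists.1 c)
  · exact h5 (not_exists.1 a) (not_exists.1 b)

structure Valid : Prop where
  two_le_d : 2 ≤ C.d
  EB_endpoints : ∀ e, C.EB e ≠ 0 → C.G.tail e ∈ C.VB ∧ C.G.head e ∈ C.VB
  EB_eulerian : C.G.Eulerian C.EB
  EB_conn : ∀ a ∈ C.VB, ∀ b ∈ C.VB, C.G.Conn C.EB a b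
  A_endpoints : ∀ e, C.A e → C.G.tail e ∉ C.VB ∧ C.G.head e ∉ C.VB
  Ac_sub : ∀ e, C.Ac e → C.A e
  ℓ_pos : ∀ v ∉ C.VB, 1 ≤ C.ℓ v
  orc_eulerian : ∀ H, C.G.Eulerian H → (∀ e, H e ≠ 0 → C.A e) → C.G.Eulerian (C.orc H)
  orc_covers : ∀ H, C.G.Eulerian H → (∀ e, H e ≠ 0 → C.A e) → ∀ v ∉ C.VB,
    ∃ e, C.orc H e ≠ 0 ∧ ¬ (C.G.Conn H v (C.G.tail e) ↔ C.G.Conn H v (C.G.head e))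
  orc_sub : ∀ H, C.G.Eulerian H → (∀ e, H e ≠ 0 → C.A e) → ∀ e, C.orc H e ≠ 0 →
    (∀ b ∈ C.VB, ¬ C.G.Conn (C.orc H) (C.G.tail e) b) → C.A e

/-- By `w_le` and `le_w` the current weight of an entity lies between `(1 - 1/d) w` and `w`. By
`VB_own` backbone vertices remain entities of their own. -/
structure Inv : Prop where
  id_id : ∀ v, s.id (s.id v) = s.id v
  w_eq : ∀ u v, s.id u = s.id v → s.w u = s.w v
  K_eq : ∀ u v, s.id u = s.id v → s.K u = s.K v
  K_eulerian : ∀ v, C.G.Eulerian (s.K v)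
  K_sub : ∀ v e, s.K v e ≠ 0 → C.A e
  K_conn : ∀ u v, s.id u = s.id v → C.G.Conn (s.K v) u v
  w_le : ∀ v, C.d * s.w v ≤ C.d * C.wt (own s v) + s.w v
  le_w : ∀ v, C.wt (own s v) ≤ s.w v
  VB_own : ∀ v ∈ C.VB, ∀ u, s.id u = s.id v → u = v
  H_eulerian : C.G.Eulerian s.H
  H_sub : ∀ e, s.H e ≠ 0 → C.A e
  K_le_H : ∀ v e, s.K v e ≠ 0 → s.H e ≠ 0
  X_eulerian : C.G.Eulerian s.X
  X_sub : ∀ e, s.X e ≠ 0 → C.A e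

variable {C s}

theorem wt_mono {U U' : Set (Fin n)} (h : U ⊆ U') : C.wt U ≤ C.wt U' := by
  refine Finset.sum_le_sum fun v _ => ?_
  by_cases hv : v ∈ U
  · rw [if_pos hv, if_pos (h hv)]
  · rw [if_neg hv]; exact Nat.zero_le _

theorem wt_diff_add_inter (U U' : Set (Fin n)) : C.wt (U \ U') + C.wt (U ∩ U') = C.wt U := by
  rw [wt, wt, wt, ← Finset.sum_add_distrib]
  refine Finset.sum_congr rfl fun v _ => ?_
  by_cases h : v ∈ U <;> by_cases h' : v ∈ U' <;> simp [h, h']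

theorem wt_union (U U' : Set (Fin n)) : C.wt (U ∪ U') = C.wt U + C.wt (U' \ U) := by
  rw [wt, wt, wt, ← Finset.sum_add_distrib]
  refine Finset.sum_congr rfl fun v _ => ?_
  by_cases h : v ∈ U <;> by_cases h' : v ∈ U' <;> simp [h, h']

theorem le_wt {U : Set (Fin n)} {v : Fin n} (h : v ∈ U) : C.ℓ v ≤ C.wt U := by
  have := Finset.single_le_sum (f := fun v => if v ∈ U then C.ℓ v else 0) (fun _ _ => Nat.zero_le _)
    (Finset.mem_univ v)
  rwa [if_pos h] at this

theorem wt_singleton (v : Fin n) : C.wt {v} = C.ℓ v := by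
  simp [wt]

theorem Inv.w_pos (h : C.Inv s) (hC : C.Valid) {v : Fin n} (hv : v ∉ C.VB) : 1 ≤ s.w v :=
  (hC.ℓ_pos v hv).trans ((le_wt (U := own s v) rfl).trans (h.le_w v))

theorem newClass_eq (hs : C.Inv s) {U : Set (Fin n)} {u v : Fin n} (h : u ∈ C.newClass s U v) :
    C.newClass s U u = C.newClass s U v := by
  rcases h with ⟨h1, h2⟩ | ⟨h1, h2, h3, h4⟩ | ⟨h1, h2, rfl⟩
  · ext x; simp [newClass, h1, h2]
  · have ho : own s u = own s v := by
      ext x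
      simp only [own, Set.mem_ofPred_eq] at h3 ⊢
      rw [h3]
    have hw := hs.w_eq _ _ h3
    have ha : C.alive s U u ↔ C.alive s U v := by rw [alive, alive, ho, hw]
    ext x
    simp only [newClass, Set.mem_ofPred_eq, ho, ha, h1, h2, h4]
    simp
  · rfl

theorem newId_mem (U : Set (Fin n)) (v : Fin n) : C.newId s U v ∈ C.newClass s U v :=
  least_spec (fun u => u ∈ C.newClass s U v) _

theorem newId_congr {U : Set (Fin n)} {u v : Fin n} (h : C.newClass s U u = C.newClass s U v) :
    C.newId s U u = C.newId s U v := by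
  unfold newId
  congr 1

theorem newId_eq_iff (hs : C.Inv s) {U : Set (Fin n)} {u v : Fin n} :
    C.newId s U u = C.newId s U v ↔ u ∈ C.newClass s U v := by
  constructor
  · intro h
    have h1 := newClass_eq hs (newId_mem (C := C) (s := s) U u)
    have h2 := newClass_eq hs (newId_mem (C := C) (s := s) U v)
    rw [← h2, ← h, h1]
    exact C.mem_newClass s U u
  · exact fun h => newId_congr (newClass_eq hs h)

theorem own_restart (hs : C.Inv s) (U : Set (Fin n)) (K : Fin m → ℕ) (v : Fin n) :
    own (C.restart s U K) v = C.newClass s U v :=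
  Set.ext fun _ => newId_eq_iff hs

theorem newClass_of_mem {U : Set (Fin n)} {v : Fin n} (h : v ∈ U) : C.newClass s U v = U := by
  ext x; simp [newClass, h]

theorem newClass_of_alive {U : Set (Fin n)} {v : Fin n} (h : v ∉ U) (h' : C.alive s U v) :
    C.newClass s U v = own s v \ U := by
  ext x; simp [newClass, h, h']

theorem newClass_of_dead {U : Set (Fin n)} {v : Fin n} (h : v ∉ U) (h' : ¬ C.alive s U v) :
    C.newClass s U v = {v} := by
  ext x; simp [newClass, h, h']

theorem restart_w_of_mem {U : Set (Fin n)} {K : Fin m → ℕ} {v : Fin n} (h : v ∈ U) :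
    (C.restart s U K).w v = C.wt U := by simp [restart, h]

theorem restart_w_of_alive {U : Set (Fin n)} {K : Fin m → ℕ} {v : Fin n} (h : v ∉ U)
    (h' : C.alive s U v) : (C.restart s U K).w v = s.w v := by simp [restart, h, h']

theorem restart_w_of_dead {U : Set (Fin n)} {K : Fin m → ℕ} {v : Fin n} (h : v ∉ U)
    (h' : ¬ C.alive s U v) : (C.restart s U K).w v = C.ℓ v := by simp [restart, h, h']

theorem newK_of_mem {U : Set (Fin n)} {K : Fin m → ℕ} {v : Fin n} (h : v ∈ U) :
    C.newK s U K v = K := by simp [newK, h]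

theorem newK_of_alive {U : Set (Fin n)} {K : Fin m → ℕ} {v : Fin n} (h : v ∉ U)
    (h' : C.alive s U v) : C.newK s U K v = s.K v := by simp [newK, h, h']

theorem newK_of_dead {U : Set (Fin n)} {K : Fin m → ℕ} {v : Fin n} (h : v ∉ U)
    (h' : ¬ C.alive s U v) : C.newK s U K v = 0 := by simp [newK, h, h']

theorem newClass_cases (U : Set (Fin n)) (v : Fin n) :
    v ∈ U ∨ (v ∉ U ∧ C.alive s U v) ∨ (v ∉ U ∧ ¬ C.alive s U v) := by tauto

theorem restart_H_eq (U : Set (Fin n)) (K : Fin m → ℕ) :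
    (C.restart s U K).H = ∑ v with C.newId s U v = v, C.newK s U K v := by
  ext e
  simp [restart, Finset.sum_apply, Finset.sum_filter]

theorem restart_inv (hs : C.Inv s) {U : Set (Fin n)} {K : Fin m → ℕ}
    (hU : ∀ v ∈ U, v ∉ C.VB) (hK : C.G.Eulerian K) (hKA : ∀ e, K e ≠ 0 → C.A e)
    (hKU : ∀ u ∈ U, ∀ v ∈ U, C.G.Conn K u v) : C.Inv (C.restart s U K) := by
  have hKe : ∀ v, C.G.Eulerian (C.newK s U K v) := by
    intro v
    rcases newClass_cases (C := C) (s := s) U v with h | ⟨h, h'⟩ | ⟨h, h'⟩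
    · rwa [newK_of_mem h]
    · rw [newK_of_alive h h']; exact hs.K_eulerian v
    · rw [newK_of_dead h h']; exact eulerian_zero
  have hKs : ∀ v e, C.newK s U K v e ≠ 0 → C.A e := by
    intro v e
    rcases newClass_cases (C := C) (s := s) U v with h | ⟨h, h'⟩ | ⟨h, h'⟩
    · rw [newK_of_mem h]; exact hKA e
    · rw [newK_of_alive h h']; exact hs.K_sub v e
    · rw [newK_of_dead h h']; intro h; exact absurd rfl h
  have hid : ∀ v, C.newId s U (C.newId s U v) = C.newId s U v := fun v =>
    (newId_eq_iff hs).2 (newId_mem U v)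
  have hKeq : ∀ u v, C.newId s U u = C.newId s U v → C.newK s U K u = C.newK s U K v := by
    intro u v huv
    have huv := (newId_eq_iff hs).1 huv
    rcases huv with ⟨h1, h2⟩ | ⟨h1, h2, h3, h4⟩ | ⟨h1, h2, rfl⟩
    · rw [newK_of_mem h1, newK_of_mem h2]
    · have ho : own s u = own s v := by ext x; simp only [own, Set.mem_ofPred_eq] at h3 ⊢; rw [h3]
      have ha : C.alive s U u := by rwa [alive, ho, hs.w_eq u v h3]
      rw [newK_of_alive h1 h2, newK_of_alive h4 ha, hs.K_eq u v h3]
    · rfl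
  have hHne : ∀ e, (C.restart s U K).H e ≠ 0 ↔ ∃ v, C.newId s U v = v ∧ C.newK s U K v e ≠ 0 := by
    intro e
    simp [restart, Finset.sum_eq_zero_iff]
  refine
    { id_id := hid
      w_eq := ?_
      K_eq := hKeq
      K_eulerian := hKe
      K_sub := hKs
      K_conn := ?_
      w_le := ?_
      le_w := ?_
      VB_own := ?_
      H_eulerian := ?_
      H_sub := ?_
      K_le_H := ?_
      X_eulerian := eulerian_zero
      X_sub := fun e he => absurd rfl he }
  · intro u v huv
    have huv := (newId_eq_iff hs).1 huv
    rcases huv with ⟨h1, h2⟩ | ⟨h1, h2, h3, h4⟩ | ⟨h1, h2, rfl⟩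
    · rw [restart_w_of_mem h1, restart_w_of_mem h2]
    · have ho : own s u = own s v := by ext x; simp only [own, Set.mem_ofPred_eq] at h3 ⊢; rw [h3]
      have ha : C.alive s U u := by rwa [alive, ho, hs.w_eq u v h3]
      rw [restart_w_of_alive h1 h2, restart_w_of_alive h4 ha, hs.w_eq u v h3]
    · rfl
  · intro u v huv
    change C.G.Conn (C.newK s U K v) u v
    have huv := (newId_eq_iff hs).1 huv
    rcases huv with ⟨h1, h2⟩ | ⟨h1, h2, h3, h4⟩ | ⟨h1, h2, rfl⟩
    · rw [newK_of_mem h1]; exact hKU u h2 v h1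
    · rw [newK_of_alive h1 h2]; exact hs.K_conn u v h3
    · exact Conn.refl u
  · intro v
    rw [own_restart hs]
    rcases newClass_cases (C := C) (s := s) U v with h | ⟨h, h'⟩ | ⟨h, h'⟩
    · rw [restart_w_of_mem h, newClass_of_mem h]; omega
    · rw [restart_w_of_alive h h', newClass_of_alive h h']; exact h'
    · rw [restart_w_of_dead h h', newClass_of_dead h h', wt_singleton]; omega
  · intro v
    rw [own_restart hs]
    rcases newClass_cases (C := C) (s := s) U v with h | ⟨h, h'⟩ | ⟨h, h'⟩
    · rw [restart_w_of_mem h, newClass_of_mem h]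
    · rw [restart_w_of_alive h h', newClass_of_alive h h']
      exact (wt_mono Set.sdiff_subset).trans (hs.le_w v)
    · rw [restart_w_of_dead h h', newClass_of_dead h h', wt_singleton]
  · intro v hv u huv
    have huv := (newId_eq_iff hs).1 huv
    rcases huv with ⟨h1, h2⟩ | ⟨h1, h2, h3, h4⟩ | ⟨h1, h2, rfl⟩
    · exact absurd hv (hU v h1)
    · exact hs.VB_own v hv u h3
    · rfl
  · rw [restart_H_eq]
    exact eulerian_sum _ _ fun v _ => hKe v
  · intro e he
    obtain ⟨v, _, hv⟩ := (hHne e).1 he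
    exact hKs v e hv
  · intro v e he
    exact (hHne e).2 ⟨C.newId s U v, hid v, by rwa [hKeq _ _ (hid v)]⟩

theorem useful_closed : C.G.Closed (C.orc s.H) (C.useful s) := by
  intro e he
  by_cases hh : C.G.Conn s.H (C.G.tail e) (C.G.head e)
  · constructor
    · rintro ⟨u, h1, h2⟩
      exact ⟨u, (conn_edge he).symm.trans h1, fun h3 => h2 (hh.trans h3)⟩
    · rintro ⟨u, h1, h2⟩
      exact ⟨u, (conn_edge he).trans h1, fun h3 => h2 (hh.symm.trans h3)⟩
  · exact ⟨fun _ => ⟨_, (conn_edge he).symm, fun h => hh h.symm⟩, fun _ => ⟨_, conn_edge he, hh⟩⟩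

theorem attached_closed (v : Fin n) : C.G.Closed (C.orc s.H) (C.attached s v) := by
  have key : ∀ a b, C.G.Conn (C.orc s.H) a b → (a ∈ C.useful s ↔ b ∈ C.useful s) →
      a ∈ C.attached s v → b ∈ C.attached s v := by
    rintro a b hab hu ⟨h1, h2, ⟨u', h3, h3'⟩, h4⟩
    exact ⟨fun x hx hc => h1 x hx (hab.trans hc), hu.1 h2, ⟨u', hab.symm.trans h3, h3'⟩,
      fun u hc => h4 u (hab.trans hc)⟩
  intro e he
  have hu := useful_closed e he
  exact ⟨key _ _ (conn_edge he) hu, key _ _ (conn_edge he).symm hu.symm⟩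

theorem not_mem_VB_of_attached {u v : Fin n} (h : u ∈ C.attached s v) : u ∉ C.VB :=
  fun hu => h.1 u hu (Conn.refl u)

theorem not_mem_VB_of_own (hs : C.Inv s) {u v : Fin n} (hv : v ∉ C.VB) (h : u ∈ own s v) :
    u ∉ C.VB := fun hu => hv ((hs.VB_own u hu v (Eq.symm h)).symm ▸ hu)

theorem merged_ne_zero {e : Fin m} : C.merged s e ≠ 0 ↔
    s.H e ≠ 0 ∨ C.orc s.H e ≠ 0 ∨ s.X e ≠ 0 ∨ C.EB e ≠ 0 := by
  simp only [merged, Pi.add_apply]; omega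

theorem conn_merged_of_orc {u v : Fin n} (h : C.G.Conn (C.orc s.H) u v) : C.G.Conn (C.merged s) u v :=
  h.mono fun _ he => merged_ne_zero.2 (Or.inr (Or.inl he))

theorem conn_merged_of_H {u v : Fin n} (h : C.G.Conn s.H u v) : C.G.Conn (C.merged s) u v :=
  h.mono fun _ he => merged_ne_zero.2 (Or.inl he)

theorem outside_conn {u v : Fin n} (h : C.outside s u) (huv : C.G.Conn (C.merged s) u v) :
    C.outside s v := fun b hb hc => h b hb (huv.trans hc)

theorem outside.not_mem {u : Fin n} (h : C.outside s u) : u ∉ C.VB := fun hu => h u hu (Conn.refl u)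

theorem orc_sub_of_outside (hC : C.Valid) (hs : C.Inv s) {e : Fin m}
    (h : C.outside s (C.G.tail e)) (he : C.orc s.H e ≠ 0) : C.A e :=
  hC.orc_sub _ hs.H_eulerian hs.H_sub e he fun b hb hc => h b hb (conn_merged_of_orc hc)

theorem closed_merged (t : Fin n) {F : Fin m → ℕ} (h : ∀ e, F e ≠ 0 → C.merged s e ≠ 0) :
    C.G.Closed F {u | C.G.Conn (C.merged s) t u} := (closed_conn t).anti h

theorem finalEdges_ne_zero {t : Fin n} {e : Fin m} : C.finalEdges s t e ≠ 0 ↔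
    C.G.Conn (C.merged s) t (C.G.tail e) ∧
      (s.X e ≠ 0 ∨ C.G.tail e ∈ C.useful s ∧ C.orc s.H e ≠ 0) := by
  rw [finalEdges, restrict_ne_zero, Pi.add_apply, ← restrict_ne_zero (F := C.orc s.H)]
  exact and_congr Iff.rfl (by omega)

theorem finalEdges_eulerian (hC : C.Valid) (hs : C.Inv s) (t : Fin n) :
    C.G.Eulerian (C.finalEdges s t) := by
  refine Eulerian.restrict (hs.X_eulerian.add ((hC.orc_eulerian _ hs.H_eulerian hs.H_sub).restrict
    useful_closed)) (closed_merged t fun e he => ?_)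
  rw [Pi.add_apply] at he
  rw [merged_ne_zero]
  by_cases hX : s.X e = 0
  · have : C.G.restrict (C.orc s.H) (C.useful s) e ≠ 0 := by omega
    exact Or.inr (Or.inl (restrict_ne_zero.1 this).2)
  · exact Or.inr (Or.inr (Or.inl hX))

theorem chord_cycle_conn {t : Fin n} {e : Fin m} (h : C.chord s t e) :
    ∀ u ∈ C.G.verts (C.G.cycle (C.light s (s.w t)) e),
      C.G.Conn (C.G.cycle (C.light s (s.w t)) e) u (C.G.tail e) := by
  rintro u ⟨f, hf, rfl⟩
  exact cycle_conn h.2.1 hf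

theorem chord_cycle_A (hC : C.Valid) {t : Fin n} {e : Fin m} (h : C.chord s t e) :
    ∀ f, C.G.cycle (C.light s (s.w t)) e f ≠ 0 → C.A f := fun f hf =>
  hC.Ac_sub f (cycle_subset (S := C.light s (s.w t)) h.1 hf).1

theorem bad_entity (hC : C.Valid) (hs : C.Inv s) {v : Fin n} (hv : v ∉ C.VB) :
    (∀ u ∈ own s v ∪ C.attached s v, u ∉ C.VB) ∧
    C.G.Eulerian (s.K v + C.G.restrict (C.orc s.H) (C.attached s v)) ∧
    (∀ e, (s.K v + C.G.restrict (C.orc s.H) (C.attached s v)) e ≠ 0 → C.A e) ∧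
    ∀ u ∈ own s v ∪ C.attached s v,
      C.G.Conn (s.K v + C.G.restrict (C.orc s.H) (C.attached s v)) u v := by
  refine ⟨?_, ?_, ?_, ?_⟩
  · rintro u (hu | hu)
    · exact not_mem_VB_of_own hs hv hu
    · exact not_mem_VB_of_attached hu
  · exact (hs.K_eulerian v).add ((hC.orc_eulerian _ hs.H_eulerian hs.H_sub).restrict (attached_closed v))
  · intro e he
    by_cases hK : s.K v e = 0
    · rw [Pi.add_apply, hK, zero_add, restrict_ne_zero] at he
      exact hC.orc_sub _ hs.H_eulerian hs.H_sub e he.2 he.1.1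
    · exact hs.K_sub v e hK
  · have h1 : ∀ u ∈ own s v, C.G.Conn (s.K v + C.G.restrict (C.orc s.H) (C.attached s v)) u v :=
      fun u hu => (hs.K_conn u v hu).mono fun e he => by rw [Pi.add_apply]; omega
    rintro u (hu | hu)
    · exact h1 u hu
    · obtain ⟨u', hc, hu'⟩ := hu.2.2.1
      exact ((hc.restrict (attached_closed v) hu).mono fun e he => by rw [Pi.add_apply]; omega).trans
        (h1 u' hu')

theorem step_inv (hC : C.Valid) (hs : C.Inv s) : C.Inv (C.step s) ∨ (C.step s).done := by
  by_cases hd : s.done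
  · right; rw [step, if_pos hd]; exact hd
  refine C.step_cases s (P := fun s' => C.Inv s' ∨ s'.done) hd ?_ ?_ ?_ ?_ ?_
  · intro v hv
    obtain ⟨h1, h2, h3, h4⟩ := bad_entity hC hs hv.1
    exact Or.inl (restart_inv hs h1 h2 h3 fun a ha b hb => (h4 a ha).trans (h4 b hb).symm)
  · intro t e _ ht he _
    have hA := chord_cycle_A hC he
    have hc := chord_cycle_conn he
    refine Or.inl (restart_inv hs ?_ (eulerian_cycle he.2.1) hA
      fun a ha b hb => (hc a ha).trans (hc b hb).symm)
    rintro _ ⟨f, hf, rfl⟩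
    exact (hC.A_endpoints f (hA f hf)).1
  · intro t e _ ht he _
    refine Or.inl { hs with X_eulerian := hs.X_eulerian.add (eulerian_cycle he.2.1), X_sub := ?_ }
    intro f hf
    by_cases hX : s.X f = 0
    · refine chord_cycle_A hC he f ?_
      simpa [hX] using hf
    · exact hs.X_sub f hX
  · intro t _ ht _
    refine Or.inl { hs with
      H_eulerian := hs.H_eulerian.add (finalEdges_eulerian hC hs t)
      H_sub := ?_
      K_le_H := fun v e he => ?_
      X_eulerian := eulerian_zero
      X_sub := fun e he => absurd rfl he }
    · intro e he
      by_cases hH : s.H e = 0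
      · have he : C.finalEdges s t e ≠ 0 := by simpa [hH] using he
        obtain ⟨h1, h2 | ⟨-, h2⟩⟩ := finalEdges_ne_zero.1 he
        · exact hs.X_sub e h2
        · exact orc_sub_of_outside hC hs (outside_conn ht.1.1 h1) h2
      · exact hs.H_sub e hH
    · have := hs.K_le_H v e he
      simp only [Pi.add_apply]; omega
  · intro _ _
    exact Or.inr trivial

theorem init_inv : C.Inv C.init where
  id_id _ := rfl
  w_eq u v h := congrArg C.ℓ h
  K_eq _ _ _ := rfl
  K_eulerian _ := eulerian_zero
  K_sub _ _ h := absurd rfl h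
  K_conn u v h := by
    obtain rfl : u = v := h
    exact Conn.refl u
  w_le v := by
    have : C.init.w v ≤ C.wt (own C.init v) := le_wt (C := C) (U := own C.init v) (v := v) rfl
    have := Nat.mul_le_mul_left C.d this
    omega
  le_w v := by
    have : own C.init v = {v} := by ext u; simp [own, init]
    rw [this, wt_singleton]; rfl
  VB_own v _ u h := h
  H_eulerian := eulerian_zero
  H_sub _ h := absurd rfl h
  K_le_H _ _ h := absurd rfl h
  X_eulerian := eulerian_zero
  X_sub _ h := absurd rfl h

end Setup

end ATSP

namespace ATSP

open Relation MultiDigraph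
open scoped Classical

/-! Termination -/

namespace Setup

variable {n m : ℕ} {C : Setup n m} {s : St n m}

theorem Inv.id_eq_iff (hs : C.Inv s) {u t : Fin n} : (s.id t = t ∧ u ∈ own s t) ↔ t = s.id u := by
  constructor
  · rintro ⟨h1, h2⟩
    exact h1.symm.trans (Eq.symm h2)
  · rintro rfl
    exact ⟨hs.id_id u, (hs.id_id u).symm⟩

/-- A sum over the vertices is the sum over the entities of the sums over their vertices. -/
theorem Inv.sum_own {M : Type} [AddCommMonoid M] (hs : C.Inv s) (f : Fin n → Fin n → M) :
    ∑ t, (if s.id t = t then ∑ u, (if u ∈ own s t then f t u else 0) else 0) = ∑ u, f (s.id u) u := by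
  have : ∀ t, (if s.id t = t then ∑ u, (if u ∈ own s t then f t u else 0) else 0) =
      ∑ u, if t = s.id u then f t u else 0 := by
    intro t
    by_cases h : s.id t = t
    · rw [if_pos h]
      refine Finset.sum_congr rfl fun u _ => ?_
      have := hs.id_eq_iff (u := u) (t := t)
      simp only [h, true_and] at this
      simp only [this]
    · rw [if_neg h, Finset.sum_eq_zero]
      intro u _
      rw [if_neg]
      rintro rfl
      exact h (hs.id_id u)
  simp only [this]
  rw [Finset.sum_comm]
  simp

-- A fresh entity contributes `w ^ (p + 1)`, and each unit of lost weight costs `d * w ^ p`. The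
-- contribution reaches 0 at the threshold for dissolving, so that, with truncated subtraction,
-- dissolving is free.
variable (C s) in
noncomputable def potential (p : ℕ) : ℕ :=
  ∑ t, if s.id t = t then s.w t ^ p * (C.d * C.wt (own s t) - (C.d - 1) * s.w t) else 0

/-- Each vertex `u` ceded to `U` costs its old entity at most `d * ℓ u * w u ^ p`. The new entity
contributes `wt U ^ (p + 1)`, and the single vertices released by dissolved entities can only help.
-/
theorem potential_restart_ge (hs : C.Inv s) (hd : 2 ≤ C.d) (p : ℕ) {U : Set (Fin n)}
    (K : Fin m → ℕ) (hU : U.Nonempty) :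
    C.potential s p + C.wt U ^ (p + 1) ≤
      C.potential (C.restart s U K) p + C.d * ∑ u, if u ∈ U then C.ℓ u * s.w u ^ p else 0 := by
  set s' := C.restart s U K with hs'
  let φ : Fin n → ℕ := fun t => s'.w t ^ p * (C.d * C.wt (own s' t) - (C.d - 1) * s'.w t)
  let f : Fin n → ℕ := fun t => s.w t ^ p * (C.d * C.wt (own s t \ U) - (C.d - 1) * s.w t)
  have hid : ∀ v, s'.id (s'.id v) = s'.id v := fun v => (newId_eq_iff hs).2 (newId_mem U v)
  have hsplit : C.potential s p ≤ (∑ t, if s.id t = t then f t else 0) +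
      C.d * ∑ u, if u ∈ U then C.ℓ u * s.w u ^ p else 0 := by
    have h1 : ∑ u, (if u ∈ U then C.ℓ u * s.w u ^ p else 0) =
        ∑ t, (if s.id t = t then s.w t ^ p * C.wt (own s t ∩ U) else 0) := by
      have := hs.sum_own (fun t u => if u ∈ U then C.ℓ u * s.w t ^ p else 0)
      rw [show (∑ u, if u ∈ U then C.ℓ u * s.w u ^ p else 0) =
        ∑ u, if u ∈ U then C.ℓ u * s.w (s.id u) ^ p else 0 from
          Finset.sum_congr rfl fun u _ => by rw [hs.w_eq (s.id u) u (hs.id_id u)], ← this]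
      refine Finset.sum_congr rfl fun t _ => ?_
      split_ifs
      · rw [wt, Finset.mul_sum]
        refine Finset.sum_congr rfl fun u _ => ?_
        by_cases h : u ∈ own s t <;> by_cases h' : u ∈ U <;> simp [h, h', mul_comm]
      · rfl
    rw [h1, Finset.mul_sum, ← Finset.sum_add_distrib, potential]
    refine Finset.sum_le_sum fun t _ => ?_
    split_ifs
    · have h2 := wt_diff_add_inter (C := C) (own s t) U
      calc s.w t ^ p * (C.d * C.wt (own s t) - (C.d - 1) * s.w t)
          ≤ s.w t ^ p * ((C.d * C.wt (own s t \ U) - (C.d - 1) * s.w t) + C.d * C.wt (own s t ∩ U)) := by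
            refine Nat.mul_le_mul_left _ ?_
            rw [← h2, mul_add]
            omega
        _ = _ := by rw [mul_add]; ring
    · simp
  have hnew : (∑ t, if s.id t = t then f t else 0) + C.wt U ^ (p + 1) ≤ C.potential s' p := by
    obtain ⟨u₁, hu₁⟩ := hU
    let u₀ := s'.id u₁
    have hu₀ : u₀ ∈ U := by
      have := newId_mem (C := C) (s := s) U u₁
      rwa [newClass_of_mem hu₁] at this
    have hφ₀ : φ u₀ = C.wt U ^ (p + 1) := by
      simp only [φ]
      rw [hs', own_restart hs, newClass_of_mem hu₀, restart_w_of_mem hu₀, pow_succ]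
      congr 1
      rw [← Nat.sub_mul, Nat.sub_sub_self (by omega), one_mul]
    let T : Finset (Fin n) := Finset.univ.filter fun t => s.id t = t ∧ f t ≠ 0
    -- A nonzero truncated difference means that the remainder outweighs `(1 - 1/d) w`; so it is
    -- nonempty and survives.
    have hTne : ∀ t ∈ T, ∃ u, u ∈ own s t ∧ u ∉ U ∧ C.alive s U u := by
      intro t ht
      simp only [T, Finset.mem_filter, Finset.mem_univ, true_and, f] at ht
      have h1 : C.d * C.wt (own s t \ U) - (C.d - 1) * s.w t ≠ 0 := fun h => ht.2 (by rw [h, mul_zero])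
      have h2 : ∃ u ∈ own s t, u ∉ U := by
        by_contra hcon
        push Not at hcon
        have : own s t \ U = ∅ := by
          ext x; simpa using hcon x
        rw [this] at h1
        simp [wt] at h1
      obtain ⟨u, hu, huU⟩ := h2
      refine ⟨u, hu, huU, ?_⟩
      have ho : own s u = own s t := by ext x; simp only [own, Set.mem_ofPred_eq] at hu ⊢; rw [hu]
      rw [alive, ho, hs.w_eq u t hu]
      have h3 : C.d * s.w t = (C.d - 1) * s.w t + s.w t := by
        rw [← Nat.succ_mul]; congr 1; omega
      omega
    -- The old representative may lie in `U`, so each entity is followed through some vertex that it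
    -- keeps.
    choose! g hg1 hg2 hg3 using hTne
    have hgown : ∀ t ∈ T, own s' (s'.id (g t)) = own s t \ U ∧ s'.w (s'.id (g t)) = s.w t := by
      intro t ht
      have h0 : C.newId s U (g t) ∈ C.newClass s U (g t) := newId_mem U (g t)
      have h1 : own s' (s'.id (g t)) = C.newClass s U (g t) := by
        rw [hs', own_restart hs]; exact newClass_eq hs h0
      rw [newClass_of_alive (hg2 t ht) (hg3 t ht)] at h1 h0
      have ho : own s (g t) = own s t := by
        have := hg1 t ht
        ext x; simp only [own, Set.mem_ofPred_eq] at this ⊢; rw [this]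
      have ha : C.alive s U (C.newId s U (g t)) := by
        have hh : s.id (C.newId s U (g t)) = s.id (g t) := h0.1
        have := hg3 t ht
        rw [alive] at this ⊢
        rwa [show own s (C.newId s U (g t)) = own s (g t) by
          ext x; simp only [own, Set.mem_ofPred_eq]; rw [hh], hs.w_eq _ _ hh]
      refine ⟨by rw [h1, ho], ?_⟩
      rw [hs', show (C.restart s U K).id (g t) = C.newId s U (g t) from rfl, restart_w_of_alive h0.2 ha]
      exact hs.w_eq _ _ ((show s.id (C.newId s U (g t)) = s.id (g t) from h0.1).trans (hg1 t ht))
    have hφg : ∀ t ∈ T, φ (s'.id (g t)) = f t := by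
      intro t ht
      simp only [φ, f, hgown t ht]
    have hinj : Set.InjOn (fun t => s'.id (g t)) T := by
      intro t ht t' ht' h
      have h1 := (hgown t ht).1
      have h2 := (hgown t' ht').1
      simp only at h
      rw [h] at h1
      have h3 : g t' ∈ own s t \ U := by
        rw [← h1, h2]; exact ⟨hg1 t' ht', hg2 t' ht'⟩
      have h4 : s.id t = s.id t' := (Eq.symm h3.1).trans (hg1 t' ht')
      simp only [T, Finset.coe_filter, Finset.mem_univ, true_and, Set.mem_ofPred_eq] at ht ht'
      rw [← ht.1, ← ht'.1, h4]
    have hnot : u₀ ∉ T.image fun t => s'.id (g t) := by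
      simp only [Finset.mem_image, not_exists, not_and]
      intro t ht h
      have h1 := (hgown t ht).1
      rw [h] at h1
      have : u₀ ∈ own s t \ U := h1 ▸ rfl
      exact this.2 hu₀
    calc (∑ t, if s.id t = t then f t else 0) + C.wt U ^ (p + 1)
        = ∑ t ∈ T, f t + φ u₀ := by
          rw [hφ₀, ← Finset.sum_filter]
          congr 1
          refine (Finset.sum_subset ?_ ?_).symm
          · intro t; simp [T]; tauto
          · intro t; simp [T]; tauto
      _ = ∑ t ∈ insert u₀ (T.image fun t => s'.id (g t)), φ t := by
          rw [Finset.sum_insert hnot, Finset.sum_image hinj, add_comm]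
          congr 1
          exact (Finset.sum_congr rfl hφg).symm
      _ ≤ C.potential s' p := by
          rw [potential, ← Finset.sum_filter]
          refine Finset.sum_le_sum_of_subset fun t ht => ?_
          simp only [Finset.mem_filter, Finset.mem_univ, true_and]
          rcases Finset.mem_insert.1 ht with rfl | ht
          · exact hid u₁
          · obtain ⟨t, _, rfl⟩ := Finset.mem_image.1 ht
            exact hid (g t)
  omega

/-- Every entity that meets `U` is lighter than `U` by a factor `d/(d + 1)`, so `hp` gives `(d + 1)
w^p ≤ (wt U)^p`. The loss is then at most `d/(d + 1)` times the gain, and positive weights make the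
inequality strict. -/
theorem potential_restart (hC : C.Valid) (hs : C.Inv s) {p : ℕ} (hp : (C.d + 1) * C.d ^ p ≤ (C.d + 1) ^ p)
    {U : Set (Fin n)} (K : Fin m → ℕ) (hU : U.Nonempty) (hUB : ∀ v ∈ U, v ∉ C.VB)
    (hw : ∀ v ∈ U, (C.d + 1) * s.w v ≤ C.d * C.wt U) :
    C.potential s p + 1 ≤ C.potential (C.restart s U K) p := by
  have hd := hC.two_le_d
  have h1 := potential_restart_ge hs hd p K hU
  have hwp : ∀ v ∈ U, (C.d + 1) * s.w v ^ p ≤ C.wt U ^ p := by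
    intro v hv
    have h2 := Nat.pow_le_pow_left (hw v hv) p
    rw [mul_pow, mul_pow] at h2
    have h3 : (C.d + 1) * C.d ^ p * s.w v ^ p ≤ C.d ^ p * C.wt U ^ p :=
      (Nat.mul_le_mul_right _ hp).trans h2
    refine Nat.le_of_mul_le_mul_left (c := C.d ^ p) ?_ (by positivity)
    calc C.d ^ p * ((C.d + 1) * s.w v ^ p) = (C.d + 1) * C.d ^ p * s.w v ^ p := by ring
      _ ≤ _ := h3
  have hsum : (C.d + 1) * ∑ u, (if u ∈ U then C.ℓ u * s.w u ^ p else 0) ≤ C.wt U ^ (p + 1) := by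
    rw [pow_succ, wt, ← wt, Finset.mul_sum, wt, Finset.mul_sum]
    refine Finset.sum_le_sum fun u _ => ?_
    split_ifs with hu
    · calc (C.d + 1) * (C.ℓ u * s.w u ^ p) = ((C.d + 1) * s.w u ^ p) * C.ℓ u := by ring
        _ ≤ _ := Nat.mul_le_mul_right _ (hwp u hu)
    · simp
  have hpos : 1 ≤ ∑ u, (if u ∈ U then C.ℓ u * s.w u ^ p else 0) := by
    obtain ⟨u, hu⟩ := hU
    have h4 := Finset.single_le_sum (f := fun u => if u ∈ U then C.ℓ u * s.w u ^ p else 0)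
      (fun _ _ => Nat.zero_le _) (Finset.mem_univ u)
    simp only [if_pos hu] at h4
    refine le_trans ?_ h4
    exact Nat.mul_pos (hC.ℓ_pos u (hUB u hu)) (Nat.pow_pos (hs.w_pos hC (hUB u hu)))
  rw [add_mul, one_mul] at hsum
  omega

theorem Inv.sum_wt_own (hs : C.Inv s) :
    ∑ t, (if s.id t = t then C.wt (own s t) else 0) = C.wt Set.univ := by
  simpa [wt] using hs.sum_own fun _ u => C.ℓ u

theorem Inv.w_le_two_mul (hC : C.Valid) (hs : C.Inv s) (v : Fin n) : s.w v ≤ 2 * C.wt (own s v) := by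
  have h1 := hs.w_le v
  have hd := hC.two_le_d
  obtain ⟨k, hk⟩ := Nat.exists_eq_add_of_le hd
  rw [hk] at h1
  by_contra h
  push Not at h
  nlinarith

theorem potential_le (hC : C.Valid) (hs : C.Inv s) (p : ℕ) :
    C.potential s p ≤ (2 * C.wt Set.univ) ^ p * C.d * C.wt Set.univ := by
  conv_rhs => rw [← hs.sum_wt_own, Finset.mul_sum, hs.sum_wt_own]
  refine Finset.sum_le_sum fun t _ => ?_
  split_ifs
  · rw [mul_assoc]
    refine Nat.mul_le_mul (Nat.pow_le_pow_left ?_ p) (Nat.sub_le _ _)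
    exact (hs.w_le_two_mul hC t).trans (Nat.mul_le_mul_left _ (wt_mono (Set.subset_univ _)))
  · simp

/-- A measure of progress: it grows whenever added edges join two components. -/
noncomputable def pairs (G : MultiDigraph (Fin n) (Fin m)) (F : Fin m → ℕ) : ℕ :=
  (Finset.univ.filter fun x : Fin n × Fin n => G.Conn F x.1 x.2).card

theorem pairs_le (G : MultiDigraph (Fin n) (Fin m)) (F : Fin m → ℕ) : pairs G F ≤ n ^ 2 := by
  refine (Finset.card_le_univ _).trans ?_
  simp [sq]

theorem pairs_lt {G : MultiDigraph (Fin n) (Fin m)} {F F' : Fin m → ℕ} (h : ∀ e, F e ≠ 0 → F' e ≠ 0)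
    {u v : Fin n} (h1 : ¬ G.Conn F u v) (h2 : G.Conn F' u v) : pairs G F < pairs G F' := by
  refine Finset.card_lt_card (Finset.ssubset_iff_of_subset ?_ |>.2 ⟨(u, v), ?_, ?_⟩)
  · intro x hx
    simp only [Finset.mem_filter, Finset.mem_univ, true_and] at hx ⊢
    exact hx.mono h
  · simpa using h2
  · simpa using h1

-- A lexicographic order written in base `n ^ 2 + 1`. A restart may destroy connectivity and
-- finalizing discards `X`, but each of them raises a more significant digit.
variable (C s) in
noncomputable def rank (p : ℕ) : ℕ :=
  (C.potential s p * (n ^ 2 + 1) + pairs C.G s.H) * (n ^ 2 + 1) + pairs C.G (C.merged s)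

theorem rank_lt_aux {N a b c a' b' c' : ℕ} (hb : b ≤ N) (hc : c ≤ N)
    (h : a < a' ∨ (a = a' ∧ (b < b' ∨ b = b' ∧ c < c'))) :
    (a * (N + 1) + b) * (N + 1) + c < (a' * (N + 1) + b') * (N + 1) + c' := by
  have key : ∀ x y z z' : ℕ, z ≤ N → x < y → x * (N + 1) + z < y * (N + 1) + z' := by
    intro x y z z' hz hxy
    have := Nat.mul_le_mul_right (N + 1) hxy
    rw [Nat.succ_mul] at this
    omega
  rcases h with h | ⟨rfl, h | ⟨rfl, h⟩⟩
  · exact key _ _ _ _ hc (key _ _ _ _ hb h)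
  · exact key _ _ _ _ hc (by omega)
  · omega

theorem chord_merged {t : Fin n} {e : Fin m} (h : C.chord s t e) :
    ¬ C.G.Conn (C.merged s) (C.G.tail e) (C.G.head e) := fun h' =>
  h.2.2 ⟨fun h1 => h1.trans h', fun h1 => h1.trans h'.symm⟩

/-- The new edges join at least two components of `H`. -/
theorem exists_finalEdges (hC : C.Valid) (hs : C.Inv s) {t : Fin n} (ht : C.outside s t) :
    ∃ e, C.finalEdges s t e ≠ 0 ∧ ¬ C.G.Conn s.H (C.G.tail e) (C.G.head e) := by
  obtain ⟨e, he, hte⟩ := hC.orc_covers _ hs.H_eulerian hs.H_sub t ht.not_mem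
  have h1 : ¬ C.G.Conn s.H (C.G.tail e) (C.G.head e) := fun h' =>
    hte ⟨fun h1 => h1.trans h', fun h1 => h1.trans h'.symm⟩
  refine ⟨e, finalEdges_ne_zero.2 ⟨?_, Or.inr ⟨⟨_, conn_edge he, h1⟩, he⟩⟩, h1⟩
  by_cases h2 : C.G.Conn s.H t (C.G.tail e)
  · exact conn_merged_of_H h2
  · have h3 : C.G.Conn s.H t (C.G.head e) := by tauto
    exact (conn_merged_of_H h3).trans (conn_merged_of_orc (conn_edge he)).symm

theorem step_rank (hC : C.Valid) (hs : C.Inv s) {p : ℕ} (hp : (C.d + 1) * C.d ^ p ≤ (C.d + 1) ^ p) :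
    (C.step s).done ∨ C.rank s p < C.rank (C.step s) p := by
  by_cases hd : s.done
  · left; rw [step, if_pos hd]; exact hd
  refine C.step_cases s (P := fun s' => s'.done ∨ C.rank s p < C.rank s' p) hd ?_ ?_ ?_ ?_ ?_
  · intro v hv
    refine Or.inr (rank_lt_aux (pairs_le _ _) (pairs_le _ _) (Or.inl ?_))
    refine potential_restart hC hs hp _ ⟨v, Or.inl rfl⟩ (bad_entity hC hs hv.1).1 fun u hu => ?_
    have hw : s.w u ≤ s.w v := by
      rcases hu with hu | hu
      · exact (hs.w_eq u v hu).le
      · exact hu.2.2.2 u (Conn.refl u)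
    calc (C.d + 1) * s.w u ≤ (C.d + 2) * s.w v := Nat.mul_le_mul (by omega) hw
      _ ≤ _ := hv.2
      _ ≤ _ := Nat.mul_le_mul_left _ (wt_mono fun x hx => Or.inr hx.1)
  · intro t e _ ht he hb
    refine Or.inr (rank_lt_aux (pairs_le _ _) (pairs_le _ _) (Or.inl ?_))
    refine potential_restart hC hs hp _ ⟨_, e, cycle_self e, rfl⟩ ?_ ?_
    · rintro _ ⟨f, hf, rfl⟩
      exact (hC.A_endpoints f (chord_cycle_A hC he f hf)).1
    · rintro _ ⟨f, hf, rfl⟩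
      exact hb f hf
  · intro t e _ ht he _
    refine Or.inr (rank_lt_aux (pairs_le _ _) (pairs_le _ _) (Or.inr ⟨rfl, Or.inr ⟨rfl, ?_⟩⟩))
    refine pairs_lt (fun f hf => ?_) (chord_merged he) (conn_edge ?_)
    · simp only [merged, Pi.add_apply] at hf ⊢; omega
    · have := cycle_self (G := C.G) (S := C.light s (s.w t)) e
      simp only [merged, Pi.add_apply]; omega
  · intro t _ ht _
    refine Or.inr (rank_lt_aux (pairs_le _ _) (pairs_le _ _) (Or.inr ⟨rfl, Or.inl ?_⟩))
    obtain ⟨e, he, h1⟩ := exists_finalEdges hC hs ht.1.1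
    refine pairs_lt (fun f hf => ?_) h1 (conn_edge ?_) <;> simp only [Pi.add_apply] <;> omega
  · intro _ _
    exact Or.inl trivial

variable (C) in
/-- The state after `k` steps. -/
noncomputable def run (k : ℕ) : St n m := C.step^[k] C.init

theorem run_succ (k : ℕ) : C.run (k + 1) = C.step (C.run k) :=
  Function.iterate_succ_apply' _ _ _

theorem run_inv (hC : C.Valid) (k : ℕ) : C.Inv (C.run k) ∨ (C.run k).done := by
  induction k with
  | zero => exact Or.inl init_inv
  | succ k ih =>
    rw [run_succ]
    rcases ih with h | h
    · exact step_inv hC h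
    · right; rw [step, if_pos h]; exact h

/-- The rank rises in every step before the end, and `k` exceeds its largest possible value. -/
theorem run_done (hC : C.Valid) {p : ℕ} (hp : (C.d + 1) * C.d ^ p ≤ (C.d + 1) ^ p) {k : ℕ}
    (hk : (((2 * C.wt Set.univ) ^ p * C.d * C.wt Set.univ) * (n ^ 2 + 1) + n ^ 2) * (n ^ 2 + 1) + n ^ 2 < k) :
    (C.run k).done := by
  have key : ∀ k, (C.run k).done ∨ C.Inv (C.run k) ∧ k ≤ C.rank (C.run k) p := by
    intro k
    induction k with
    | zero => exact Or.inr ⟨init_inv, Nat.zero_le _⟩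
    | succ k ih =>
      rw [run_succ]
      rcases ih with h | ⟨h1, h2⟩
      · left; rw [step, if_pos h]; exact h
      · rcases step_rank hC h1 hp with h | h
        · exact Or.inl h
        · rcases step_inv hC h1 with h' | h'
          · exact Or.inr ⟨h', by omega⟩
          · exact Or.inl h'
  rcases key k with h | ⟨h1, h2⟩
  · exact h
  · exfalso
    have h3 : C.rank (C.run k) p ≤ (((2 * C.wt Set.univ) ^ p * C.d * C.wt Set.univ) * (n ^ 2 + 1) + n ^ 2) *
        (n ^ 2 + 1) + n ^ 2 := by
      refine Nat.add_le_add (Nat.mul_le_mul_right _ (Nat.add_le_add (Nat.mul_le_mul_right _ ?_) (pairs_le _ _)))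
        (pairs_le _ _)
      exact potential_le hC h1 p
    omega

end Setup

end ATSP

namespace ATSP

open Relation MultiDigraph
open scoped Classical

/-! The cost of the computed tour -/

section Cost

variable {n m : ℕ}

/-- The cost of a multiset of edges. -/
noncomputable def costOf (c : Fin m → ℝ) (F : Fin m → ℕ) : ℝ := ∑ e, F e * c e

theorem costOf_add (c : Fin m → ℝ) (F F' : Fin m → ℕ) : costOf c (F + F') = costOf c F + costOf c F' := by
  simp [costOf, add_mul, Finset.sum_add_distrib]

theorem costOf_zero (c : Fin m → ℝ) : costOf c 0 = 0 := by simp [costOf]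

theorem costOf_mono {c : Fin m → ℝ} (hc : ∀ e, 0 ≤ c e) {F F' : Fin m → ℕ} (h : ∀ e, F e ≤ F' e) :
    costOf c F ≤ costOf c F' :=
  Finset.sum_le_sum fun e _ => mul_le_mul_of_nonneg_right (by exact_mod_cast h e) (hc e)

theorem costOf_sum {ι : Type} (c : Fin m → ℝ) (T : Finset ι) (K : ι → Fin m → ℕ) :
    costOf c (∑ i ∈ T, K i) = ∑ i ∈ T, costOf c (K i) := by
  induction T using Finset.induction_on with
  | empty => simp [costOf_zero]
  | insert i T hi ih => rw [Finset.sum_insert hi, Finset.sum_insert hi, costOf_add, ih]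

theorem MultiDigraph.restrict_le {G : MultiDigraph (Fin n) (Fin m)} (F : Fin m → ℕ) (Y : Set (Fin n)) (e : Fin m) :
    G.restrict F Y e ≤ F e := by
  unfold restrict; split_ifs <;> simp

theorem MultiDigraph.restrict_add {G : MultiDigraph (Fin n) (Fin m)} (F F' : Fin m → ℕ) (Y : Set (Fin n)) :
    G.restrict (F + F') Y = G.restrict F Y + G.restrict F' Y := by
  ext e; simp only [restrict, Pi.add_apply]; split_ifs <;> rfl

theorem MultiDigraph.restrict_restrict {G : MultiDigraph (Fin n) (Fin m)} (F : Fin m → ℕ) (Y Y' : Set (Fin n)) :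
    G.restrict (G.restrict F Y) Y' = G.restrict F (Y ∩ Y') := by
  ext e; simp only [restrict, Set.mem_inter_iff]; split_ifs <;> tauto

end Cost

/-! ### The cost analysis: which entity pays for which edges. -/

namespace Setup

variable {n m : ℕ} {C : Setup n m} {s : St n m} {c : Fin m → ℝ} {θ α R : ℝ}

/-- The cost bounds on which the analysis rests. -/
structure CostValid (C : Setup n m) (c : Fin m → ℝ) (θ α R : ℝ) : Prop where
  c_nonneg : ∀ e, 0 ≤ c e
  θ_nonneg : 0 ≤ θ
  α_nonneg : 0 ≤ α
  cycle_cost : ∀ F, C.G.Eulerian F → (∀ e, F e ≠ 0 → C.Ac e) →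
    (∀ v, ∑ e with C.G.tail e = v, F e ≤ 1) → costOf c F ≤ θ * C.wt (C.G.verts F)
  orc_total : ∀ H, C.G.Eulerian H → (∀ e, H e ≠ 0 → C.A e) → costOf c (C.orc H) ≤ R
  orc_component : ∀ H, C.G.Eulerian H → (∀ e, H e ≠ 0 → C.A e) → ∀ Y, C.G.Closed (C.orc H) Y →
    (∀ v ∈ Y, ∀ b ∈ C.VB, ¬ C.G.Conn (C.orc H) v b) →
    costOf c (C.G.restrict (C.orc H) Y) ≤ α * θ * C.wt Y
  mode : (α = 0 ∧ ∀ e, ¬ C.Ac e) ∨ (1 ≤ 2 * α ∧ ∀ e, C.A e → C.Ac e)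

/-- The total weight of the entities with representative in `P`. -/
noncomputable def entityWeight (s : St n m) (P : Set (Fin n)) : ℝ :=
  ∑ t, if s.id t = t ∧ t ∈ P then (s.w t : ℝ) else 0

theorem entityWeight_mono {P P' : Set (Fin n)} (h : P ⊆ P') : entityWeight s P ≤ entityWeight s P' := by
  refine Finset.sum_le_sum fun t _ => ?_
  by_cases h1 : s.id t = t ∧ t ∈ P
  · rw [if_pos h1, if_pos ⟨h1.1, h h1.2⟩]
  · rw [if_neg h1]; split_ifs <;> positivity

theorem entityWeight_nonneg (P : Set (Fin n)) : 0 ≤ entityWeight s P :=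
  Finset.sum_nonneg fun t _ => by split_ifs <;> positivity

theorem entityWeight_union {P P' : Set (Fin n)} (h : Disjoint P P') :
    entityWeight s (P ∪ P') = entityWeight s P + entityWeight s P' := by
  rw [entityWeight, entityWeight, entityWeight, ← Finset.sum_add_distrib]
  refine Finset.sum_congr rfl fun t _ => ?_
  by_cases h1 : t ∈ P
  · have h2 : t ∉ P' := Set.disjoint_left.1 h h1
    simp [h1, h2]
  · simp [h1]

theorem entityWeight_singleton {t : Fin n} (ht : s.id t = t) : entityWeight s {t} = s.w t := by
  rw [entityWeight, Finset.sum_eq_single t]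
  · simp [ht]
  · intro b _ hb; simp [hb]
  · simp

/-- The bookkeeping of the costs that have been paid. `Q` consists of the vertices whose entities
have paid for components of Subtour Cover solutions, `PH` and `PX` are the entities that
have paid for cycles in `H` and in `X`. -/
structure Paid (C : Setup n m) (s : St n m) (c : Fin m → ℝ) (θ α : ℝ) (Q PH PX : Set (Fin n)) : Prop where
  Q_own : ∀ u v, v ∈ Q → s.id u = s.id v → u ∈ Q
  disjoint : Disjoint PH PX
  H_cost : costOf c s.H ≤ 2 * α * θ * entityWeight s Set.univ +
    α * θ * (2 + 2 / C.d) * entityWeight s Q + (1 + 1 / C.d) * θ * entityWeight s PH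
  X_cost : ∀ Y, C.G.Closed (C.merged s) Y →
    costOf c (C.G.restrict s.X Y) ≤ (1 + 1 / C.d) * θ * entityWeight s (PX ∩ Y)
  Q_conn : ∀ v ∈ Q, ∀ u, C.G.DReach (C.light s (s.w v)) v u → C.G.DReach (C.light s (s.w v)) u v →
    C.G.Conn s.H v u
  H_top : ∀ v ∉ C.VB, ∃ t, C.G.Conn s.H v t ∧ t ∉ PH ∧ s.id t = t ∧
    ∀ u, C.G.Conn s.H v u → s.w u ≤ s.w t
  M_top : ∀ v, C.outside s v → ∃ t, C.G.Conn (C.merged s) v t ∧ t ∉ PH ∧ t ∉ PX ∧ s.id t = t ∧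
    ∀ u, C.G.Conn (C.merged s) v u → s.w u ≤ s.w t

/-- Among the conditions in `Paid`, `M_top` provides an entity that can pay for the next cycle, and
`H_top` restores `M_top` when `X` is discarded. `Q_conn` excludes a second charge for solution
components. `X_cost` holds for every union of components, so that one component can be finalized
alone. -/
structure CostInv (C : Setup n m) (s : St n m) (c : Fin m → ℝ) (θ α : ℝ) : Prop where
  K_cost : ∀ v, costOf c (s.K v) ≤ 2 * α * θ * s.w v
  paid : ∃ Q PH PX, Paid C s c θ α Q PH PX

theorem Inv.conn_id (hs : C.Inv s) (v : Fin n) : C.G.Conn s.H v (s.id v) :=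
  (hs.K_conn v (s.id v) (hs.id_id v).symm).mono fun e he => hs.K_le_H _ e he

theorem Inv.w_id (hs : C.Inv s) (v : Fin n) : s.w (s.id v) = s.w v := hs.w_eq _ _ (hs.id_id v)

theorem exists_heaviest (s : St n m) (F : Fin m → ℕ) (v : Fin n) :
    ∃ t, C.G.Conn F v t ∧ ∀ u, C.G.Conn F v u → s.w u ≤ s.w t := by
  obtain ⟨t, ht, h⟩ := Finset.exists_max_image (Finset.univ.filter fun u => C.G.Conn F v u) s.w
    ⟨v, by simpa using Conn.refl v⟩
  simp only [Finset.mem_filter, Finset.mem_univ, true_and] at ht h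
  exact ⟨t, ht, h⟩

theorem costInv_fresh (hθ : 0 ≤ θ) (hs : C.Inv s)
    (hK : ∀ v, costOf c (s.K v) ≤ 2 * α * θ * s.w v) (hX : s.X = 0)
    (hH : s.H = ∑ v with s.id v = v, s.K v) : CostInv C s c θ α := by
  refine ⟨hK, ∅, ∅, ∅, ?_⟩
  have hempty : entityWeight s ∅ = 0 := by simp [entityWeight]
  refine
    { Q_own := fun _ _ h => absurd h (Set.notMem_empty _)
      disjoint := Set.disjoint_empty _
      H_cost := ?_
      X_cost := fun Y _ => ?_
      Q_conn := fun _ h => absurd h (Set.notMem_empty _)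
      H_top := fun v _ => ?_
      M_top := fun v _ => ?_ }
  · rw [hempty, mul_zero, mul_zero, add_zero, add_zero, hH, costOf_sum, entityWeight, Finset.mul_sum,
      Finset.sum_filter]
    refine Finset.sum_le_sum fun v _ => ?_
    by_cases h : s.id v = v
    · simpa [h] using hK v
    · simp [h]
  · rw [hX, show C.G.restrict (0 : Fin m → ℕ) Y = 0 by ext e; simp [restrict], costOf_zero]
    have := entityWeight_nonneg (s := s) (∅ ∩ Y)
    positivity
  · obtain ⟨t, h1, h2⟩ := exists_heaviest (C := C) s s.H v
    exact ⟨s.id t, h1.trans (hs.conn_id t), Set.notMem_empty _, hs.id_id t, by rwa [hs.w_id]⟩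
  · obtain ⟨t, h1, h2⟩ := exists_heaviest (C := C) s (C.merged s) v
    exact ⟨s.id t, h1.trans (conn_merged_of_H (hs.conn_id t)), Set.notMem_empty _, Set.notMem_empty _,
      hs.id_id t, by rwa [hs.w_id]⟩

theorem costInv_restart (hc : CostValid C c θ α R) (hK : ∀ v, costOf c (s.K v) ≤ 2 * α * θ * s.w v)
    {U : Set (Fin n)} {K : Fin m → ℕ} (hs' : C.Inv (C.restart s U K))
    (hKU : costOf c K ≤ 2 * α * θ * C.wt U) : CostInv C (C.restart s U K) c θ α := by
  refine costInv_fresh hc.θ_nonneg hs' (fun v => ?_) rfl (restart_H_eq U K)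
  change costOf c (C.newK s U K v) ≤ _
  rcases newClass_cases (C := C) (s := s) U v with h | ⟨h, h'⟩ | ⟨h, h'⟩
  · rwa [newK_of_mem h, restart_w_of_mem h]
  · rw [newK_of_alive h h', restart_w_of_alive h h']; exact hK v
  · rw [newK_of_dead h h', costOf_zero]
    have := hc.θ_nonneg
    have := hc.α_nonneg
    positivity

/-- Let `o` be the current weight of the entity and `b` the attached weight outside it. Then `o ≥ (1
- 1/d) w`, `b ≥ (1 + 2/d) w`, and the attached weight is at most `b + w`. Hence `2 w` plus the
attached weight is at most `3 w + b ≤ 2 o + 2 b`. -/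
theorem bad_cost (hC : C.Valid) (hc : CostValid C c θ α R) (hs : C.Inv s)
    (hK : ∀ v, costOf c (s.K v) ≤ 2 * α * θ * s.w v) {v : Fin n} (hv : C.bad s v) :
    costOf c (s.K v + C.G.restrict (C.orc s.H) (C.attached s v)) ≤
      2 * α * θ * C.wt (own s v ∪ C.attached s v) := by
  have h1 := hc.orc_component _ hs.H_eulerian hs.H_sub _ (attached_closed v) fun u hu => hu.1
  rw [costOf_add]
  have h2 : 2 * s.w v + C.wt (C.attached s v) ≤ 2 * C.wt (own s v ∪ C.attached s v) := by
    rw [wt_union]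
    have e1 := wt_diff_add_inter (C := C) (C.attached s v) (own s v)
    have e2 : C.wt (C.attached s v ∩ own s v) ≤ C.wt (own s v) := wt_mono Set.inter_subset_right
    have e3 := hs.w_le v
    have e4 := hs.le_w v
    have e5 := hv.2
    have hd : 0 < C.d := by have := hC.two_le_d; omega
    refine Nat.le_of_mul_le_mul_left (c := C.d) ?_ hd
    have e6 := Nat.mul_le_mul_left C.d (e2.trans e4)
    rw [← e1]
    ring_nf at e3 e5 e6 ⊢
    omega
  have h3 : (2 * s.w v + C.wt (C.attached s v) : ℝ) ≤ 2 * C.wt (own s v ∪ C.attached s v) := by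
    exact_mod_cast h2
  have h4 := mul_le_mul_of_nonneg_left h3 (mul_nonneg hc.α_nonneg hc.θ_nonneg)
  have h5 := hK v
  linarith

theorem chord_cycle_cost (hc : CostValid C c θ α R) {t : Fin n} {e : Fin m} (h : C.chord s t e) :
    costOf c (C.G.cycle (C.light s (s.w t)) e) ≤
      θ * C.wt (C.G.verts (C.G.cycle (C.light s (s.w t)) e)) :=
  hc.cycle_cost _ (eulerian_cycle h.2.1) (fun _ hf => (cycle_subset (S := C.light s (s.w t)) h.1 hf).1)
    (cycle_out_le_one h.2.1)

/-- Here `1 ≤ 2 * α` is needed: a cycle may cost as much as its vertices weigh. For `α = 0` there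
are no chords. -/
theorem big_cost (hc : CostValid C c θ α R) {t : Fin n} {e : Fin m} (h : C.chord s t e) :
    costOf c (C.G.cycle (C.light s (s.w t)) e) ≤
      2 * α * θ * C.wt (C.G.verts (C.G.cycle (C.light s (s.w t)) e)) := by
  rcases hc.mode with ⟨-, h'⟩ | ⟨h', -⟩
  · exact absurd h.1.1 (h' e)
  · refine (chord_cycle_cost hc h).trans ?_
    have := hc.θ_nonneg
    have h2 : θ * C.wt (C.G.verts (C.G.cycle (C.light s (s.w t)) e)) * 1 ≤
      θ * C.wt (C.G.verts (C.G.cycle (C.light s (s.w t)) e)) * (2 * α) :=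
      mul_le_mul_of_nonneg_left h' (by positivity)
    linarith

/-- Some tail on the cycle belongs to an entity heavy enough to pay up to the factor `1 + 1/d`;
being light, it is no heavier than `t`. -/
theorem not_big_cost (hC : C.Valid) (hc : CostValid C c θ α R) {t : Fin n} {e : Fin m} (h : C.chord s t e)
    (hb : ¬ C.big s (C.G.cycle (C.light s (s.w t)) e)) :
    costOf c (C.G.cycle (C.light s (s.w t)) e) ≤ (1 + 1 / C.d) * θ * s.w t := by
  refine (chord_cycle_cost hc h).trans ?_
  simp only [big, not_forall, not_le] at hb
  obtain ⟨f, hf, hb⟩ := hb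
  have h1 : s.w (C.G.tail f) ≤ s.w t := (cycle_subset (S := C.light s (s.w t)) h.1 hf).2.1
  have h2 := hb.le.trans (Nat.mul_le_mul_left _ h1)
  have h3 : (C.d : ℝ) * C.wt (C.G.verts (C.G.cycle (C.light s (s.w t)) e)) ≤ (C.d + 1) * s.w t := by
    exact_mod_cast h2
  have hd : (0 : ℝ) < C.d := by have := hC.two_le_d; positivity
  have h4 : (C.wt (C.G.verts (C.G.cycle (C.light s (s.w t)) e)) : ℝ) ≤ (1 + 1 / C.d) * s.w t := by
    rw [← mul_le_mul_iff_right₀ hd]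
    refine h3.trans (le_of_eq ?_)
    field_simp
  calc _ ≤ θ * ((1 + 1 / C.d) * s.w t) := mul_le_mul_of_nonneg_left h4 hc.θ_nonneg
    _ = _ := by ring

/-- The cycle is charged to the unpaid top `r` of the component of `t`. If the enlarged component
still avoids the backbone, then it contains a former component with an unpaid top that is no
lighter, because `t` is lowest. That top succeeds `r`. -/
theorem costInv_addCycle (hC : C.Valid) (hc : CostValid C c θ α R) (hi : CostInv C s c θ α)
    {t : Fin n} {e : Fin m} (ht : C.lowest s t) (he : C.chord s t e)
    (hb : ¬ C.big s (C.G.cycle (C.light s (s.w t)) e)) :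
    CostInv C { s with X := s.X + C.G.cycle (C.light s (s.w t)) e } c θ α := by
  obtain ⟨hK, Q, PH, PX, hP⟩ := hi
  set F := C.G.cycle (C.light s (s.w t)) e with hF
  set s' : St n m := { s with X := s.X + F } with hs'
  have hmono : ∀ f, C.merged s f ≠ 0 → C.merged s' f ≠ 0 := by
    intro f hf; simp only [merged, hs', Pi.add_apply] at hf ⊢; omega
  have hFm : ∀ f, F f ≠ 0 → C.merged s' f ≠ 0 := by
    intro f hf; simp only [merged, hs', Pi.add_apply] at hf ⊢; omega
  have hFe : F e ≠ 0 := cycle_self e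
  obtain ⟨r, hr1, hr2, hr3, hr4, hr5⟩ := hP.M_top t ht.1.1
  have hwr : s.w r = s.w t := le_antisymm (ht.1.2 r hr1) (hr5 t (Conn.refl t))
  -- The vertex `x` is the end of the chord outside the component of `t`; the successor of `r` is
  -- found in its component.
  obtain ⟨x, hx1, hx2⟩ : ∃ x, ¬ C.G.Conn (C.merged s) t x ∧ C.G.Conn (C.merged s') t x := by
    have he' := conn_edge (G := C.G) (hFm e hFe)
    have h3 := he.2.2
    by_cases h1 : C.G.Conn (C.merged s) t (C.G.tail e)
    · exact ⟨C.G.head e, fun h2 => h3 ⟨fun _ => h2, fun _ => h1⟩, (h1.mono hmono).trans he'⟩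
    · have h2 : C.G.Conn (C.merged s) t (C.G.head e) := by tauto
      exact ⟨C.G.tail e, h1, (h2.mono hmono).trans he'.symm⟩
  refine ⟨hK, Q, PH, insert r PX, { hP with disjoint := ?_, X_cost := ?_, M_top := ?_ }⟩
  · rw [Set.disjoint_right]
    intro a ha
    rcases Set.mem_insert_iff.1 ha with rfl | ha
    · exact hr2
    · exact Set.disjoint_right.1 hP.disjoint ha
  · intro Y hY
    have hY0 := hP.X_cost Y (hY.anti hmono)
    have hθd : 0 ≤ (1 + 1 / (C.d : ℝ)) * θ := by have := hc.θ_nonneg; positivity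
    change costOf c (C.G.restrict (s.X + F) Y) ≤ _ * _ * entityWeight s (insert r PX ∩ Y)
    rw [MultiDigraph.restrict_add, costOf_add]
    by_cases htY : t ∈ Y
    · have hrY : r ∈ Y := (hY.anti hmono).mem hr1 htY
      have e1 : insert r PX ∩ Y = (PX ∩ Y) ∪ {r} := by
        ext a; simp only [Set.mem_inter_iff, Set.mem_insert_iff, Set.mem_union, Set.mem_singleton_iff]
        constructor
        · rintro ⟨rfl | h, h'⟩ <;> tauto
        · rintro (⟨h, h'⟩ | rfl) <;> tauto
      rw [e1, entityWeight_union (by simp [hr3]), entityWeight_singleton hr4, hwr, mul_add]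
      have h1 := (costOf_mono hc.c_nonneg (MultiDigraph.restrict_le (G := C.G) F Y)).trans
        (not_big_cost hC hc he hb)
      linarith
    · have h0 : C.G.restrict F Y = 0 := by
        ext f
        by_contra hf
        obtain ⟨h1, h2⟩ := restrict_ne_zero.1 hf
        have h3 : C.G.Conn F (C.G.tail f) (C.G.tail e) := cycle_conn he.2.1 h2
        have h4 : C.G.tail e ∈ Y := hY.mem (h3.mono hFm) h1
        have h5 : C.G.head e ∈ Y := hY.mem (conn_edge (hFm e hFe)) h4
        have h6 := he.2.2
        by_cases h7 : C.G.Conn (C.merged s) t (C.G.tail e)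
        · exact htY ((hY.anti hmono).mem h7.symm h4)
        · have h8 : C.G.Conn (C.merged s) t (C.G.head e) := by tauto
          exact htY ((hY.anti hmono).mem h8.symm h5)
      rw [h0, costOf_zero, add_zero]
      exact hY0.trans (mul_le_mul_of_nonneg_left
        (entityWeight_mono (Set.inter_subset_inter_left _ (Set.subset_insert _ _))) hθd)
  · intro v hv
    have hout : ∀ u, C.G.Conn (C.merged s') v u → C.outside s u := fun u hu b hb hc =>
      hv b hb (hu.trans (hc.mono hmono))
    obtain ⟨u, hu1, hu2⟩ := exists_heaviest (C := C) s (C.merged s') v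
    obtain ⟨a, ha1, ha2, ha3, ha4, ha5⟩ := hP.M_top u (hout u hu1)
    -- Only when the old top is `r`, which has just paid, is a successor required.
    by_cases har : a = r
    · subst har
      have hvx : C.G.Conn (C.merged s') v x :=
        hu1.trans ((ha1.mono hmono).trans ((hr1.symm.mono hmono).trans hx2))
      obtain ⟨b, hb1, hb2, hb3, hb4, hb5⟩ := hP.M_top x (hout x hvx)
      have htop : C.top s b := ⟨outside_conn (hout x hvx) hb1, fun y hy => hb5 y (hb1.trans hy)⟩
      have hle := ht.2 b htop
      refine ⟨b, hvx.trans (hb1.mono hmono), hb2, ?_, hb4, fun y hy => ?_⟩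
      · rw [Set.mem_insert_iff, not_or]
        refine ⟨?_, hb3⟩
        rintro rfl
        exact hx1 (hr1.trans hb1.symm)
      · have h1 := hu2 y hy
        have h2 := ha5 u (Conn.refl u)
        change s.w y ≤ s.w b
        omega
    · refine ⟨a, hu1.trans (ha1.mono hmono), ha2, ?_, ha4, fun y hy => ?_⟩
      · rw [Set.mem_insert_iff, not_or]; exact ⟨har, ha3⟩
      · exact (hu2 y hy).trans (ha5 u (Conn.refl u))

/-- A useful component without backbone vertices has its heaviest entity outside `Q`. -/
theorem heaviest_not_mem (hC : C.Valid) (hs : C.Inv s) {Q PH PX : Set (Fin n)}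
    (hP : Paid C s c θ α Q PH PX) (hA : ∀ e, C.A e → C.Ac e) {u j : Fin n} (hu : u ∈ C.useful s)
    (hB : ∀ b ∈ C.VB, ¬ C.G.Conn (C.orc s.H) u b)
    (hj : C.G.Conn (C.orc s.H) u j) (hmax : ∀ x, C.G.Conn (C.orc s.H) u x → s.w x ≤ s.w j) : j ∉ Q := by
  intro hjQ
  let Y : Set (Fin n) := {x | C.G.Conn (C.orc s.H) u x}
  have hY : C.G.Closed (C.orc s.H) Y := closed_conn u
  -- The component is Eulerian, hence strongly connected, and all its edges are light for `j`. So
  -- `Q_conn` puts it into one component of `H`, which contradicts usefulness.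
  have hE := (hC.orc_eulerian _ hs.H_eulerian hs.H_sub).restrict hY
  have hlight : ∀ e, C.G.restrict (C.orc s.H) Y e ≠ 0 → C.light s (s.w j) e := by
    intro e he
    obtain ⟨h1, h2⟩ := restrict_ne_zero.1 he
    have h1' : C.G.Conn (C.orc s.H) u (C.G.tail e) := h1
    refine ⟨hA e (hC.orc_sub _ hs.H_eulerian hs.H_sub e h2 fun b hb hc => hB b hb (h1'.trans hc)),
      hmax _ h1', hmax _ ((hY e h2).1 h1)⟩
  have key : ∀ x ∈ Y, C.G.Conn s.H j x := by
    intro x hx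
    have h1 : C.G.Conn (C.G.restrict (C.orc s.H) Y) j x :=
      Conn.restrict hY hj (hj.symm.trans hx)
    exact hP.Q_conn j hjQ x ((hE.dreach h1).mono hlight) ((hE.dreach h1.symm).mono hlight)
  obtain ⟨u', h1, h2⟩ := hu
  exact h2 ((key u (Conn.refl u)).symm.trans (key u' h1))

theorem attached_congr (hs : C.Inv s) {u v : Fin n} (h : s.id u = s.id v) :
    C.attached s u = C.attached s v := by
  ext x; simp only [attached, hs.w_eq u v h, h]

/-- Each useful component is charged to its heaviest entity, which has not paid before. As this
entity is not bad, the weight charged to it is at most `(1 + 2/d) w` outside and `w` inside the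
entity. For `α = 0` the components cost nothing. -/
theorem useful_cost (hC : C.Valid) (hc : CostValid C c θ α R) (hs : C.Inv s) {Q PH PX : Set (Fin n)}
    (hP : Paid C s c θ α Q PH PX) (hbad : ∀ v, ¬ C.bad s v) {t : Fin n} (ht : C.outside s t) :
    costOf c (C.G.restrict (C.G.restrict (C.orc s.H) (C.useful s)) {u | C.G.Conn (C.merged s) t u}) ≤
      α * θ * (2 + 2 / C.d) * entityWeight s ({u | C.G.Conn (C.merged s) t u} \ Q) := by
  set Z : Set (Fin n) := {u | C.G.Conn (C.merged s) t u} with hZ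
  have hZc : C.G.Closed (C.orc s.H) Z :=
    closed_merged t fun e he => merged_ne_zero.2 (Or.inr (Or.inl he))
  have hYc : C.G.Closed (C.orc s.H) (C.useful s ∩ Z) := fun e he =>
    and_congr (useful_closed e he) (hZc e he)
  have hZB : ∀ v ∈ Z, ∀ b ∈ C.VB, ¬ C.G.Conn (C.orc s.H) v b := fun v hv b hb h =>
    ht b hb (Conn.trans hv (conn_merged_of_orc h))
  rw [MultiDigraph.restrict_restrict]
  refine (hc.orc_component _ hs.H_eulerian hs.H_sub _ hYc fun v hv => hZB v hv.2).trans ?_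
  rcases hc.mode with ⟨h0, -⟩ | ⟨-, hA⟩
  · simp [h0]
  have hd : (0 : ℝ) < C.d := by have := hC.two_le_d; positivity
  rw [mul_assoc (α * θ)]
  refine mul_le_mul_of_nonneg_left ?_ (mul_nonneg hc.α_nonneg hc.θ_nonneg)
  have h1 : C.wt (C.useful s ∩ Z) ≤
      ∑ r, if s.id r = r ∧ r ∈ Z \ Q then C.wt (C.attached s r) else 0 := by
    have : ∀ r, (if s.id r = r ∧ r ∈ Z \ Q then C.wt (C.attached s r) else 0) =
        ∑ u, if (s.id r = r ∧ r ∈ Z \ Q) ∧ u ∈ C.attached s r then C.ℓ u else 0 := by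
      intro r
      by_cases h : s.id r = r ∧ r ∈ Z \ Q
      · simp [h, wt]
      · simp only [h, if_false, false_and, Finset.sum_const_zero]
    simp only [this]
    rw [Finset.sum_comm, wt]
    refine Finset.sum_le_sum fun u _ => ?_
    split_ifs with hu
    · obtain ⟨j, hj1, hj2⟩ := exists_heaviest (C := C) s (C.orc s.H) u
      have hjQ : j ∉ Q := heaviest_not_mem hC hs hP hA hu.1 (hZB u hu.2) hj1 hj2
      have hr : (s.id (s.id j) = s.id j ∧ s.id j ∈ Z \ Q) ∧ u ∈ C.attached s (s.id j) := by
        refine ⟨⟨hs.id_id j, ?_, fun h => hjQ (hP.Q_own j _ h (hs.id_id j).symm)⟩, ?_⟩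
        · exact (Conn.trans hu.2 (conn_merged_of_orc hj1)).trans (conn_merged_of_H (hs.conn_id j))
        · rw [attached_congr hs (hs.id_id j)]
          exact ⟨hZB u hu.2, hu.1, ⟨j, hj1, rfl⟩, hj2⟩
      have h2 := Finset.single_le_sum
        (f := fun r => if (s.id r = r ∧ r ∈ Z \ Q) ∧ u ∈ C.attached s r then C.ℓ u else 0)
        (fun _ _ => Nat.zero_le _) (Finset.mem_univ (s.id j))
      simp only [if_pos hr] at h2
      exact h2
    · exact Nat.zero_le _
  have h2 : (C.wt (C.useful s ∩ Z) : ℝ) ≤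
      ∑ r, if s.id r = r ∧ r ∈ Z \ Q then (C.wt (C.attached s r) : ℝ) else 0 := by
    exact_mod_cast h1
  refine h2.trans ?_
  rw [entityWeight, Finset.mul_sum]
  refine Finset.sum_le_sum fun r _ => ?_
  split_ifs with hr
  · have hrB : r ∉ C.VB := (outside_conn ht hr.2.1).not_mem
    have e0 : ¬ (C.d + 2) * s.w r ≤ C.d * C.wt (C.attached s r \ own s r) := fun h => hbad r ⟨hrB, h⟩
    have e1 := wt_diff_add_inter (C := C) (C.attached s r) (own s r)
    have e2 : C.wt (C.attached s r ∩ own s r) ≤ s.w r := (wt_mono Set.inter_subset_right).trans (hs.le_w r)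
    have e3 : C.d * C.wt (C.attached s r) ≤ (2 * C.d + 2) * s.w r := by
      rw [← e1]
      have := Nat.mul_le_mul_left C.d e2
      ring_nf at this e0 ⊢
      omega
    have e4 : (C.d : ℝ) * C.wt (C.attached s r) ≤ (2 * C.d + 2) * s.w r := by exact_mod_cast e3
    rw [← mul_le_mul_iff_right₀ hd]
    refine e4.trans (le_of_eq ?_)
    field_simp
  · simp

/-- All of `Z` joins `Q`: the new `H` connects `Z`, and without chords no light strong component of
a vertex in `Z` leaves `Z`. Payments for cycles inside `Z` pass from `PX` to `PH`; the other ones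
are cancelled together with their cycles. -/
theorem costInv_finalize (hC : C.Valid) (hc : CostValid C c θ α R) (hs : C.Inv s)
    (hi : CostInv C s c θ α) (hbad : ∀ v, ¬ C.bad s v) {t : Fin n} (ht : C.lowest s t)
    (hch : ∀ e, ¬ C.chord s t e) :
    CostInv C { s with H := s.H + C.finalEdges s t, X := 0 } c θ α := by
  obtain ⟨hK, Q, PH, PX, hP⟩ := hi
  set Z : Set (Fin n) := {u | C.G.Conn (C.merged s) t u} with hZ
  set s' : St n m := { s with H := s.H + C.finalEdges s t, X := 0 } with hs'
  have hHm : ∀ f, s.H f ≠ 0 → C.merged s f ≠ 0 := fun f hf => merged_ne_zero.2 (Or.inl hf)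
  have hHH : ∀ f, s.H f ≠ 0 → s'.H f ≠ 0 := fun f hf => by simp only [hs', Pi.add_apply]; omega
  have hH'm : ∀ f, s'.H f ≠ 0 → C.merged s f ≠ 0 := by
    intro f hf
    by_cases h : s.H f = 0
    · have : C.finalEdges s t f ≠ 0 := by simpa [hs', h] using hf
      obtain ⟨-, h1 | ⟨-, h1⟩⟩ := finalEdges_ne_zero.1 this
      · exact merged_ne_zero.2 (Or.inr (Or.inr (Or.inl h1)))
      · exact merged_ne_zero.2 (Or.inr (Or.inl h1))
    · exact hHm f h
  have hZM : C.G.Closed (C.merged s) Z := closed_conn t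
  have hZH : C.G.Closed s.H Z := hZM.anti hHm
  have hZH' : C.G.Closed s'.H Z := hZM.anti hH'm
  have hZconn : ∀ u ∈ Z, C.G.Conn s'.H t u := by
    have : C.G.Closed (C.merged s) {u | u ∈ Z → C.G.Conn s'.H t u} := by
      intro e he
      by_cases hte : C.G.tail e ∈ Z
      · have hhe := (hZM e he).1 hte
        have : C.G.Conn s'.H (C.G.tail e) (C.G.head e) := by
          rcases merged_ne_zero.1 he with h | h | h | h
          · exact conn_edge (hHH e h)
          -- An omitted solution edge belongs to a component that joins nothing, so `H` connects its
          -- ends.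
          · by_cases hu : C.G.tail e ∈ C.useful s
            · refine conn_edge ?_
              have := finalEdges_ne_zero.2 ⟨hte, Or.inr ⟨hu, h⟩⟩
              simp only [hs', Pi.add_apply]; omega
            · have : C.G.Conn s.H (C.G.tail e) (C.G.head e) := by
                by_contra hn
                exact hu ⟨_, conn_edge h, hn⟩
              exact this.mono hHH
          · refine conn_edge ?_
            have := finalEdges_ne_zero.2 ⟨hte, Or.inl h⟩
            simp only [hs', Pi.add_apply]; omega
          · exact absurd (hC.EB_endpoints e h).1 (outside_conn ht.1.1 hte).not_mem
        exact ⟨fun h _ => (h hte).trans this, fun h _ => (h hhe).trans this.symm⟩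
      · have hhe : C.G.head e ∉ Z := fun h => hte ((hZM e he).2 h)
        exact ⟨fun _ h => absurd h hhe, fun _ h => absurd h hte⟩
    intro u hu
    exact this.mem hu (fun _ => Conn.refl t) hu
  have hZB : ∀ v ∈ Z, v ∉ C.VB := fun v hv => (outside_conn ht.1.1 hv).not_mem
  obtain ⟨r, hr1, hr2, hr3, hr4, hr5⟩ := hP.M_top t ht.1.1
  have hHtop : ∀ v ∉ C.VB, ∃ a, C.G.Conn s'.H v a ∧ a ∉ PH ∪ (PX ∩ Z) ∧ s'.id a = a ∧
      ∀ u, C.G.Conn s'.H v u → s'.w u ≤ s'.w a := by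
    intro v hv
    by_cases hvZ : v ∈ Z
    · refine ⟨r, (hZconn v hvZ).symm.trans (hZconn r hr1), ?_, hr4, fun u hu => ?_⟩
      · rintro (h | h)
        exacts [hr2 h, hr3 h.1]
      · exact hr5 u (hZH'.mem hu hvZ)
    · obtain ⟨a, ha1, ha2, ha3, ha4⟩ := hP.H_top v hv
      have hcomp : C.G.Closed s'.H {x | C.G.Conn s.H v x} := by
        intro e he
        by_cases h : s.H e = 0
        · have hf : C.finalEdges s t e ≠ 0 := by simpa [hs', h] using he
          have hte : C.G.tail e ∈ Z := (finalEdges_ne_zero.1 hf).1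
          have hhe : C.G.head e ∈ Z := (hZH' e he).1 hte
          exact ⟨fun h1 => absurd (hZH.mem (Conn.symm h1) hte) hvZ,
            fun h1 => absurd (hZH.mem (Conn.symm h1) hhe) hvZ⟩
        · exact closed_conn v e h
      refine ⟨a, ha1.mono hHH, ?_, ha3, fun u hu => ha4 u (hcomp.mem hu (Conn.refl v))⟩
      rintro (h | h)
      · exact ha2 h
      · exact hvZ (hZH.mem ha1.symm h.2)
  have hX := hP.X_cost Z hZM
  have hF := useful_cost hC hc hs hP hbad ht.1.1
  refine ⟨hK, Q ∪ Z, PH ∪ (PX ∩ Z), ∅,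
    { Q_own := ?_
      disjoint := Set.disjoint_empty _
      H_cost := ?_
      X_cost := fun Y _ => ?_
      Q_conn := ?_
      H_top := hHtop
      M_top := fun v hv => ?_ }⟩
  · rintro u v (hv | hv) huv
    · exact Or.inl (hP.Q_own u v hv huv)
    · right
      have h1 : C.G.Conn s.H v u := by
        have e1 := hs.conn_id v
        have e2 := hs.conn_id u
        rw [show s.id u = s.id v from huv] at e2
        exact e1.trans e2.symm
      exact hZH.mem h1 hv
  · change costOf c (s.H + C.finalEdges s t) ≤ 2 * α * θ * entityWeight s Set.univ +
      α * θ * (2 + 2 / C.d) * entityWeight s (Q ∪ Z) +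
      (1 + 1 / C.d) * θ * entityWeight s (PH ∪ (PX ∩ Z))
    rw [costOf_add, finalEdges, MultiDigraph.restrict_add, costOf_add,
      entityWeight_union (hP.disjoint.mono_right Set.inter_subset_left), ← Set.union_sdiff_self,
      entityWeight_union disjoint_sdiff_self_right, mul_add, mul_add]
    have h1 := hP.H_cost
    linarith
  · rw [show C.G.restrict s'.X Y = 0 by ext e; simp [restrict, hs'], costOf_zero]
    have := entityWeight_nonneg (s := s') (∅ ∩ Y)
    have := hc.θ_nonneg
    positivity
  · rintro v (hv | hv) u h1 h2
    · exact (hP.Q_conn v hv u h1 h2).mono hHH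
    -- Since `t` is heaviest in `Z`, edges light for `v` are light for `t`. The first edge leaving
    -- `Z` on a closed walk of such edges would be a chord.
    · have hvt : s.w v ≤ s.w t := ht.1.2 v hv
      have hsub : ∀ e, C.light s (s.w v) e → C.light s (s.w t) e := fun e he =>
        ⟨he.1, he.2.1.trans hvt, he.2.2.trans hvt⟩
      have huZ : u ∈ Z := by
        replace h1 : C.G.DReach (C.light s (s.w t)) v u := h1.mono hsub
        replace h2 : C.G.DReach (C.light s (s.w t)) u v := h2.mono hsub
        induction h1 with
        | refl => exact hv
        | @tail b x hb hbx ih =>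
          obtain ⟨e, he, rfl, rfl⟩ := hbx
          have hb2 : C.G.DReach (C.light s (s.w t)) (C.G.tail e) v := (DReach.edge he).trans h2
          have hbZ := ih hb2
          by_contra hx
          exact hch e ⟨he, h2.trans hb, fun h => hx (h.1 hbZ)⟩
      exact (hZconn v hv).symm.trans (hZconn u huZ)
  -- Now `X` is empty, so the unpaid top of the `H`-component of a heaviest vertex serves the whole
  -- component.
  · obtain ⟨u, hu1, hu2⟩ := exists_heaviest (C := C) s' (C.merged s') v
    have hu : u ∉ C.VB := (outside_conn hv hu1).not_mem
    obtain ⟨a, ha1, ha2, ha3, ha4⟩ := hHtop u hu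
    refine ⟨a, hu1.trans (conn_merged_of_H ha1), ha2, Set.notMem_empty _, ha3, fun y hy => ?_⟩
    exact (hu2 y hy).trans (ha4 u (Conn.refl u))

/-- What is known about the result when the algorithm stops. -/
structure Final (C : Setup n m) (s : St n m) (c : Fin m → ℝ) (θ α R : ℝ) : Prop where
  eulerian : C.G.Eulerian (C.EB + s.H)
  conn : ∀ u v, C.G.Conn (C.EB + s.H) u v
  cost : costOf c s.H ≤ R + (α * (4 + 2 / C.d) + (1 + 1 / C.d)) * (1 + 2 / C.d) * (θ * C.wt Set.univ)

/-- Combine `w ≤ wt + w / d` with the crude bound `w ≤ 2 wt`. -/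
theorem entityWeight_univ_le (hC : C.Valid) (hs : C.Inv s) :
    entityWeight s Set.univ ≤ (1 + 2 / C.d) * C.wt Set.univ := by
  have hd2 : (2 : ℝ) ≤ C.d := by exact_mod_cast hC.two_le_d
  rw [← hs.sum_wt_own, entityWeight]
  push_cast
  rw [Finset.mul_sum]
  refine Finset.sum_le_sum fun t _ => ?_
  by_cases h : s.id t = t
  · simp only [h, Set.mem_univ, and_self, if_true]
    have h1 : (C.d : ℝ) * s.w t ≤ C.d * C.wt (own s t) + s.w t := by exact_mod_cast hs.w_le t
    have h0 : (0 : ℝ) ≤ C.wt (own s t) := by positivity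
    have h3 : (1 + 2 / (C.d : ℝ)) * C.wt (own s t) = (C.d + 2) * C.wt (own s t) / C.d := by
      field_simp
    rw [h3, le_div_iff₀ (by linarith)]
    have h4 : (s.w t : ℝ) ≤ 2 * C.wt (own s t) := by exact_mod_cast hs.w_le_two_mul hC t
    nlinarith
  · simp [h]

theorem exists_lowest (z : Fin n) (hz : C.outside s z) : ∃ t, C.lowest s t := by
  have hne : (Finset.univ.filter fun t => C.top s t).Nonempty := by
    obtain ⟨t, h1, h2⟩ := exists_heaviest (C := C) s (C.merged s) z
    exact ⟨t, by simpa using ⟨outside_conn hz h1, fun u hu => h2 u (h1.trans hu)⟩⟩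
  obtain ⟨t, ht, h⟩ := Finset.exists_min_image _ s.w hne
  simp only [Finset.mem_filter, Finset.mem_univ, true_and] at ht h
  exact ⟨t, ht, h⟩

/-- Without a lowest vertex every component reaches the backbone. Each entity contributes `2α` for
its own edges and at most `(2 + 2/d) α` for solution components, and at most `1 + 1/d` for cycles
because `PH` and `PX` are disjoint. -/
theorem final_of_no_lowest (hC : C.Valid) (hc : CostValid C c θ α R) (hs : C.Inv s)
    (hi : CostInv C s c θ α) (hl : ∀ t, ¬ C.lowest s t) :
    Final C { s with H := s.H + C.orc s.H + s.X, done := True } c θ α R := by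
  obtain ⟨-, Q, PH, PX, hP⟩ := hi
  have hin : ∀ z, ∃ b ∈ C.VB, C.G.Conn (C.merged s) z b := by
    intro z
    by_contra h
    push Not at h
    obtain ⟨t, ht⟩ := exists_lowest z h
    exact hl t ht
  have hM : ∀ u v, C.G.Conn (C.merged s) u v → C.G.Conn (C.EB + (s.H + C.orc s.H + s.X)) u v :=
    fun u v h => h.mono fun e he => by simp only [merged, Pi.add_apply] at he ⊢; omega
  refine ⟨?_, fun u v => hM u v ?_, ?_⟩
  · exact hC.EB_eulerian.add ((hs.H_eulerian.add (hC.orc_eulerian _ hs.H_eulerian hs.H_sub)).add hs.X_eulerian)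
  · obtain ⟨a, ha, hua⟩ := hin u
    obtain ⟨b, hb, hvb⟩ := hin v
    exact hua.trans (((hC.EB_conn a ha b hb).mono fun e he =>
      merged_ne_zero.2 (Or.inr (Or.inr (Or.inr he)))).trans hvb.symm)
  · change costOf c (s.H + C.orc s.H + s.X) ≤ _
    rw [costOf_add, costOf_add]
    have h1 := hP.H_cost
    have h2 := hc.orc_total _ hs.H_eulerian hs.H_sub
    have h3 := hP.X_cost Set.univ fun e _ => by simp
    rw [show C.G.restrict s.X Set.univ = s.X by ext e; simp [restrict], Set.inter_univ] at h3
    have hd : (0 : ℝ) < C.d := by have := hC.two_le_d; positivity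
    have hθ := hc.θ_nonneg
    have hα := hc.α_nonneg
    have h4 : entityWeight s PH + entityWeight s PX ≤ entityWeight s Set.univ := by
      rw [← entityWeight_union hP.disjoint]; exact entityWeight_mono (Set.subset_univ _)
    have h5 : entityWeight s Q ≤ entityWeight s Set.univ := entityWeight_mono (Set.subset_univ _)
    have h6 := entityWeight_univ_le hC hs
    have k1 : α * θ * (2 + 2 / C.d) * entityWeight s Q ≤
        α * θ * (2 + 2 / C.d) * entityWeight s Set.univ :=
      mul_le_mul_of_nonneg_left h5 (by positivity)
    have k2 : (1 + 1 / C.d) * θ * (entityWeight s PH + entityWeight s PX) ≤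
        (1 + 1 / C.d) * θ * entityWeight s Set.univ :=
      mul_le_mul_of_nonneg_left h4 (by positivity)
    have k3 : (α * (4 + 2 / C.d) + (1 + 1 / C.d)) * θ * entityWeight s Set.univ ≤
        (α * (4 + 2 / C.d) + (1 + 1 / C.d)) * θ * ((1 + 2 / C.d) * C.wt Set.univ) :=
      mul_le_mul_of_nonneg_left h6 (by positivity)
    linarith

theorem init_costInv (hθ : 0 ≤ θ) (hα : 0 ≤ α) : CostInv C C.init c θ α := by
  refine costInv_fresh hθ init_inv (fun v => ?_) rfl ?_
  · change costOf c 0 ≤ _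
    rw [costOf_zero]; positivity
  · change (0 : Fin m → ℕ) = ∑ v with _, (0 : Fin n → Fin m → ℕ) v
    simp

theorem step_costInv (hC : C.Valid) (hc : CostValid C c θ α R) (hd : ¬ s.done) (hs : C.Inv s)
    (hi : CostInv C s c θ α) :
    (C.Inv (C.step s) ∧ ¬ (C.step s).done ∧ CostInv C (C.step s) c θ α) ∨
      (C.step s).done ∧ Final C (C.step s) c θ α R := by
  have hinv := step_inv hC hs
  revert hinv
  refine C.step_cases s (P := fun s' => (C.Inv s' ∨ s'.done) →
    (C.Inv s' ∧ ¬ s'.done ∧ CostInv C s' c θ α) ∨ s'.done ∧ Final C s' c θ α R) hd ?_ ?_ ?_ ?_ ?_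
  · intro v hv h
    have hnd : ¬ (C.restart s (own s v ∪ C.attached s v)
      (s.K v + C.G.restrict (C.orc s.H) (C.attached s v))).done := fun h => h
    have h := h.resolve_right hnd
    exact Or.inl ⟨h, hnd, costInv_restart hc hi.K_cost h (bad_cost hC hc hs hi.K_cost hv)⟩
  · intro t e _ _ he _ h
    have hnd : ¬ (C.restart s (C.G.verts (C.G.cycle (C.light s (s.w t)) e))
      (C.G.cycle (C.light s (s.w t)) e)).done := fun h => h
    have h := h.resolve_right hnd
    exact Or.inl ⟨h, hnd, costInv_restart hc hi.K_cost h (big_cost hc he)⟩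
  · intro t e _ ht he hb h
    exact Or.inl ⟨h.resolve_right hd, hd, costInv_addCycle hC hc hi ht he hb⟩
  · intro t hbad ht he h
    exact Or.inl ⟨h.resolve_right hd, hd, costInv_finalize hC hc hs hi hbad ht he⟩
  · intro _ hl _
    exact Or.inr ⟨trivial, final_of_no_lowest hC hc hs hi hl⟩

theorem run_final (hC : C.Valid) (hc : CostValid C c θ α R) {k : ℕ} (hk : (C.run k).done) :
    Final C (C.run k) c θ α R := by
  have key : ∀ k, (C.Inv (C.run k) ∧ ¬ (C.run k).done ∧ CostInv C (C.run k) c θ α) ∨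
      (C.run k).done ∧ Final C (C.run k) c θ α R := by
    intro k
    induction k with
    | zero => exact Or.inl ⟨init_inv, fun h => h, init_costInv hc.θ_nonneg hc.α_nonneg⟩
    | succ k ih =>
      rw [run_succ]
      rcases ih with ⟨h1, h2, h3⟩ | ⟨h1, h2⟩
      · exact step_costInv hC hc h2 h1 h3
      · right
        rw [step, if_pos h1]
        exact ⟨h1, h2⟩
  rcases key k with h | h
  · exact absurd hk h.2.1
  · exact h.2

end Setup

end ATSP

namespace ATSP

open Relation MultiDigraph
open scoped Classical

/-! Vertebrate pairs as instances of the abstract algorithm -/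

/-- The number of `k < Q` with `(k + 1) M ≤ a` is the integral part of `a / M`. -/
theorem count_mul_le {Q : ℕ} {M a : ℚ} (hM : 0 ≤ M) (ha : a ≤ Q * M) (ha0 : 0 ≤ a) (P : Fin Q → Prop)
    (hP : ∀ k, P k ↔ ((k : ℕ) + 1) * M ≤ a) :
    a ≤ M * (1 + (∑ k, if P k then 1 else 0 : ℕ)) ∧ M * (∑ k, if P k then 1 else 0 : ℕ) ≤ a := by
  rw [← Finset.card_filter]
  set T := Finset.univ.filter P with hT
  have hdown : ∀ k j : Fin Q, j ≤ k → k ∈ T → j ∈ T := by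
    intro k j hjk hk
    simp only [hT, Finset.mem_filter, Finset.mem_univ, true_and, hP] at hk ⊢
    refine le_trans (mul_le_mul_of_nonneg_right ?_ hM) hk
    have : (j : ℕ) ≤ k := hjk
    exact_mod_cast Nat.succ_le_succ this
  -- `T` is an initial segment, hence consists of the indices below its cardinality.
  have hin : ∀ k ∈ T, k.val < T.card := by
    intro k hk
    have h1 : Finset.Iic k ⊆ T := fun j hj => hdown k j (Finset.mem_Iic.1 hj) hk
    have := Finset.card_le_card h1
    rw [Fin.card_Iic] at this
    omega
  have hout : ∀ k ∉ T, T.card ≤ k.val := by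
    intro k hk
    have h1 : T ⊆ Finset.Iio k := fun j hj => Finset.mem_Iio.2 (by
      by_contra h
      exact hk (hdown j k (not_lt.1 h) hj))
    have := Finset.card_le_card h1
    rwa [Fin.card_Iio] at this
  have hle : T.card ≤ Q := by simpa using Finset.card_le_univ T
  constructor
  -- If all `Q` indices count, then `ha` suffices. This includes `M = 0`, where every comparison
  -- holds.
  · rcases hle.eq_or_lt with h | h
    · rw [h]; nlinarith
    · have hk : (⟨T.card, h⟩ : Fin Q) ∉ T := fun hk => absurd (hin _ hk) (lt_irrefl _)
      have hk' : ¬ P ⟨T.card, h⟩ := fun hp => hk (Finset.mem_filter.2 ⟨Finset.mem_univ _, hp⟩)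
      rw [hP, not_le] at hk'
      linarith
  · rcases Nat.eq_zero_or_pos T.card with h | h
    · rw [h]; simpa using ha0
    · have hk : (⟨T.card - 1, by omega⟩ : Fin Q) ∈ T := by
        by_contra hk
        have := hout _ hk
        simp only at this
        omega
      have hk := (hP _).1 (Finset.mem_filter.1 hk).2
      have : ((T.card - 1 : ℕ) : ℚ) + 1 = T.card := by
        rw [Nat.cast_sub h]; simp
      rw [this] at hk
      linarith

/-! ### Cycle covers and sums over edges. -/

namespace MultiDigraph

variable {n m : ℕ} {G : MultiDigraph (Fin n) (Fin m)}

/-- A bounded Eulerian multiset with the same support as the Eulerian multiset `H`. -/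
noncomputable def cycleCover (G : MultiDigraph (Fin n) (Fin m)) (H : Fin m → ℕ) : Fin m → ℕ :=
  fun e' => ∑ e, if H e ≠ 0 then G.cycle (fun f => H f ≠ 0) e e' else 0

theorem cycleCover_eq (H : Fin m → ℕ) :
    G.cycleCover H = ∑ e with H e ≠ 0, G.cycle (fun f => H f ≠ 0) e := by
  ext e'; simp only [cycleCover, Finset.sum_apply, Finset.sum_filter]

/-- The bound does not depend on the multiplicities in `H`, so the calls of Subtour Cover stay
small. -/
theorem cycleCover_le (H : Fin m → ℕ) (e : Fin m) : G.cycleCover H e ≤ m := by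
  refine (Finset.sum_le_card_nsmul _ _ 1 fun f _ => ?_).trans (by simp)
  split_ifs
  · exact cycle_le_one f e
  · simp

theorem cycleCover_ne_zero {H : Fin m → ℕ} {e : Fin m} : G.cycleCover H e ≠ 0 ↔ H e ≠ 0 := by
  simp only [cycleCover, ne_eq, Finset.sum_eq_zero_iff, Finset.mem_univ, true_imp_iff, not_forall]
  constructor
  · rintro ⟨f, hf⟩
    split_ifs at hf with h
    · simp at hf
    · exact cycle_subset (S := fun f => H f ≠ 0) h hf
  · intro h
    exact ⟨e, by rw [if_pos h]; exact cycle_self e⟩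

theorem eulerian_cycleCover {H : Fin m → ℕ} (hH : G.Eulerian H) : G.Eulerian (G.cycleCover H) := by
  rw [cycleCover_eq]
  refine eulerian_sum _ _ fun e he => eulerian_cycle (hH.dreach_edge ?_)
  simpa using he

theorem conn_cycleCover {H : Fin m → ℕ} {u v : Fin n} : G.Conn (G.cycleCover H) u v ↔ G.Conn H u v :=
  ⟨Conn.mono fun _ => cycleCover_ne_zero.1, Conn.mono fun _ => cycleCover_ne_zero.2⟩

theorem mem_supp_iff {F : Fin m → ℕ} {u v : Fin n} :
    u ∈ ((G.graph F).connectedComponentMk v).supp ↔ G.Conn F u v := by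
  rw [SimpleGraph.ConnectedComponent.mem_supp_iff, SimpleGraph.ConnectedComponent.eq, conn_iff_reachable]

theorem conn_of_mem_supp {F : Fin m → ℕ} {D : (G.graph F).ConnectedComponent} {u v : Fin n}
    (hu : u ∈ D.supp) (hv : v ∈ D.supp) : G.Conn F u v := by
  obtain ⟨w, rfl⟩ := D.exists_rep
  exact (mem_supp_iff.1 hu).trans (mem_supp_iff.1 hv).symm

/-- Summation over edges, sorted by one of their ends. -/
theorem sum_edges (F : Fin m → ℕ) (f : Fin m → Fin n) (g : Fin n → ℚ) :
    ∑ e, (F e : ℚ) * g (f e) = ∑ v, g v * ((∑ e with f e = v, F e : ℕ) : ℚ) := by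
  rw [← Finset.sum_fiberwise (s := Finset.univ) (g := f)]
  refine Finset.sum_congr rfl fun v _ => ?_
  push_cast
  rw [Finset.mul_sum]
  refine Finset.sum_congr rfl fun e he => ?_
  rw [(Finset.mem_filter.1 he).2, mul_comm]

theorem Eulerian.sum_ends {F : Fin m → ℕ} (hF : G.Eulerian F) (g : Fin n → ℚ) :
    ∑ e, (F e : ℚ) * (g (G.tail e) + g (G.head e)) =
      ∑ v, 2 * g v * ((∑ e with G.tail e = v, F e : ℕ) : ℚ) := by
  simp only [mul_add, Finset.sum_add_distrib]
  rw [sum_edges, sum_edges, ← Finset.sum_add_distrib]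
  refine Finset.sum_congr rfl fun v _ => ?_
  rw [hF v]
  ring

end MultiDigraph

/-! ### Costs of edge sets that cross no large laminar set. -/

namespace StronglyLaminarInstance

variable (I : StronglyLaminarInstance)

theorem vertexWeight_nonneg (v : Fin I.n) : 0 ≤ I.vertexWeight v :=
  Finset.sum_nonneg fun i _ => (I.y_pos i).le

theorem cost_nonneg (e : Fin I.m) : 0 ≤ I.cost e :=
  Finset.sum_nonneg fun i _ => (I.y_pos i).le

/-- An edge that does not cross a large laminar set pays for the weights of its ends. -/
theorem cost_eq {e : Fin I.m} (h : ∀ i, 2 ≤ (I.L i).card → e ∉ I.G.cut (I.L i : Set (Fin I.n))) :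
    I.cost e = I.vertexWeight (I.G.tail e) + I.vertexWeight (I.G.head e) := by
  have hne := I.G.loopless e
  rw [cost, vertexWeight, vertexWeight, ← Finset.sum_union]
  · refine Finset.sum_congr ?_ fun _ _ => rfl
    ext i
    simp only [Finset.mem_filter, Finset.mem_univ, true_and, Finset.mem_union, cut, Set.mem_ofPred_eq,
      Finset.mem_coe]
    constructor
    · intro hi
      have hcard : (I.L i).card = 1 := by
        have h1 : ¬ 2 ≤ (I.L i).card := fun h2 => h i h2 hi
        have h2 : 0 < (I.L i).card := Finset.card_pos.2 (by
          have := (I.stronglyConnected_L i).1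
          simpa using this)
        omega
      obtain ⟨v, hv⟩ := Finset.card_eq_one.1 hcard
      rw [hv] at hi ⊢
      simp only [Finset.mem_singleton] at hi
      by_cases hx : I.G.tail e = v
      · exact Or.inl (by rw [hx])
      · have : I.G.head e = v := by tauto
        exact Or.inr (by rw [this])
    · rintro (hi | hi)
      · rw [hi]; simp [hne.symm]
      · rw [hi]; simp [hne]
  · rw [Finset.disjoint_left]
    intro i h1 h2
    simp only [Finset.mem_filter, Finset.mem_univ, true_and] at h1 h2
    rw [h1] at h2
    exact hne (Finset.singleton_injective h2)

/-- Each edge pays the weights of its two ends, and an Eulerian multiset enters a vertex as often as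
it leaves it. -/
theorem totalCost_eq {F : Fin I.m → ℕ} (hF : I.G.Eulerian F)
    (h : ∀ e, F e ≠ 0 → ∀ i, 2 ≤ (I.L i).card → e ∉ I.G.cut (I.L i : Set (Fin I.n))) :
    I.totalCost F = ∑ v, 2 * I.vertexWeight v * ((∑ e with I.G.tail e = v, F e : ℕ) : ℚ) := by
  rw [← hF.sum_ends, totalCost]
  refine Finset.sum_congr rfl fun e _ => ?_
  by_cases he : F e = 0
  · simp [he]
  · rw [I.cost_eq (h e he)]

theorem costOf_eq (F : Fin I.m → ℕ) : costOf (fun e => (I.cost e : ℝ)) F = (I.totalCost F : ℝ) := by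
  simp [costOf, totalCost]

theorem totalCost_restrict (F : Fin I.m → ℕ) (Y : Set (Fin I.n)) :
    I.totalCost (I.G.restrict F Y) = ∑ e with I.G.tail e ∈ Y, F e * I.cost e := by
  rw [totalCost, Finset.sum_filter]
  refine Finset.sum_congr rfl fun e _ => ?_
  unfold restrict
  split_ifs <;> simp

end StronglyLaminarInstance

/-! ### Rounding of the weights, and the abstract algorithm on a vertebrate pair. -/

namespace VertebratePair

variable (J : VertebratePair)

/-- The edges that neither touch the backbone nor cross a large laminar set. -/
def allowed (e : Fin J.m) : Prop :=
  J.G.tail e ∉ J.VB ∧ J.G.head e ∉ J.VB ∧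
    ∀ i, 2 ≤ (J.L i).card → e ∉ J.G.cut (J.L i : Set (Fin J.n))

/-- The instance of Subtour Cover given by an Eulerian multiset of allowed edges. -/
noncomputable def subtourCover (H : Fin J.m → ℕ) (h : J.G.Eulerian H ∧ ∀ e, H e ≠ 0 → J.allowed e) :
    SubtourCoverInstance where
  toVertebratePair := J
  H := J.G.cycleCover H
  H_endpoints e he := ⟨(h.2 e (cycleCover_ne_zero.1 he)).1, (h.2 e (cycleCover_ne_zero.1 he)).2.1⟩
  H_eulerian := eulerian_cycleCover h.1
  H_cut i hi e he := (h.2 e (cycleCover_ne_zero.1 he)).2.2 i hi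

/-- The integral weight of a vertex: an approximation of its weight, relative to the largest one. -/
noncomputable def scaledWeight (q : ℕ) (v : Fin J.n) : ℕ :=
  if v ∈ J.VB then 0 else
    1 + ∑ k : Fin (q * J.n), if ∀ u, u ∉ J.VB → ((k : ℕ) + 1) * J.vertexWeight u ≤
      (q * J.n : ℕ) * J.vertexWeight v then 1 else 0

variable (sol : ∀ S : SubtourCoverInstance, Fin S.m → ℕ) (cyc : Prop) (d : ℕ)

/-- The setup in which the abstract algorithm is run. -/
noncomputable def setup : Setup J.n J.m where
  G := J.G
  VB := {v | v ∈ J.VB}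
  EB := J.EB
  A := J.allowed
  Ac e := cyc ∧ J.allowed e
  ℓ := J.scaledWeight d
  orc H := if h : J.G.Eulerian H ∧ ∀ e, H e ≠ 0 → J.allowed e then sol (J.subtourCover H h) else 0
  d := d

variable {J sol cyc d}

theorem setup_orc {H : Fin J.m → ℕ} (h : J.G.Eulerian H) (h' : ∀ e, H e ≠ 0 → J.allowed e) :
    (J.setup sol cyc d).orc H = sol (J.subtourCover H ⟨h, h'⟩) := dif_pos ⟨h, h'⟩

theorem n_pos (J : VertebratePair) : 0 < J.n := by
  obtain ⟨⟨v, _⟩⟩ := J.EB_connected.nonempty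
  exact Fin.pos v

theorem conn_EB (J : VertebratePair) {a b : Fin J.n} (ha : a ∈ J.VB) (hb : b ∈ J.VB) : J.G.Conn J.EB a b := by
  rw [conn_iff_reachable]
  have := J.EB_connected.preconnected ⟨a, ha⟩ ⟨b, hb⟩
  exact this.map (SimpleGraph.Embedding.induce (G := J.G.graph J.EB) (J.VB : Set (Fin J.n))).toHom

theorem setup_valid (hd : 2 ≤ d) (hsol : ∀ S : SubtourCoverInstance, S.IsSolution (sol S)) : (J.setup sol cyc d).Valid where
  two_le_d := hd
  EB_endpoints := J.EB_endpoints
  EB_eulerian := J.EB_eulerian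
  EB_conn a ha b hb := conn_EB J ha hb
  A_endpoints e he := ⟨he.1, he.2.1⟩
  Ac_sub e he := he.2
  ℓ_pos v hv := by
    change 1 ≤ J.scaledWeight d v
    have hv' : v ∉ J.VB := hv
    rw [scaledWeight, if_neg hv']
    omega
  orc_eulerian H h h' := by
    rw [setup_orc h h']
    exact (hsol (J.subtourCover H ⟨h, h'⟩)).eulerian
  orc_covers H h h' v hv := by
    rw [setup_orc h h']
    obtain ⟨e, he, hcut⟩ := (hsol (J.subtourCover H ⟨h, h'⟩)).covers
      ((J.G.graph (J.G.cycleCover H)).connectedComponentMk v) (by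
        rw [Set.disjoint_left]
        intro u hu huB
        have hu : J.G.Conn (J.G.cycleCover H) u v := mem_supp_iff.1 hu
        have hcl : J.G.Closed (J.G.cycleCover H) {u | u ∈ J.VB} := fun e he =>
          ⟨fun h1 => absurd h1 (h' e (cycleCover_ne_zero.1 he)).1,
            fun h1 => absurd h1 (h' e (cycleCover_ne_zero.1 he)).2.1⟩
        exact hv (hcl.mem hu huB))
    refine ⟨e, he, fun h1 => hcut ?_⟩
    have key : ∀ u, u ∈ ((J.G.graph (J.G.cycleCover H)).connectedComponentMk v).supp ↔ J.G.Conn H v u := by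
      intro u
      rw [mem_supp_iff, conn_cycleCover]
      exact ⟨Conn.symm, Conn.symm⟩
    exact (key _).trans (h1.trans (key _).symm)
  orc_sub H h h' e := by
    rw [setup_orc h h']
    intro he hB
    have hs := hsol (J.subtourCover H ⟨h, h'⟩)
    refine ⟨fun h1 => hB _ h1 (Conn.refl _), fun h1 => hB _ h1 (conn_edge he), fun i hi hcut => ?_⟩
    -- A component of the solution that crosses a large laminar set must meet the backbone.
    obtain ⟨b, hb, hbD⟩ := hs.meets_backbone
      ((J.G.graph (sol (J.subtourCover H ⟨h, h'⟩))).connectedComponentMk (J.G.tail e))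
      ⟨i, hi, e, he, mem_supp_iff.2 (Conn.refl _), hcut⟩
    exact hB b hb (mem_supp_iff.1 hbD).symm

/-- The largest weight of a vertex outside the backbone. -/
noncomputable def maxWeight (J : VertebratePair) : ℚ :=
  if h : (Finset.univ.filter fun v => v ∉ J.VB).Nonempty then
    (Finset.univ.filter fun v => v ∉ J.VB).sup' h J.vertexWeight else 0

theorem le_maxWeight {v : Fin J.n} (hv : v ∉ J.VB) : J.vertexWeight v ≤ J.maxWeight := by
  have hm : v ∈ Finset.univ.filter fun v => v ∉ J.VB := by simpa using hv
  rw [maxWeight, dif_pos ⟨v, hm⟩]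
  exact Finset.le_sup' _ hm

theorem maxWeight_cases (J : VertebratePair) :
    (∃ v, v ∉ J.VB ∧ J.maxWeight = J.vertexWeight v) ∨ ((∀ v, v ∈ J.VB) ∧ J.maxWeight = 0) := by
  by_cases h : (Finset.univ.filter fun v => v ∉ J.VB).Nonempty
  · obtain ⟨v, hv, h'⟩ := Finset.exists_mem_eq_sup' h J.vertexWeight
    refine Or.inl ⟨v, by simpa using hv, ?_⟩
    rw [maxWeight, dif_pos h, h']
  · refine Or.inr ⟨fun v => ?_, by rw [maxWeight, dif_neg h]⟩
    by_contra hv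
    exact h ⟨v, by simpa using hv⟩

theorem maxWeight_nonneg (J : VertebratePair) : 0 ≤ J.maxWeight := by
  rcases J.maxWeight_cases with ⟨v, _, h⟩ | ⟨_, h⟩
  · rw [h]; exact J.vertexWeight_nonneg v
  · exact h.ge

theorem two_mul_maxWeight_le (J : VertebratePair) : 2 * J.maxWeight ≤ J.outsideWeight := by
  have hnn : ∀ v ∈ Finset.univ.filter fun v => v ∉ J.VB, 0 ≤ 2 * J.vertexWeight v := fun v _ =>
    mul_nonneg zero_le_two (J.vertexWeight_nonneg v)
  rcases J.maxWeight_cases with ⟨v, hv, h⟩ | ⟨_, h⟩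
  · rw [h]
    exact Finset.single_le_sum hnn (by simpa using hv)
  · rw [h, mul_zero]
    exact Finset.sum_nonneg hnn

/-- Comparing with every `u` off the backbone amounts to comparing with `maxWeight`, without
division. The summand 1 rounds upwards and keeps the weights positive. -/
theorem scaledWeight_bounds {q : ℕ} {v : Fin J.n} (hv : v ∉ J.VB) :
    (q * J.n : ℕ) * J.vertexWeight v ≤ J.maxWeight * J.scaledWeight q v ∧
      J.maxWeight * J.scaledWeight q v ≤ (q * J.n : ℕ) * J.vertexWeight v + J.maxWeight := by
  have h := count_mul_le (Q := q * J.n) (M := J.maxWeight) (a := (q * J.n : ℕ) * J.vertexWeight v)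
    J.maxWeight_nonneg (mul_le_mul_of_nonneg_left (le_maxWeight hv) (by positivity))
    (mul_nonneg (by positivity) (J.vertexWeight_nonneg v))
    (fun k => ∀ u, u ∉ J.VB → ((k : ℕ) + 1) * J.vertexWeight u ≤ (q * J.n : ℕ) * J.vertexWeight v)
    (fun k => by
      constructor
      · intro h
        rcases J.maxWeight_cases with ⟨u, hu, h'⟩ | ⟨h', _⟩
        · rw [h']; exact h u hu
        · exact absurd (h' v) hv
      · intro h u hu
        exact (mul_le_mul_of_nonneg_left (le_maxWeight hu) (by positivity)).trans h)
  rw [scaledWeight, if_neg hv]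
  push_cast at h ⊢
  constructor
  · exact h.1
  · linarith [h.2]

/-- The factor between integral weights and true weights. -/
noncomputable def scale (J : VertebratePair) (q : ℕ) : ℚ := 2 * J.maxWeight / (q * J.n : ℕ)

theorem scale_nonneg (J : VertebratePair) (q : ℕ) : 0 ≤ J.scale q :=
  div_nonneg (mul_nonneg zero_le_two J.maxWeight_nonneg) (by positivity)

theorem weight_le_scale {q : ℕ} (hq : 0 < q) {v : Fin J.n} (hv : v ∉ J.VB) :
    2 * J.vertexWeight v ≤ J.scale q * J.scaledWeight q v := by
  have hQ : (0 : ℚ) < (q * J.n : ℕ) := by exact_mod_cast Nat.mul_pos hq J.n_pos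
  have h := (scaledWeight_bounds (q := q) hv).1
  rw [scale, div_mul_eq_mul_div, le_div_iff₀ hQ]
  linarith

theorem sum_weight_le_scale {q : ℕ} (hq : 0 < q) (Y : Set (Fin J.n)) (hY : ∀ v ∈ Y, v ∉ J.VB) :
    (∑ v with v ∈ Y, 2 * J.vertexWeight v) ≤ J.scale q * ((J.setup sol cyc q).wt Y : ℚ) := by
  rw [Setup.wt]
  push_cast
  rw [Finset.mul_sum, Finset.sum_filter]
  refine Finset.sum_le_sum fun v _ => ?_
  split_ifs with h
  · exact weight_le_scale hq (hY v h)
  · simp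

/-- Rounding adds at most one unit `2 * maxWeight / (q * n)` per vertex, so `2 * maxWeight / q`
altogether, and `2 * maxWeight` is at most `outsideWeight`. -/
theorem scale_wt_univ_le {q : ℕ} (hq : 0 < q) :
    J.scale q * ((J.setup sol cyc q).wt Set.univ : ℚ) ≤ (1 + 1 / q) * J.outsideWeight := by
  have hq' : (0 : ℚ) < q := by exact_mod_cast hq
  have hn : (0 : ℚ) < J.n := by exact_mod_cast J.n_pos
  have h1 : ∀ v, J.scale q * (J.scaledWeight q v : ℚ) ≤
      (if v ∉ J.VB then 2 * J.vertexWeight v else 0) + 2 * J.maxWeight / (q * J.n : ℕ) := by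
    intro v
    by_cases hv : v ∈ J.VB
    · rw [scaledWeight, if_pos hv, if_neg (not_not.2 hv)]
      have := J.scale_nonneg q
      rw [scale] at this
      simpa using this
    · rw [if_pos hv, scale]
      have h := (scaledWeight_bounds (q := q) hv).2
      have hQ : (0 : ℚ) < (q * J.n : ℕ) := by exact_mod_cast Nat.mul_pos hq J.n_pos
      rw [div_mul_eq_mul_div, ← sub_nonneg]
      have : 2 * J.vertexWeight v + 2 * J.maxWeight / ((q * J.n : ℕ) : ℚ) -
          2 * J.maxWeight * (J.scaledWeight q v : ℚ) / ((q * J.n : ℕ) : ℚ) =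
          2 * ((q * J.n : ℕ) * J.vertexWeight v + J.maxWeight - J.maxWeight * (J.scaledWeight q v : ℚ)) /
            ((q * J.n : ℕ) : ℚ) := by
        field_simp
      rw [this]
      exact div_nonneg (by linarith) hQ.le
  calc J.scale q * ((J.setup sol cyc q).wt Set.univ : ℚ)
      = ∑ v, J.scale q * (J.scaledWeight q v : ℚ) := by
        rw [Setup.wt]
        push_cast
        rw [Finset.mul_sum]
        exact Finset.sum_congr rfl fun v _ => by simp [setup]
    _ ≤ ∑ v, ((if v ∉ J.VB then 2 * J.vertexWeight v else 0) + 2 * J.maxWeight / (q * J.n : ℕ)) :=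
        Finset.sum_le_sum fun v _ => h1 v
    _ = J.outsideWeight + 2 * J.maxWeight / q := by
        rw [Finset.sum_add_distrib, ← Finset.sum_filter, outsideWeight]
        simp only [Finset.sum_const, Finset.card_univ, Fintype.card_fin, nsmul_eq_mul]
        push_cast
        congr 1
        field_simp
    _ ≤ J.outsideWeight + J.outsideWeight / q := by
        have := div_le_div_of_nonneg_right J.two_mul_maxWeight_le hq'.le
        linarith
    _ = _ := by ring

/-- The cost of the components in `Y` is the sum of the costs of the single components. -/
theorem component_bound {α : ℝ} {F : Fin J.m → ℕ} {Y : Set (Fin J.n)} (hY : J.G.Closed F Y)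
    (h : ∀ D : (J.G.graph F).ConnectedComponent, (∃ v ∈ Y, v ∈ D.supp) → (J.componentCost F D : ℝ) ≤
        α * ((∑ v with v ∈ D.supp, 2 * J.vertexWeight v : ℚ) : ℝ)) :
    (J.totalCost (J.G.restrict F Y) : ℝ) ≤ α * ((∑ v with v ∈ Y, 2 * J.vertexWeight v : ℚ) : ℝ) := by
  let T : Finset (J.G.graph F).ConnectedComponent :=
    (Finset.univ.filter fun v => v ∈ Y).image (J.G.graph F).connectedComponentMk
  have hT : ∀ D ∈ T, ∃ v ∈ Y, D = (J.G.graph F).connectedComponentMk v := by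
    intro D hD
    obtain ⟨v, hv, rfl⟩ := Finset.mem_image.1 hD
    exact ⟨v, by simpa using hv, rfl⟩
  have hsub : ∀ D ∈ T, ∀ u ∈ D.supp, u ∈ Y := by
    intro D hD u hu
    obtain ⟨v, hv, rfl⟩ := hT D hD
    exact hY.mem (mem_supp_iff.1 hu).symm hv
  have h1 : J.totalCost (J.G.restrict F Y) = ∑ D ∈ T, J.componentCost F D := by
    rw [J.totalCost_restrict, ← Finset.sum_fiberwise_of_maps_to (t := T)
      (g := fun e => (J.G.graph F).connectedComponentMk (J.G.tail e))]
    · refine Finset.sum_congr rfl fun D hD => ?_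
      rw [StronglyLaminarInstance.componentCost]
      refine Finset.sum_congr ?_ fun _ _ => rfl
      ext e
      simp only [Finset.mem_filter, Finset.mem_univ, true_and]
      rw [SimpleGraph.ConnectedComponent.mem_supp_iff]
      exact ⟨fun h => h.2, fun h => ⟨hsub D hD _ h, h⟩⟩
    · intro e he
      exact Finset.mem_image_of_mem _ (by simpa using he)
  have h2 : (∑ v with v ∈ Y, 2 * J.vertexWeight v) =
      ∑ D ∈ T, ∑ v with v ∈ D.supp, 2 * J.vertexWeight v := by
    rw [← Finset.sum_fiberwise_of_maps_to (t := T) (g := (J.G.graph F).connectedComponentMk)]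
    · refine Finset.sum_congr rfl fun D hD => ?_
      refine Finset.sum_congr ?_ fun _ _ => rfl
      ext v
      simp only [Finset.mem_filter, Finset.mem_univ, true_and]
      rw [SimpleGraph.ConnectedComponent.mem_supp_iff]
      exact ⟨fun h => h.2, fun h => ⟨hsub D hD _ h, h⟩⟩
    · intro v hv
      exact Finset.mem_image_of_mem _ (by simpa using hv)
  rw [h1, h2]
  push_cast
  rw [Finset.mul_sum]
  refine Finset.sum_le_sum fun D hD => ?_
  obtain ⟨v, hv, hvD⟩ := hT D hD
  have := h D ⟨v, hv, hvD ▸ mem_supp_iff.2 (Conn.refl v)⟩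
  push_cast at this
  exact this

theorem setup_costValid {α κ β : ℝ} (hα : 0 ≤ α) (hd : 0 < d)
    (hsol : ∀ S : SubtourCoverInstance, S.CostBounds α κ β (sol S))
    (hmode : (α = 0 ∧ ¬ cyc) ∨ (1 ≤ 2 * α ∧ cyc)) :
    (J.setup sol cyc d).CostValid (fun e => (J.cost e : ℝ)) (J.scale d) α
      (κ * J.lpValue + β * J.outsideWeight) where
  c_nonneg e := by exact_mod_cast J.cost_nonneg e
  θ_nonneg := by exact_mod_cast J.scale_nonneg d
  α_nonneg := hα
  cycle_cost F hF hA hout := by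
    rw [J.costOf_eq]
    have h1 : J.totalCost F ≤ ∑ v with v ∈ J.G.verts F, 2 * J.vertexWeight v := by
      rw [J.totalCost_eq hF fun e he => (hA e he).2.2.2, Finset.sum_filter]
      refine Finset.sum_le_sum fun v _ => ?_
      have hw := J.vertexWeight_nonneg v
      split_ifs with hv
      · have h2 : ((∑ e with J.G.tail e = v, F e : ℕ) : ℚ) ≤ 1 := by exact_mod_cast hout v
        nlinarith
      · have h2 : ∑ e with J.G.tail e = v, F e = 0 := by
          refine Finset.sum_eq_zero fun e he => ?_
          by_contra h0
          exact hv ⟨e, h0, (Finset.mem_filter.1 he).2⟩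
        rw [h2]; simp
    have h2 := h1.trans (sum_weight_le_scale (sol := sol) (cyc := cyc) hd (J.G.verts F) (by
      rintro _ ⟨e, he, rfl⟩
      exact (hA e he).2.1))
    exact_mod_cast h2
  orc_total H h h' := by
    rw [setup_orc h h']
    exact (J.costOf_eq _).le.trans (hsol (J.subtourCover H ⟨h, h'⟩)).total
  orc_component H h h' := by
    rw [setup_orc h h']
    intro Y hY hB
    refine (J.costOf_eq _).le.trans ((component_bound (α := α) hY fun D hD => ?_).trans ?_)
    · refine (hsol (J.subtourCover H ⟨h, h'⟩)).component D ?_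
      obtain ⟨v, hv, hvD⟩ := hD
      rw [Set.disjoint_left]
      intro b hbD hb
      exact hB v hv b hb (conn_of_mem_supp hvD hbD)
    · rw [mul_assoc]
      refine mul_le_mul_of_nonneg_left ?_ hα
      exact_mod_cast sum_weight_le_scale (sol := sol) (cyc := cyc) hd Y fun v hv h1 =>
        hB v hv v h1 (Conn.refl v)
  mode := by
    rcases hmode with ⟨h1, h2⟩ | ⟨h1, h2⟩
    · exact Or.inl ⟨h1, fun e he => h2 he.1⟩
    · exact Or.inr ⟨h1, fun e he => ⟨h2, he⟩⟩

theorem isSolution_of_final {α κ β : ℝ} {s : St J.n J.m} (hd : 0 < d) (hα : 0 ≤ α)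
    (h : (J.setup sol cyc d).Final s (fun e => (J.cost e : ℝ)) (J.scale d) α
      (κ * J.lpValue + β * J.outsideWeight)) :
    J.IsSolution s.H ∧ (J.totalCost s.H : ℝ) ≤ κ * J.lpValue +
      (β + (α * (4 + 2 / d) + (1 + 1 / d)) * (1 + 2 / d) * (1 + 1 / d)) * J.outsideWeight := by
  refine ⟨⟨?_, h.eulerian⟩, ?_⟩
  · have : Nonempty (Fin J.n) := ⟨⟨0, J.n_pos⟩⟩
    exact ⟨fun u v => conn_iff_reachable.1 (h.conn u v)⟩
  · rw [← J.costOf_eq]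
    refine h.cost.trans ?_
    have h1 : ((J.scale d : ℝ) * ((J.setup sol cyc d).wt Set.univ : ℝ)) ≤
        (1 + 1 / d) * (J.outsideWeight : ℝ) := by
      have := (Rat.cast_le (K := ℝ)).2 (scale_wt_univ_le (J := J) (sol := sol) (cyc := cyc) hd)
      push_cast at this
      exact this
    have h2 : 0 ≤ (α * (4 + 2 / (d : ℝ)) + (1 + 1 / d)) * (1 + 2 / d) := by positivity
    have h3 := mul_le_mul_of_nonneg_left h1 h2
    change κ * _ + β * _ + (α * (4 + 2 / (d : ℝ)) + (1 + 1 / d)) * (1 + 2 / d) * _ ≤ _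
    linarith

end VertebratePair

/-! ### The case of small `α`. -/

namespace SubtourCoverInstance

/-- If `α < 1` then the components without backbone vertices cost nothing. -/
theorem CostBounds.zero {S : SubtourCoverInstance} {α κ β : ℝ} {F : Fin S.m → ℕ} (hα0 : 0 ≤ α) (hα : α < 1)
    (hF : S.IsSolution F) (h : S.CostBounds α κ β F) : S.CostBounds 0 κ β F := by
  refine ⟨h.total, fun D hD => ?_⟩
  have h0 := h.component D hD
  rw [zero_mul]
  obtain ⟨v₀, rfl⟩ := D.exists_rep
  set D := (S.G.graph F).connectedComponentMk v₀ with hDdef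
  change (S.componentCost F D : ℝ) ≤ α * ((∑ v with v ∈ D.supp, 2 * S.vertexWeight v : ℚ) : ℝ) at h0
  change (S.componentCost F D : ℝ) ≤ 0
  have hcl : S.G.Closed F D.supp := fun e he => by
    rw [hDdef, mem_supp_iff, mem_supp_iff]
    exact ⟨fun h1 => (conn_edge he).symm.trans h1, fun h1 => (conn_edge he).trans h1⟩
  have hcost : S.componentCost F D = S.totalCost (S.G.restrict F D.supp) :=
    (S.totalCost_restrict F D.supp ▸ by
      rw [StronglyLaminarInstance.componentCost]
      exact Finset.sum_congr (by ext; simp) fun _ _ => rfl)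
  by_cases hne : ∃ e, S.G.tail e ∈ D.supp ∧ F e ≠ 0
  · have hE := hF.eulerian.restrict hcl
    -- A component with edges that avoids the backbone crosses no large set and leaves each of its
    -- vertices, so it costs at least its weight. As it costs at most `α < 1` times its weight, both
    -- vanish.
    have hge : (∑ v with v ∈ D.supp, 2 * S.vertexWeight v) ≤ S.componentCost F D := by
      rw [hcost, S.totalCost_eq hE, Finset.sum_filter]
      · refine Finset.sum_le_sum fun v _ => ?_
        have hw := S.vertexWeight_nonneg v
        split_ifs with hv
        -- A vertex that is never left is never entered either, hence forms a component alone;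
        -- without loops this component would have no edge.
        · have hout : 1 ≤ ∑ e with S.G.tail e = v, S.G.restrict F D.supp e := by
            by_contra hlt
            have hz : ∑ e with S.G.tail e = v, S.G.restrict F D.supp e = 0 := by omega
            have hz' := (hE v).trans hz
            rw [Finset.sum_eq_zero_iff] at hz hz'
            have hsing : S.G.Closed F {v} := by
              intro e he
              have key : ∀ f : Fin S.m → Fin S.n, f e = v → (f = S.G.tail ∨ f = S.G.head) → False := by
                rintro f hf (rfl | rfl)
                · have := hz e (by simp [hf])
                  exact restrict_ne_zero.2 ⟨hf ▸ hv, he⟩ this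
                · have := hz' e (by simp [hf])
                  exact restrict_ne_zero.2 ⟨(hcl e he).2 (hf ▸ hv), he⟩ this
              exact ⟨fun h1 => (key _ h1 (Or.inl rfl)).elim, fun h1 => (key _ h1 (Or.inr rfl)).elim⟩
            obtain ⟨e, he1, he2⟩ := hne
            have hall : ∀ u ∈ D.supp, u = v := by
              intro u hu
              have h1 : S.G.Conn F u v₀ := mem_supp_iff.1 hu
              have h2 : S.G.Conn F v v₀ := mem_supp_iff.1 hv
              exact hsing.mem (h2.trans h1.symm) rfl
            exact S.G.loopless e ((hall _ he1).trans (hall _ ((hcl e he2).1 he1)).symm)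
          have hout' : (1 : ℚ) ≤ ((∑ e with S.G.tail e = v, S.G.restrict F D.supp e : ℕ) : ℚ) := by
            exact_mod_cast hout
          nlinarith
        · positivity
      · intro e he i hi hcut
        obtain ⟨h1, h2⟩ := restrict_ne_zero.1 he
        obtain ⟨b, hb, hbD⟩ := hF.meets_backbone D ⟨i, hi, e, h2, h1, hcut⟩
        exact Set.disjoint_left.1 hD hbD hb
    have hge' : ((∑ v with v ∈ D.supp, 2 * S.vertexWeight v : ℚ) : ℝ) ≤ S.componentCost F D := by
      exact_mod_cast hge
    have hnn : (0 : ℝ) ≤ ((∑ v with v ∈ D.supp, 2 * S.vertexWeight v : ℚ) : ℝ) := by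
      exact_mod_cast Finset.sum_nonneg fun v _ => mul_nonneg zero_le_two (S.vertexWeight_nonneg v)
    by_contra hpos
    push Not at hpos
    nlinarith [mul_le_mul_of_nonneg_left hge' hα0]
  · push Not at hne
    rw [StronglyLaminarInstance.componentCost, Finset.sum_eq_zero]
    · simp
    · intro e he
      rw [hne e (Finset.mem_filter.1 he).2]
      simp

end SubtourCoverInstance

end ATSP

namespace ATSP

open Relation MultiDigraph Enc
open scoped Classical

/-! Programs for graphs -/

/-- `v` can be reached from `u` in at most `k` steps. -/
def reachAux {n : ℕ} (r : Fin n → Fin n → Prop) : ℕ → Fin n → Fin n → Prop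
  | 0 => fun u v => u = v
  | k + 1 => fun u v => reachAux r k u v ∨ ∃ w, reachAux r k u w ∧ r w v

/-- The reached sets grow strictly until they are stable, so `n` rounds suffice. -/
theorem reachAux_iff {n : ℕ} {r : Fin n → Fin n → Prop} {u v : Fin n} :
    reachAux r n u v ↔ ReflTransGen r u v := by
  let R : ℕ → Finset (Fin n) := fun k => Finset.univ.filter fun v => reachAux r k u v
  have hR : ∀ {k v}, v ∈ R k ↔ reachAux r k u v := by intro k v; simp [R]
  have hsub : ∀ k, R k ⊆ R (k + 1) := fun k v hv => hR.2 (Or.inl (hR.1 hv))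
  have key : ∀ k, R (k + 1) ⊆ R k ∨ k + 1 ≤ (R k).card := by
    intro k
    induction k with
    | zero => exact Or.inr (Finset.card_pos.2 ⟨u, hR.2 rfl⟩)
    | succ k ih =>
      rcases ih with ih | ih
      · left
        intro v hv
        rcases hR.1 hv with h | ⟨w, h, h'⟩
        · exact hR.2 h
        · exact hR.2 (Or.inr ⟨w, hR.1 (ih (hR.2 h)), h'⟩)
      · by_cases h : R (k + 1) ⊆ R k
        · left
          intro v hv
          rcases hR.1 hv with h1 | ⟨w, h1, h'⟩
          · exact hR.2 h1
          · exact hR.2 (Or.inr ⟨w, hR.1 (h (hR.2 h1)), h'⟩)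
        · right
          have := Finset.card_lt_card ⟨hsub k, h⟩
          omega
  have hstable : R (n + 1) ⊆ R n := by
    refine (key n).resolve_right fun h => ?_
    have := Finset.card_le_univ (R n)
    rw [Fintype.card_fin] at this
    omega
  constructor
  · have : ∀ k v, reachAux r k u v → ReflTransGen r u v := by
      intro k
      induction k with
      | zero => rintro v rfl; exact .refl
      | succ k ih =>
        rintro v (h | ⟨w, h, h'⟩)
        · exact ih v h
        · exact (ih w h).tail h'
    exact this n v
  · intro h
    induction h with
    | refl =>
      have : ∀ k, u ∈ R k := fun k => by
        induction k with
        | zero => exact hR.2 rfl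
        | succ k ih => exact hsub k ih
      exact hR.1 (this n)
    | tail _ hbc ih => exact hR.1 (hstable (hR.2 (Or.inr ⟨_, ih, hbc⟩)))

variable {γ : Type} {i : γ → Data} {n m : γ → ℕ}

theorem size_enc_matrix_le {a b : ℕ} (r : Fin a → Fin b → Prop) :
    (enc r).size ≤ a * (b * 4 + 2) + 1 :=
  size_enc_pi_le fun _ => size_enc_pi_le fun _ => size_enc_prop _

namespace Poly

theorem _root_.ATSP.PT.app₂ {α : γ → Type} [∀ c, Enc (α c)] {r : ∀ c, Fin (n c) → Fin (m c) → α c}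
    {u : ∀ c, Fin (n c)} {v : ∀ c, Fin (m c)} (hr : Poly i r) (hu : Poly i u) (hv : Poly i v) :
    Poly i fun c => r c (u c) (v c) :=
  (hr.app hu).app hv

theorem tab₂ {α : γ → Type} [∀ c, Enc (α c)] {r : ∀ c, Fin (n c) → Fin (m c) → α c}
    (hn : Poly i n) (hm : Poly i m)
    (hr : PT (Ext (Ext i fun c => Fin (n c)) fun x => Fin (m x.1)) fun x => enc (r x.1.1 x.1.2 x.2)) :
    Poly i r := tab hn (tab hm.up hr)

theorem reach {r : ∀ c, Fin (n c) → Fin (n c) → Prop} (hn : Poly i n) (hr : Poly i r) :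
    Poly i fun c => (fun u v => ReflTransGen (r c) u v) := by
  refine (iterate (fun c k => reachAux (r c) k) hn ?_ ?_ ⟨_, ?_, fun c k _ => size_enc_matrix_le _⟩).congr
    fun c => ?_
  · exact tab₂ hn hn (finEq PT.var.up PT.var)
  · have hn' : Poly (fun x : {x : γ × ℕ // x.2 < n x.1} => .cons (i x.1.1) (.cons (enc x.1.2)
        (enc (reachAux (r x.1.1) x.1.2)))) fun x => n x.1.1 := hn.pull _ PT.refl.left
    have hr' : Poly (fun x : {x : γ × ℕ // x.2 < n x.1} => .cons (i x.1.1) (.cons (enc x.1.2)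
        (enc (reachAux (r x.1.1) x.1.2)))) fun x => r x.1.1 := hr.pull _ PT.refl.left
    have hs' : Poly (fun x : {x : γ × ℕ // x.2 < n x.1} => .cons (i x.1.1) (.cons (enc x.1.2)
        (enc (reachAux (r x.1.1) x.1.2)))) fun x => reachAux (r x.1.1) x.1.2 := PT.refl.right.right
    exact tab₂ hn' hn' (or (hs'.up.up.app₂ PT.var.up PT.var)
      (ex hn'.up.up (and (hs'.up.up.up.app₂ PT.var.up.up PT.var) (hr'.up.up.up.app₂ PT.var PT.var.up))))
  · have := PolyBdd.of_unary hn
    exact (this.mul ((this.mul (.const 4)).add (.const 2))).add (.const 1)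
  · congr 1
    ext u v
    exact reachAux_iff

end Poly

/-- A family of graphs can be read from the input. -/
structure PolyGraph (i : γ → Data) (G : ∀ c, MultiDigraph (Fin (n c)) (Fin (m c))) : Prop where
  n : Poly i n
  m : Poly i m
  tail : Poly i fun c => (G c).tail
  head : Poly i fun c => (G c).head

namespace PolyGraph

variable {G : ∀ c, MultiDigraph (Fin (n c)) (Fin (m c))}

theorem pull (hG : PolyGraph i G) {γ' : Type} {j : γ' → Data} (g : γ' → γ)
    (hj : PT j fun c => i (g c)) : PolyGraph j fun c => G (g c) :=
  ⟨hG.n.pull g hj, hG.m.pull g hj, hG.tail.pull g hj, hG.head.pull g hj⟩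

theorem up (hG : PolyGraph i G) {β : γ → Type} [∀ c, Enc (β c)] :
    PolyGraph (Ext i β) fun x => G x.1 := hG.pull _ PT.refl.left

theorem conn (hG : PolyGraph i G) {F : ∀ c, Fin (m c) → ℕ} (hF : Poly i F) :
    Poly i fun c => (fun u v => (G c).Conn (F c) u v) := by
  refine Poly.reach hG.n (Poly.tab₂ hG.n hG.n (Poly.ex hG.m.up.up (Poly.and (Poly.not (Poly.natEq
    (hF.up.up.up.app PT.var) (Poly.constNat 0))) (Poly.or (Poly.and ?_ ?_) (Poly.and ?_ ?_)))))
  · exact Poly.finEq (hG.tail.up.up.up.app PT.var) PT.var.up.up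
  · exact Poly.finEq (hG.head.up.up.up.app PT.var) PT.var.up
  · exact Poly.finEq (hG.tail.up.up.up.app PT.var) PT.var.up
  · exact Poly.finEq (hG.head.up.up.up.app PT.var) PT.var.up.up

theorem dreach (hG : PolyGraph i G) {S : ∀ c, Fin (m c) → Prop} (hS : Poly i S) :
    Poly i fun c => (fun u v => (G c).DReach (S c) u v) := by
  refine Poly.reach hG.n (Poly.tab₂ hG.n hG.n (Poly.ex hG.m.up.up (Poly.and
    (hS.up.up.up.app PT.var) (Poly.and ?_ ?_))))
  · exact Poly.finEq (hG.tail.up.up.up.app PT.var) PT.var.up.up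
  · exact Poly.finEq (hG.head.up.up.up.app PT.var) PT.var.up

/-- Sets of vertices are represented by their characteristic vectors. -/
abbrev _root_.ATSP.PolySet (i : γ → Data) (U : ∀ c, Set (Fin (n c))) : Prop :=
  Poly i fun c => (fun v => v ∈ U c)

theorem prune (hG : PolyGraph i G) {S : ∀ c, Fin (m c) → Prop} (hS : Poly i S)
    {u v : ∀ c, Fin (n c)} (hu : Poly i u) (hv : Poly i v) :
    Poly i fun c => (G c).prune (S c) (u c) (v c) := by
  refine Poly.iterate (fun c k => (G c).pruneAux (S c) (u c) (v c) k) hG.m hS ?_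
    ⟨_, ((PolyBdd.of_unary hG.m).mul (.const 4)).add (.const 1),
      fun c k _ => size_enc_pi_le fun _ => size_enc_prop _⟩
  have hG' := hG.pull (j := fun x : {x : γ × ℕ // x.2 < m x.1} => .cons (i x.1.1) (.cons (enc x.1.2)
    (enc ((G x.1.1).pruneAux (S x.1.1) (u x.1.1) (v x.1.1) x.1.2)))) (fun x => x.1.1) PT.refl.left
  have hu' := hu.pull (j := fun x : {x : γ × ℕ // x.2 < m x.1} => .cons (i x.1.1) (.cons (enc x.1.2)
    (enc ((G x.1.1).pruneAux (S x.1.1) (u x.1.1) (v x.1.1) x.1.2)))) (fun x => x.1.1) PT.refl.left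
  have hv' := hv.pull (j := fun x : {x : γ × ℕ // x.2 < m x.1} => .cons (i x.1.1) (.cons (enc x.1.2)
    (enc ((G x.1.1).pruneAux (S x.1.1) (u x.1.1) (v x.1.1) x.1.2)))) (fun x => x.1.1) PT.refl.left
  have hk : Poly (fun x : {x : γ × ℕ // x.2 < m x.1} => .cons (i x.1.1) (.cons (enc x.1.2)
    (enc ((G x.1.1).pruneAux (S x.1.1) (u x.1.1) (v x.1.1) x.1.2)))) fun x => x.1.2 := PT.refl.right.left
  have hp : Poly (fun x : {x : γ × ℕ // x.2 < m x.1} => .cons (i x.1.1) (.cons (enc x.1.2)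
    (enc ((G x.1.1).pruneAux (S x.1.1) (u x.1.1) (v x.1.1) x.1.2))))
    fun x => (G x.1.1).pruneAux (S x.1.1) (u x.1.1) (v x.1.1) x.1.2 := PT.refl.right.right
  have hr := (hG'.dreach (S := fun x e' => (G x.1.1).pruneAux (S x.1.1) (u x.1.1) (v x.1.1) x.1.2 e' ∧
    e'.val ≠ x.1.2) (Poly.tab hG'.m (Poly.and (hp.up.app PT.var)
      (Poly.not (Poly.natEq (Poly.finVal PT.var) hk.up))))).app₂ hu' hv'
  exact Poly.tab hG'.m (Poly.and (hp.up.app PT.var) (Poly.imp (Poly.natEq (Poly.finVal PT.var) hk.up)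
    (Poly.not hr).up))

theorem cycle (hG : PolyGraph i G) {S : ∀ c, Fin (m c) → Prop} (hS : Poly i S)
    {e : ∀ c, Fin (m c)} (he : Poly i e) : Poly i fun c => (G c).cycle (S c) (e c) := by
  refine Poly.tab hG.m (Poly.ite (Poly.or (Poly.finEq PT.var he.up) ?_) (Poly.constNat 1) (Poly.constNat 0))
  exact (hG.prune hS (hG.head.app he) (hG.tail.app he)).up.app PT.var

theorem cycleCover (hG : PolyGraph i G) {H : ∀ c, Fin (m c) → ℕ} (hH : Poly i H) :
    Poly i fun c => (G c).cycleCover (H c) := by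
  have hS : Poly i fun c => (fun f => H c f ≠ 0) :=
    Poly.tab hG.m (Poly.not (Poly.natEq (hH.up.app PT.var) (Poly.constNat 0)))
  exact Poly.tab hG.m (Poly.sumIte hG.m.up (Poly.not (Poly.natEq (hH.up.up.app PT.var) (Poly.constNat 0)))
    ((hG.up.up.cycle hS.up.up PT.var).app PT.var.up))

theorem restrict (hG : PolyGraph i G) {F : ∀ c, Fin (m c) → ℕ} (hF : Poly i F)
    {Y : ∀ c, Set (Fin (n c))} (hY : PolySet i Y) : Poly i fun c => (G c).restrict (F c) (Y c) :=
  Poly.tab hG.m (Poly.ite (hY.up.app (hG.tail.up.app PT.var)) ((hF.up.app PT.var).sub _) (Poly.constNat 0))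

theorem verts (hG : PolyGraph i G) {F : ∀ c, Fin (m c) → ℕ} (hF : Poly i F) :
    PolySet i fun c => (G c).verts (F c) :=
  Poly.tab hG.n (Poly.ex hG.m.up (Poly.and (Poly.not (Poly.natEq (hF.up.up.app PT.var) (Poly.constNat 0)))
    (Poly.finEq (hG.tail.up.up.app PT.var) PT.var.up)))

end PolyGraph

namespace Poly

theorem dite {p : γ → Prop} {β : γ → Type} [∀ c, Enc (β c)] {f : ∀ c, p c → β c} {g : ∀ c, ¬ p c → β c}
    [∀ c, Decidable (p c)] (hp : Poly i p)
    (hf : PT (γ := {c // p c}) (fun c => i c) fun c => enc (f c c.2))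
    (hg : PT (γ := {c // ¬ p c}) (fun c => i c) fun c => enc (g c c.2)) :
    Poly i fun c => if h : p c then f c h else g c h :=
  cases hp (hf.congr fun c => by simp [c.2]) (hg.congr fun c => by simp [c.2])

theorem addVec {F F' : ∀ c, Fin (m c) → ℕ} (hm : Poly i m) (hF : Poly i F) (hF' : Poly i F') :
    Poly i fun c => F c + F' c :=
  tab hm (add (hF.up.app PT.var) (hF'.up.app PT.var))

theorem zeroVec (hm : Poly i m) : Poly i fun c => (0 : Fin (m c) → ℕ) := tab hm (constNat 0)

end Poly

/-! Programs for the steps of the algorithm -/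

noncomputable instance {n m : ℕ} : Enc (St n m) := ⟨fun s => enc (s.id, s.K, s.w, s.H, s.X, s.done)⟩

/-- A family of setups, states, and results of the Subtour Cover algorithm can be read from the input. -/
structure PolyStep (i : γ → Data) (C : ∀ c, Setup (n c) (m c)) (s : ∀ c, St (n c) (m c)) : Prop where
  G : PolyGraph i fun c => (C c).G
  VB : PolySet i fun c => (C c).VB
  EB : Poly i fun c => (C c).EB
  Ac : Poly i fun c => (C c).Ac
  ℓ : Poly i fun c => (C c).ℓ
  d : Poly i fun c => (C c).d
  st : Poly i s
  orc : Poly i fun c => (C c).orc (s c).H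

namespace PolyStep

variable {C : ∀ c, Setup (n c) (m c)} {s : ∀ c, St (n c) (m c)} {U : ∀ c, Set (Fin (n c))}
  {v t : ∀ c, Fin (n c)}

theorem pull (h : PolyStep i C s) {γ' : Type} {j : γ' → Data} (g : γ' → γ)
    (hj : PT j fun c => i (g c)) : PolyStep j (fun c => C (g c)) fun c => s (g c) :=
  ⟨h.G.pull g hj, h.VB.pull g hj, h.EB.pull g hj, h.Ac.pull g hj, h.ℓ.pull g hj, h.d.pull g hj,
    h.st.pull g hj, h.orc.pull g hj⟩

theorem up (h : PolyStep i C s) {β : γ → Type} [∀ c, Enc (β c)] :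
    PolyStep (Ext i β) (fun x => C x.1) fun x => s x.1 := h.pull _ PT.refl.left

theorem sub (h : PolyStep i C s) (p : γ → Prop) :
    PolyStep (γ := {c // p c}) (fun c => i c) (fun c => C c) fun c => s c := h.pull _ PT.refl

theorem id (h : PolyStep i C s) : Poly i fun c => (s c).id := h.st.left
theorem K (h : PolyStep i C s) : Poly i fun c => (s c).K := h.st.right.left
theorem w (h : PolyStep i C s) : Poly i fun c => (s c).w := h.st.right.right.left
theorem H (h : PolyStep i C s) : Poly i fun c => (s c).H := h.st.right.right.right.left
theorem X (h : PolyStep i C s) : Poly i fun c => (s c).X := h.st.right.right.right.right.left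
theorem done (h : PolyStep i C s) : Poly i fun c => (s c).done := h.st.right.right.right.right.right

theorem wt (h : PolyStep i C s) (hU : PolySet i U) : Poly i fun c => (C c).wt (U c) :=
  Poly.sumIte h.G.n (hU.up.app PT.var) (h.ℓ.up.app PT.var)

theorem own (h : PolyStep i C s) (hv : Poly i v) : PolySet i fun c => Setup.own (s c) (v c) :=
  Poly.tab h.G.n (Poly.finEq (h.id.up.app PT.var) (h.id.app hv).up)

theorem useful (h : PolyStep i C s) : PolySet i fun c => (C c).useful (s c) :=
  Poly.tab h.G.n (Poly.ex h.G.n.up (Poly.and ((h.G.conn h.orc).up.up.app₂ PT.var.up PT.var)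
    (Poly.not ((h.G.conn h.H).up.up.app₂ PT.var.up PT.var))))

theorem attached (h : PolyStep i C s) (hv : Poly i v) : PolySet i fun c => (C c).attached (s c) (v c) := by
  have hc := h.G.conn h.orc
  refine Poly.tab h.G.n (Poly.and (Poly.all h.G.n.up (Poly.imp (h.VB.up.up.app PT.var)
    (Poly.not (hc.up.up.app₂ PT.var.up PT.var)))) (Poly.and (h.useful.up.app PT.var) (Poly.and
    (Poly.ex h.G.n.up (Poly.and (hc.up.up.app₂ PT.var.up PT.var)
      (Poly.finEq (h.id.up.up.app PT.var) (h.id.app hv).up.up)))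
    (Poly.all h.G.n.up (Poly.imp (hc.up.up.app₂ PT.var.up PT.var)
      (Poly.le (h.w.up.up.app PT.var) (h.w.app hv).up.up))))))

theorem diff {U' : ∀ c, Set (Fin (n c))} (hn : Poly i n) (hU : PolySet i U) (hU' : PolySet i U') :
    PolySet i fun c => U c \ U' c :=
  Poly.tab hn (Poly.and (hU.up.app PT.var) (Poly.not (hU'.up.app PT.var)))

theorem union {U' : ∀ c, Set (Fin (n c))} (hn : Poly i n) (hU : PolySet i U) (hU' : PolySet i U') :
    PolySet i fun c => U c ∪ U' c :=
  Poly.tab hn (Poly.or (hU.up.app PT.var) (hU'.up.app PT.var))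

theorem bad (h : PolyStep i C s) (hv : Poly i v) : Poly i fun c => (C c).bad (s c) (v c) :=
  Poly.and (Poly.not (h.VB.app hv)) (Poly.le (Poly.mul (Poly.add h.d (Poly.constNat 2)) (h.w.app hv))
    (Poly.mul h.d (h.wt (diff h.G.n (h.attached hv) (h.own hv)))))

theorem merged (h : PolyStep i C s) : Poly i fun c => (C c).merged (s c) :=
  Poly.addVec h.G.m (Poly.addVec h.G.m (Poly.addVec h.G.m h.H h.orc) h.X) h.EB

theorem top (h : PolyStep i C s) (ht : Poly i t) : Poly i fun c => (C c).top (s c) (t c) := by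
  have hc := h.G.conn h.merged
  exact Poly.and (Poly.all h.G.n (Poly.imp (h.VB.up.app PT.var) (Poly.not (hc.up.app₂ ht.up PT.var))))
    (Poly.all h.G.n (Poly.imp (hc.up.app₂ ht.up PT.var) (Poly.le (h.w.up.app PT.var) (h.w.app ht).up)))

theorem lowest (h : PolyStep i C s) (ht : Poly i t) : Poly i fun c => (C c).lowest (s c) (t c) :=
  Poly.and (h.top ht) (Poly.all h.G.n (Poly.imp (h.up.top PT.var)
    (Poly.le (h.w.app ht).up (h.w.up.app PT.var))))

theorem light (h : PolyStep i C s) {τ : γ → ℕ} (hτ : Poly i τ) : Poly i fun c => (C c).light (s c) (τ c) :=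
  Poly.tab h.G.m (Poly.and (h.Ac.up.app PT.var)
    (Poly.and (Poly.le (h.w.up.app (h.G.tail.up.app PT.var)) hτ.up)
      (Poly.le (h.w.up.app (h.G.head.up.app PT.var)) hτ.up)))

theorem chord (h : PolyStep i C s) (ht : Poly i t) {e : ∀ c, Fin (m c)} (he : Poly i e) :
    Poly i fun c => (C c).chord (s c) (t c) (e c) := by
  have hl := h.light (h.w.app ht)
  have hc := h.G.conn h.merged
  exact Poly.and (hl.app he) (Poly.and ((h.G.dreach hl).app₂ (h.G.head.app he) (h.G.tail.app he))
    (Poly.not (Poly.iff (hc.app₂ ht (h.G.tail.app he)) (hc.app₂ ht (h.G.head.app he)))))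

theorem big (h : PolyStep i C s) {F : ∀ c, Fin (m c) → ℕ} (hF : Poly i F) :
    Poly i fun c => (C c).big (s c) (F c) :=
  Poly.all h.G.m (Poly.imp (Poly.not (Poly.natEq (hF.up.app PT.var) (Poly.constNat 0)))
    (Poly.le (Poly.mul (Poly.add h.d.up (Poly.constNat 1)) (h.w.up.app (h.G.tail.up.app PT.var)))
      (Poly.mul h.d (h.wt (h.G.verts hF))).up))

theorem alive (h : PolyStep i C s) (hU : PolySet i U) (hv : Poly i v) :
    Poly i fun c => (C c).alive (s c) (U c) (v c) :=
  Poly.le (Poly.mul h.d (h.w.app hv)) (Poly.add (Poly.mul h.d (h.wt (diff h.G.n (h.own hv) hU))) (h.w.app hv))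

theorem newClass (h : PolyStep i C s) (hU : PolySet i U) (hv : Poly i v) :
    PolySet i fun c => (C c).newClass (s c) (U c) (v c) := by
  have h1 := hU.app hv
  have h2 := h.alive hU hv
  exact Poly.tab h.G.n (Poly.or (Poly.and h1.up (hU.up.app PT.var)) (Poly.or
    (Poly.and (Poly.not h1).up (Poly.and h2.up ((diff h.G.n (h.own hv) hU).up.app PT.var)))
    (Poly.and (Poly.not h1).up (Poly.and (Poly.not h2).up (Poly.finEq PT.var hv.up)))))

theorem newId (h : PolyStep i C s) (hU : PolySet i U) : Poly i fun c => (C c).newId (s c) (U c) :=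
  Poly.tab h.G.n (Poly.least (fun x => ⟨x.2, (C x.1).mem_newClass (s x.1) (U x.1) x.2⟩) h.G.n.up
    ((h.up.newClass hU.up PT.var).up.app PT.var))

theorem newK (h : PolyStep i C s) (hU : PolySet i U) {K : ∀ c, Fin (m c) → ℕ} (hK : Poly i K) :
    Poly i fun c => (C c).newK (s c) (U c) (K c) :=
  Poly.tab h.G.n (Poly.ite (hU.up.app PT.var) (hK.up.sub _) (Poly.ite ((h.up.alive hU.up PT.var).sub _)
    (((h.K.up.app PT.var).sub _).sub _) ((Poly.zeroVec h.G.m).up.sub _ |>.sub _)))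

theorem restart (h : PolyStep i C s) (hU : PolySet i U) {K : ∀ c, Fin (m c) → ℕ} (hK : Poly i K) :
    Poly i fun c => (C c).restart (s c) (U c) (K c) := by
  refine (h.newId hU).cons ((h.newK hU hK).cons (PT.cons ?_ (PT.cons ?_ ((Poly.zeroVec h.G.m).cons Poly.false))))
  · exact Poly.tab h.G.n (Poly.ite (hU.up.app PT.var) ((h.wt hU).up.sub _)
      (Poly.ite ((h.up.alive hU.up PT.var).sub _) (((h.w.up.app PT.var).sub _).sub _)
        (((h.ℓ.up.app PT.var).sub _).sub _)))
  · exact Poly.tab h.G.m (Poly.sumIte h.G.n.up (Poly.finEq ((h.newId hU).up.up.app PT.var) PT.var)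
      ((h.newK hU hK).up.up.app₂ PT.var PT.var.up))

theorem finalEdges (h : PolyStep i C s) (ht : Poly i t) : Poly i fun c => (C c).finalEdges (s c) (t c) :=
  h.G.restrict (Poly.addVec h.G.m h.X (h.G.restrict h.orc h.useful))
    ((Poly.tab h.G.n ((h.G.conn h.merged).up.app₂ ht.up PT.var) :
      Poly i fun c => (fun u => (C c).G.Conn ((C c).merged (s c)) (t c) u)))

theorem augment (h : PolyStep i C s) (ht : Poly i t) : Poly i fun c =>
    if hc : ∃ e, (C c).chord (s c) (t c) e then
      if (C c).big (s c) ((C c).G.cycle ((C c).light (s c) ((s c).w (t c))) (least _ hc)) then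
        (C c).restart (s c) ((C c).G.verts ((C c).G.cycle ((C c).light (s c) ((s c).w (t c))) (least _ hc)))
          ((C c).G.cycle ((C c).light (s c) ((s c).w (t c))) (least _ hc))
      else { s c with X := (s c).X + (C c).G.cycle ((C c).light (s c) ((s c).w (t c))) (least _ hc) }
    else { s c with H := (s c).H + (C c).finalEdges (s c) (t c), X := 0 } := by
  refine Poly.dite (Poly.ex h.G.m (h.up.chord ht.up PT.var)) ?_ ?_
  · replace h := h.sub fun c => ∃ e, (C c).chord (s c) (t c) e
    replace ht := ht.sub fun c => ∃ e, (C c).chord (s c) (t c) e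
    have he := Poly.least (fun c => c.2) h.G.m (h.up.chord ht.up PT.var)
    have hc := h.G.cycle (h.light (h.w.app ht)) he
    refine Poly.ite (h.big hc) ?_ ?_
    · exact (h.sub _).restart ((h.sub _).G.verts (hc.sub _)) (hc.sub _)
    · replace h := h.sub fun c => ¬ (C c).big (s c)
        ((C c).G.cycle ((C c).light (s c) ((s c).w (t c))) (least _ c.2))
      exact h.id.cons (h.K.cons (h.w.cons (h.H.cons ((Poly.addVec h.G.m h.X (hc.sub _)).cons h.done))))
  · replace h := h.sub fun c => ¬ ∃ e, (C c).chord (s c) (t c) e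
    replace ht := ht.sub fun c => ¬ ∃ e, (C c).chord (s c) (t c) e
    exact h.id.cons (h.K.cons (h.w.cons ((Poly.addVec h.G.m h.H (h.finalEdges ht)).cons
      ((Poly.zeroVec h.G.m).cons h.done))))

/-- The data are required only before the end: the final `H` may touch the backbone, and then it no
longer defines an instance of Subtour Cover. -/
theorem step (hs : Poly i s) (h : PolyStep (γ := {c // ¬ (s c).done}) (fun c => i c) (fun c => C c) fun c => s c) :
    Poly i fun c => (C c).step (s c) := by
  refine Poly.ite (p := fun c => (s c).done) hs.right.right.right.right.right (hs.sub _) ?_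
  refine Poly.dite (p := fun c : {c // ¬ (s c).done} => ∃ v, (C c).bad (s c) v)
    (Poly.ex h.G.n (h.up.bad PT.var)) ?_ ?_
  · have h' := h.sub fun c => ∃ v, (C c).bad (s c) v
    have hv := Poly.least (fun c => c.2) h'.G.n (h'.up.bad PT.var)
    have ha := h'.attached hv
    exact h'.restart (union h'.G.n (h'.own hv) ha) (Poly.addVec h'.G.m (h'.K.app hv) (h'.G.restrict h'.orc ha))
  replace h := h.sub fun c => ¬ ∃ v, (C c).bad (s c) v
  refine Poly.dite (Poly.ex h.G.n (h.up.lowest PT.var)) ?_ ?_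
  · replace h := h.sub fun c => ∃ v, (C c).lowest (s c) v
    have ht := Poly.least (fun c => c.2) h.G.n (h.up.lowest PT.var)
    exact h.augment ht
  · replace h := h.sub fun c => ¬ ∃ t, (C c).lowest (s c) t
    exact h.id.cons (h.K.cons (h.w.cons ((Poly.addVec h.G.m (Poly.addVec h.G.m h.H h.orc) h.X).cons
      (h.X.cons Poly.true))))

end PolyStep

end ATSP

namespace ATSP

open Relation MultiDigraph Enc
open scoped Classical

/-! The whole algorithm runs in polynomial time -/

/-! ### Growth of the multiplicities during a run. -/

namespace Setup

/-- Bounds on the numbers in a state. -/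
structure Bounded {n m : ℕ} (C : Setup n m) (s : St n m) (a b h : ℕ) : Prop where
  K : ∀ v e, s.K v e ≤ a
  X : ∀ e, s.X e ≤ b
  H : ∀ e, s.H e ≤ h
  w : ∀ v, s.w v ≤ C.wt Set.univ

variable {n m : ℕ} {C : Setup n m} {s : St n m} {a b h a' b' h' B : ℕ}

theorem Bounded.mono (hs : C.Bounded s a b h) (ha : a ≤ a') (hb : b ≤ b') (hh : h ≤ h') :
    C.Bounded s a' b' h' :=
  ⟨fun v e => (hs.K v e).trans ha, fun e => (hs.X e).trans hb, fun e => (hs.H e).trans hh, hs.w⟩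

theorem restrict_le {G : MultiDigraph (Fin n) (Fin m)} (F : Fin m → ℕ) (Y : Set (Fin n)) (e : Fin m) :
    G.restrict F Y e ≤ F e := by
  unfold restrict; split_ifs <;> simp

theorem Bounded.restart (hs : C.Bounded s a b h) (U : Set (Fin n)) {K : Fin m → ℕ} (hK : ∀ e, K e ≤ a') :
    C.Bounded (C.restart s U K) (max a a') 0 (n * max a a') := by
  have hK' : ∀ v e, C.newK s U K v e ≤ max a a' := by
    intro v e
    unfold newK
    split_ifs
    · exact (hK e).trans (le_max_right _ _)
    · exact (hs.K v e).trans (le_max_left _ _)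
    · simp
  refine ⟨hK', fun e => le_rfl, fun e => ?_, fun v => ?_⟩
  · refine (Finset.sum_le_card_nsmul (Finset.univ : Finset (Fin n)) _ (max a a') fun v _ => ?_).trans_eq
      (by simp)
    split_ifs
    · exact hK' v e
    · simp
  · change (if v ∈ U then C.wt U else if C.alive s U v then s.w v else C.ℓ v) ≤ _
    split_ifs
    · exact wt_mono (Set.subset_univ _)
    · exact hs.w v
    · exact le_wt (Set.mem_univ v)

theorem Bounded.step (hs : C.Bounded s a b h) (hd : ¬ s.done) (hB : ∀ e, C.orc s.H e ≤ B) :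
    C.Bounded (C.step s) (a + B + 1) (b + 1) (n * (a + B + 1) + (h + b + B)) := by
  refine C.step_cases (P := fun s' => C.Bounded s' (a + B + 1) (b + 1) (n * (a + B + 1) + (h + b + B))) s hd ?_ ?_ ?_ ?_ ?_
  · intro v _
    have hK : ∀ e, (s.K v + C.G.restrict (C.orc s.H) (C.attached s v)) e ≤ a + B + 1 := fun e =>
      (add_le_add (hs.K v e) ((restrict_le _ _ _).trans (hB e))).trans (Nat.le_succ _)
    have := hs.restart (own s v ∪ C.attached s v) hK
    rw [max_eq_right (by omega)] at this
    exact this.mono le_rfl (by omega) (by omega)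
  · intro t e _ _ _ _
    have hK : ∀ e', C.G.cycle (C.light s (s.w t)) e e' ≤ a + B + 1 := fun e' =>
      (cycle_le_one e e').trans (by omega)
    have := hs.restart (C.G.verts (C.G.cycle (C.light s (s.w t)) e)) hK
    rw [max_eq_right (by omega)] at this
    exact this.mono le_rfl (by omega) (by omega)
  · intro t e _ _ _ _
    exact ⟨fun v e => (hs.K v e).trans (by omega), fun e' => add_le_add (hs.X e') (cycle_le_one e e'),
      fun e => (hs.H e).trans (by omega), hs.w⟩
  · intro t _ _ _
    refine ⟨fun v e => (hs.K v e).trans (by omega), fun e => Nat.zero_le _, fun e => ?_, hs.w⟩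
    change s.H e + C.finalEdges s t e ≤ _
    have h1 : C.finalEdges s t e ≤ s.X e + C.orc s.H e :=
      (restrict_le _ _ _).trans (add_le_add le_rfl (restrict_le _ _ _))
    have := hs.H e
    have := hs.X e
    have := hB e
    omega
  · intro _ _
    refine ⟨fun v e => (hs.K v e).trans (by omega), fun e => (hs.X e).trans (by omega), fun e => ?_, hs.w⟩
    change s.H e + C.orc s.H e + s.X e ≤ _
    have := hs.H e
    have := hs.X e
    have := hB e
    omega

/-- Since `B` bounds all answers irrespective of the multiplicities in `H`, the entries of `K` and
`X` grow additively. `H` is rebuilt from `K` at each restart and grows additively in between. -/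
theorem run_bounded (hC : C.Valid)
    (hB : ∀ H, C.G.Eulerian H → (∀ e, H e ≠ 0 → C.A e) → ∀ e, C.orc H e ≤ B) (k : ℕ) :
    C.Bounded (C.run k) (k * (B + 1)) k (k * (n * (k * (B + 1)) + (k + B))) := by
  induction k with
  | zero => exact ⟨fun _ _ => Nat.zero_le _, fun _ => le_rfl, fun _ => Nat.zero_le _,
      fun v => le_wt (Set.mem_univ v)⟩
  | succ k ih =>
    rw [run_succ]
    by_cases hd : (C.run k).done
    · rw [Setup.step, if_pos hd]
      exact ih.mono (by gcongr; omega) (by omega) (by gcongr <;> omega)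
    · have hi := (run_inv hC k).resolve_right hd
      refine (ih.step hd (hB _ hi.H_eulerian hi.H_sub)).mono (by rw [add_mul]; omega) le_rfl ?_
      have : k * (n * (k * (B + 1)) + (k + B)) ≤ k * (n * ((k + 1) * (B + 1)) + (k + 1 + B)) := by
        gcongr <;> omega
      have h2 : k * (B + 1) + B + 1 = (k + 1) * (B + 1) := by ring
      rw [h2, add_mul k 1 (n * ((k + 1) * (B + 1)) + (k + 1 + B)), one_mul]
      omega

theorem Bounded.size_le (hs : C.Bounded s a b h) : (enc s).size ≤
    (n * (2 * n + 2) + 1) + ((n * ((m * (2 * a + 2) + 1) + 1) + 1) +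
      ((n * (2 * C.wt Set.univ + 2) + 1) + ((m * (2 * h + 2) + 1) + ((m * (2 * b + 2) + 1) + 8)))) := by
  have h1 : (enc s.id).size ≤ n * (2 * n + 2) + 1 := size_enc_pi_le (B := 2 * n + 1) fun v => by
    rw [size_enc_fin]; have := (s.id v).2; omega
  have h2 : (enc s.K).size ≤ n * ((m * (2 * a + 2) + 1) + 1) + 1 := size_enc_pi_le fun v =>
    size_enc_pi_le (B := 2 * a + 1) fun e => by rw [size_enc_nat]; have := hs.K v e; omega
  have h3 : (enc s.w).size ≤ n * (2 * C.wt Set.univ + 2) + 1 := size_enc_pi_le (B := 2 * C.wt Set.univ + 1) fun v => by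
    rw [size_enc_nat]; have := hs.w v; omega
  have h4 : (enc s.H).size ≤ m * (2 * h + 2) + 1 := size_enc_pi_le (B := 2 * h + 1) fun v => by
    rw [size_enc_nat]; have := hs.H v; omega
  have h5 : (enc s.X).size ≤ m * (2 * b + 2) + 1 := size_enc_pi_le (B := 2 * b + 1) fun v => by
    rw [size_enc_nat]; have := hs.X v; omega
  have h6 := size_enc_prop s.done
  change (Data.cons (enc s.id) (Data.cons (enc s.K) (Data.cons (enc s.w) (Data.cons (enc s.H)
    (Data.cons (enc s.X) (enc s.done)))))).size ≤ _
  simp only [Data.size]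
  omega

end Setup

variable {γ : Type} {i : γ → Data} {n m : γ → ℕ}

/-- The data of a family of setups, apart from the algorithm for Subtour Cover. -/
structure PolySetup (i : γ → Data) (C : ∀ c, Setup (n c) (m c)) : Prop where
  G : PolyGraph i fun c => (C c).G
  VB : PolySet i fun c => (C c).VB
  EB : Poly i fun c => (C c).EB
  Ac : Poly i fun c => (C c).Ac
  ℓ : Poly i fun c => (C c).ℓ
  d : Poly i fun c => (C c).d

theorem PolySetup.run {C : ∀ c, Setup (n c) (m c)} (h : PolySetup i C) (hC : ∀ c, (C c).Valid)
    (horc : PT (γ := {x : Σ c, (Fin (m c) → ℕ) // (C x.1).G.Eulerian x.2 ∧ ∀ e, x.2 e ≠ 0 → (C x.1).A e})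
      (fun x => .cons (i x.1.1) (enc x.1.2)) fun x => enc ((C x.1.1).orc x.1.2))
    (hB : ∃ B : γ → ℕ, PolyBdd i B ∧ ∀ c H, (C c).G.Eulerian H → (∀ e, H e ≠ 0 → (C c).A e) →
      ∀ e, (C c).orc H e ≤ B c) {T : γ → ℕ} (hT : Poly i T) :
    Poly i fun c => (C c).run (T c) := by
  obtain ⟨B, hB, hB'⟩ := hB
  refine Poly.iterate (fun c k => (C c).run k) hT ?_ ?_ ?_
  · refine PT.cons ?_ (PT.cons ?_ (h.ℓ.cons ((Poly.zeroVec h.G.m).cons ((Poly.zeroVec h.G.m).cons Poly.false))))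
    · exact Poly.tab h.G.n PT.var
    · exact Poly.tab h.G.n (Poly.zeroVec h.G.m).up
  · simp only [Setup.run_succ]
    have hs : Poly (fun x : {x : γ × ℕ // x.2 < T x.1} => .cons (i x.1.1) (.cons (enc x.1.2)
      (enc ((C x.1.1).run x.1.2)))) fun x => (C x.1.1).run x.1.2 := PT.refl.right.right
    refine PolyStep.step hs ?_
    have hi : PT (fun x : {x : {x : γ × ℕ // x.2 < T x.1} // ¬ ((C x.1.1).run x.1.2).done} =>
      .cons (i x.1.1.1) (.cons (enc x.1.1.2) (enc ((C x.1.1.1).run x.1.1.2)))) fun x => i x.1.1.1 :=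
      PT.refl.left
    have hs' : Poly (fun x : {x : {x : γ × ℕ // x.2 < T x.1} // ¬ ((C x.1.1).run x.1.2).done} =>
      .cons (i x.1.1.1) (.cons (enc x.1.1.2) (enc ((C x.1.1.1).run x.1.1.2))))
      fun x => (C x.1.1.1).run x.1.1.2 := PT.refl.right.right
    have hg : ∀ x : {x : {x : γ × ℕ // x.2 < T x.1} // ¬ ((C x.1.1).run x.1.2).done},
        (C x.1.1.1).Inv ((C x.1.1.1).run x.1.1.2) := fun x => (Setup.run_inv (hC _) _).resolve_right x.2
    refine ⟨h.G.pull _ hi, h.VB.pull _ hi, h.EB.pull _ hi, h.Ac.pull _ hi, h.ℓ.pull _ hi, h.d.pull _ hi, hs', ?_⟩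
    exact horc.pull (fun x => ⟨⟨x.1.1.1, ((C x.1.1.1).run x.1.1.2).H⟩, (hg x).H_eulerian, (hg x).H_sub⟩)
      (hi.cons hs'.right.right.right.left)
  · have hn := PolyBdd.of_unary h.G.n
    have hm := PolyBdd.of_unary h.G.m
    have hT' := PolyBdd.of_unary hT
    have hw : PolyBdd i fun c => (C c).wt Set.univ :=
      (PolyBdd.of_unary (Poly.sum (f := fun c v => (C c).ℓ v) h.G.n (h.ℓ.up.app PT.var))).mono fun c => by simp [Setup.wt]
    have ha := hT'.mul (hB.add (.const 1))
    have hh := hT'.mul ((hn.mul ha).add (hT'.add hB))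
    have h2 : ∀ {f : γ → ℕ}, PolyBdd i f → PolyBdd i fun c => 2 * f c + 2 := fun hf =>
      ((PolyBdd.const 2).mul hf).add (.const 2)
    have hsz := ((hn.mul (h2 hn)).add (.const 1)).add (((hn.mul (((hm.mul (h2 ha)).add (.const 1)).add (.const 1))).add
      (.const 1)).add (((hn.mul (h2 hw)).add (.const 1)).add (((hm.mul (h2 hh)).add (.const 1)).add
      (((hm.mul (h2 hT')).add (.const 1)).add (.const 8)))))
    refine ⟨_, hsz, fun c k hk => ?_⟩
    refine ((Setup.run_bounded (hC c) (hB' c) k).mono ?_ hk ?_).size_le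
    · gcongr
    · gcongr

end ATSP

namespace ATSP

open Enc
open scoped Classical

/-! Programs for binary arithmetic -/

/-- Bit vectors are represented by the lists of their bits. -/
noncomputable instance {w : ℕ} : Enc (BitVec w) :=
  ⟨fun x => enc (fun k : Fin w => x.getLsbD k = true)⟩

variable {γ : Type} {i : γ → Data} {n : γ → ℕ}

namespace PT

theorem listLength {l : γ → List Data} (h : PT i fun c => Data.list (l c)) : Poly i fun c => (l c).length := by
  have := loop (i := i) (fun c => (l c).length) (fun c k => Data.list ((l c).drop ((l c).length - k)))
    (fun c k => Data.unary ((l c).length - k)) (fun c => by simp [Data.list]) (fun c k hk => ?_)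
    (by simpa using h) (PT.nil.congr fun c => by simp [Data.unary]) ?_ ⟨_, h.size_bdd, fun c k _ => ?_⟩
  · exact this
  · rw [List.drop_eq_getElem_cons (by omega), show (l c).length - (k + 1) + 1 = (l c).length - k by omega]
    exact ⟨_, rfl⟩
  · refine (PT.nil.cons PT.refl.right.right).congr fun x => ?_
    have := x.2
    rw [show (l x.1.1).length - x.1.2 = (l x.1.1).length - (x.1.2 + 1) + 1 by omega]
    rfl
  · have : ∀ l : List Data, 2 * l.length + 1 ≤ (Data.list l).size := by
      intro l
      induction l with
      | nil => simp [Data.list, Data.size]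
      | cons a l ih =>
        have := a.size_pos
        simp only [Data.list, Data.size, List.length_cons]; omega
    have := this (l c)
    rw [Data.size_unary]
    omega

theorem getOfFn {o : ∀ c, Fin (n c) → Data} {v : ∀ c, Fin (n c)}
    (h : PT i fun c => Data.list (List.ofFn (o c))) (hv : Poly i v) : PT i fun c => o c (v c) := by
  refine (listGet (k := fun c => (v c : ℕ)) h hv).congr fun c => ?_
  rw [List.drop_eq_getElem_cons (by simp)]
  simp [Data.list, Data.fst]

end PT

/-! ### Binary arithmetic modulo powers of two. -/

namespace Poly

variable {W : γ → ℕ} {x y : ∀ c, BitVec (W c)}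

theorem bitVec (hW : Poly i W)
    (h : PT (Ext i fun c => Fin (W c)) fun z => enc ((x z.1).getLsbD z.2 = Bool.true)) : Poly i x :=
  tab hW h

theorem _root_.ATSP.PT.bvBit (hx : Poly i x) {k : ∀ c, Fin (W c)} (hk : Poly i k) :
    Poly i fun c => ((x c).getLsbD (k c) = Bool.true) :=
  PT.app (f := fun c => (fun k : Fin (W c) => (x c).getLsbD k = Bool.true)) hx hk

theorem carry (hx : Poly i x) (hy : Poly i y) (b : Bool) {T : γ → ℕ} (hT : Poly i T) (h : ∀ c, T c ≤ W c) :
    Poly i fun c => ((x c).carry (T c) (y c) b = Bool.true) := by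
  refine iterate (fun c k => BitVec.carry k (x c) (y c) b = Bool.true) hT ?_ ?_
    ⟨_, .const 3, fun c k _ => size_enc_prop _⟩
  · simpa using constProp _
  · have hi : PT (fun z : {z : γ × ℕ // z.2 < T z.1} => .cons (i z.1.1) (.cons (enc z.1.2)
      (enc (BitVec.carry z.1.2 (x z.1.1) (y z.1.1) b = Bool.true)))) fun z => i z.1.1 := PT.refl.left
    have hk : Poly (fun z : {z : γ × ℕ // z.2 < T z.1} => .cons (i z.1.1) (.cons (enc z.1.2)
      (enc (BitVec.carry z.1.2 (x z.1.1) (y z.1.1) b = Bool.true))))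
      fun z => (⟨z.1.2, z.2.trans_le (h z.1.1)⟩ : Fin (W z.1.1)) := PT.refl.right.left
    have hc : Poly (fun z : {z : γ × ℕ // z.2 < T z.1} => .cons (i z.1.1) (.cons (enc z.1.2)
      (enc (BitVec.carry z.1.2 (x z.1.1) (y z.1.1) b = Bool.true))))
      fun z => (BitVec.carry z.1.2 (x z.1.1) (y z.1.1) b = Bool.true) := PT.refl.right.right
    have h1 := (hx.pull (fun z : {z : γ × ℕ // z.2 < T z.1} => z.1.1) hi).bvBit hk
    have h2 := (hy.pull (fun z : {z : γ × ℕ // z.2 < T z.1} => z.1.1) hi).bvBit hk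
    refine (or (and h1 h2) (or (and h1 hc) (and h2 hc))).iffProp fun z => ?_
    rw [BitVec.carry_succ]
    simp only
    cases (x z.1.1).getLsbD z.1.2 <;> cases (y z.1.1).getLsbD z.1.2 <;>
      cases BitVec.carry z.1.2 (x z.1.1) (y z.1.1) b <;> simp [Bool.atLeastTwo]

theorem bvAdd (hW : Poly i W) (hx : Poly i x) (hy : Poly i y) : Poly i fun c => x c + y c := by
  have h1 := hx.up.bvBit (k := fun z : (Σ c, Fin (W c)) => z.2) PT.var
  have h2 := hy.up.bvBit (k := fun z : (Σ c, Fin (W c)) => z.2) PT.var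
  have h3 := carry (x := fun z : (Σ c, Fin (W c)) => x z.1) hx.up hy.up Bool.false
    (T := fun z : (Σ c, Fin (W c)) => (z.2 : ℕ)) PT.var fun z => z.2.2.le
  refine bitVec hW ((not (iff h1 (not (iff h2 h3)))).iffProp fun z => ?_)
  rw [BitVec.getLsbD_add z.2.2]
  cases (x z.1).getLsbD z.2 <;> cases (y z.1).getLsbD z.2 <;>
    cases BitVec.carry z.2 (x z.1) (y z.1) Bool.false <;> simp

theorem bvZero (hW : Poly i W) : Poly i fun c => (0 : BitVec (W c)) :=
  bitVec hW (Poly.false.iffProp fun z => by simp)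

theorem bvOne (hW : Poly i W) : Poly i fun c => (1 : BitVec (W c)) :=
  bitVec hW ((natEq (finVal (v := fun z : (Σ c, Fin (W c)) => z.2) PT.var) (constNat 0)).iffProp fun z => by
    have := z.2.2
    change _ ↔ (BitVec.ofNat (W z.1) 1).getLsbD z.2 = _
    rw [BitVec.getLsbD_ofNat]
    simp only [show ((z.2 : ℕ) < W z.1) from this, decide_true, Bool.true_and]
    rw [Nat.testBit_one_eq_true_iff_self_eq_zero])

theorem size_enc_bitVec {w : ℕ} (x : BitVec w) : (enc x).size ≤ w * 4 + 1 :=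
  size_enc_pi_le fun _ => size_enc_prop _

/-- One step of Horner's scheme: double and add according to the next bit of `y`. -/
theorem mul_div_two_pow {w : ℕ} (x y : BitVec w) (a : ℕ) [Decidable (y.getLsbD a = Bool.true)] :
    x * BitVec.ofNat w (y.toNat / 2 ^ a) = x * BitVec.ofNat w (y.toNat / 2 ^ (a + 1)) +
      x * BitVec.ofNat w (y.toNat / 2 ^ (a + 1)) + if y.getLsbD a = Bool.true then x else 0 := by
  have hbit : y.getLsbD a = decide (y.toNat / 2 ^ a % 2 = 1) := by
    rw [← BitVec.testBit_toNat, Nat.testBit_eq_decide_div_mod_eq]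
  have hN : y.toNat / 2 ^ a =
      y.toNat / 2 ^ (a + 1) + y.toNat / 2 ^ (a + 1) + y.toNat / 2 ^ a % 2 := by
    rw [pow_succ, ← Nat.div_div_eq_div_mul]; omega
  conv_lhs => rw [hN, BitVec.ofNat_add, BitVec.ofNat_add, BitVec.mul_add, BitVec.mul_add]
  congr 1
  rcases Nat.mod_two_eq_zero_or_one (y.toNat / 2 ^ a) with h | h
  · rw [h, if_neg (by simp [hbit, h])]; simp
  · rw [h, if_pos (by simp [hbit, h])]; simp

theorem bvMul (hW : Poly i W) (hx : Poly i x) (hy : Poly i y) : Poly i fun c => x c * y c := by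
  have hb : ∃ f, PolyBdd i f ∧ ∀ c k, k ≤ W c →
      (enc (x c * BitVec.ofNat (W c) ((y c).toNat / 2 ^ (W c - k)))).size ≤ f c :=
    ⟨_, ((PolyBdd.of_unary hW).mul (.const 4)).add (.const 1), fun c k _ => size_enc_bitVec _⟩
  refine (iterate (fun c k => x c * BitVec.ofNat (W c) ((y c).toNat / 2 ^ (W c - k))) hW ?_ ?_ hb).congr
    fun c => by simp
  · refine (bvZero hW).congr fun c => ?_
    dsimp only
    rw [Nat.sub_zero, Nat.div_eq_of_lt (y c).isLt]
    simp
  · have hi : PT (fun z : {z : γ × ℕ // z.2 < W z.1} => .cons (i z.1.1) (.cons (enc z.1.2)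
      (enc (x z.1.1 * BitVec.ofNat (W z.1.1) ((y z.1.1).toNat / 2 ^ (W z.1.1 - z.1.2)))))) fun z => i z.1.1 :=
      PT.refl.left
    have hs : Poly (fun z : {z : γ × ℕ // z.2 < W z.1} => .cons (i z.1.1) (.cons (enc z.1.2)
      (enc (x z.1.1 * BitVec.ofNat (W z.1.1) ((y z.1.1).toNat / 2 ^ (W z.1.1 - z.1.2))))))
      fun z => x z.1.1 * BitVec.ofNat (W z.1.1) ((y z.1.1).toNat / 2 ^ (W z.1.1 - z.1.2)) := PT.refl.right.right
    have hk : Poly (fun z : {z : γ × ℕ // z.2 < W z.1} => .cons (i z.1.1) (.cons (enc z.1.2)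
      (enc (x z.1.1 * BitVec.ofNat (W z.1.1) ((y z.1.1).toNat / 2 ^ (W z.1.1 - z.1.2)))))) fun z => z.1.2 :=
      PT.refl.right.left
    have hW' := hW.pull (fun z : {z : γ × ℕ // z.2 < W z.1} => z.1.1) hi
    have hx' := hx.pull (fun z : {z : γ × ℕ // z.2 < W z.1} => z.1.1) hi
    have hj := natSub hW' (add hk (constNat 1))
    have hbit := (hy.pull (fun z : {z : γ × ℕ // z.2 < W z.1} => z.1.1) hi).bvBit
      (k := fun z => ⟨W z.1.1 - (z.1.2 + 1), by have := z.2; omega⟩) hj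
    have hif := ite (f := fun z : {z : γ × ℕ // z.2 < W z.1} => x z.1.1)
      (g := fun z : {z : γ × ℕ // z.2 < W z.1} => 0) hbit (hx'.sub _) ((bvZero hW').sub _)
    refine (bvAdd hW' (bvAdd hW' hs hs) hif).congr fun z => ?_
    congr 1
    dsimp only
    have hz := z.2
    rw [show W z.1.1 - z.1.2 = W z.1.1 - (z.1.2 + 1) + 1 by omega]
    exact (mul_div_two_pow _ _ _).symm

/-- Whether `x ≤ y` is the carry out of `y + ~~~x + 1`. -/
theorem bvLe (hW : Poly i W) (hx : Poly i x) (hy : Poly i y) : Poly i fun c => x c ≤ y c := by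
  have hn : Poly i fun c => ~~~ x c := bitVec hW ((not (hx.up.bvBit (k := fun z : (Σ c, Fin (W c)) => z.2) PT.var)).iffProp fun z => by simp)
  refine (carry hy hn Bool.true hW fun c => le_rfl).iffProp fun c => ?_
  rw [← BitVec.ule_eq_carry, BitVec.ule_iff_le]

theorem bvUnary (hW : Poly i W) {a : γ → ℕ} (ha : Poly i a) : Poly i fun c => BitVec.ofNat (W c) (a c) := by
  refine iterate (fun c k => BitVec.ofNat (W c) k) ha (bvZero hW) ?_
    ⟨_, ((PolyBdd.of_unary hW).mul (.const 4)).add (.const 1), fun c k _ => size_enc_bitVec _⟩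
  have hW' : Poly (fun z : {z : γ × ℕ // z.2 < a z.1} => .cons (i z.1.1) (.cons (enc z.1.2)
    (enc (BitVec.ofNat (W z.1.1) z.1.2)))) fun z => W z.1.1 := hW.pull _ PT.refl.left
  refine (bvAdd hW' (x := fun z : {z : γ × ℕ // z.2 < a z.1} => BitVec.ofNat (W z.1.1) z.1.2) PT.refl.right.right (bvOne hW')).congr fun z => ?_
  rw [BitVec.ofNat_add]
  rfl

theorem bvBinary (hW : Poly i W) {a : γ → ℕ} (ha : PT i fun c => Data.binary (a c)) :
    Poly i fun c => BitVec.ofNat (W c) (a c) := by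
  refine bitVec hW ((PT.listGet (k := fun z : (Σ c, Fin (W c)) => (z.2 : ℕ)) ha.up PT.var).congr fun z => ?_)
  rw [BitVec.getLsbD_ofNat, Nat.testBit_eq_inth]
  simp only [z.2.2, decide_true, Bool.true_and]
  generalize (z.2 : ℕ) = k
  rw [← List.map_drop]
  by_cases h : k < (a z.1).bits.length
  · rw [List.drop_eq_getElem_cons h, List.getI_eq_getElem _ h, List.map_cons, Data.list, Data.fst]
    simp [enc]
  · rw [List.drop_of_length_le (by omega), List.getI_eq_default _ (by omega), List.map_nil, Data.list, Data.fst]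
    simp [enc, Data.bit]

theorem lt_two_pow_bits (a : ℕ) : a < 2 ^ a.bits.length := by
  rw [Nat.size_eq_bits_len]
  exact Nat.lt_size_self a

/-- Comparison of products of unary and binary numbers. -/
theorem mulLe {a b a' b' u u' : γ → ℕ} (hu : Poly i u) (hu' : Poly i u')
    (ha : PT i fun c => Data.binary (a c)) (hb : PT i fun c => Data.binary (b c))
    (ha' : PT i fun c => Data.binary (a' c)) (hb' : PT i fun c => Data.binary (b' c)) :
    Poly i fun c => u c * (a c * b c) ≤ u' c * (a' c * b' c) := by
  have hlen : ∀ {a : γ → ℕ}, (PT i fun c => Data.binary (a c)) → Poly i fun c => (a c).bits.length := fun h =>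
    h.listLength.congr fun c => by simp
  -- The unary factors and the bit lengths together give a width at which none of the products
  -- overflows.
  have hW := add (add hu (add (hlen ha) (hlen hb))) (add hu' (add (hlen ha') (hlen hb')))
  refine (bvLe hW (bvMul hW (bvUnary hW hu) (bvMul hW (bvBinary hW ha) (bvBinary hW hb)))
    (bvMul hW (bvUnary hW hu') (bvMul hW (bvBinary hW ha') (bvBinary hW hb')))).iffProp fun c => ?_
  rw [← BitVec.ofNat_mul, ← BitVec.ofNat_mul, ← BitVec.ofNat_mul, ← BitVec.ofNat_mul, BitVec.le_def,
    BitVec.toNat_ofNat, BitVec.toNat_ofNat]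
  have key : ∀ u a b : ℕ, u * (a * b) < 2 ^ (u + (a.bits.length + b.bits.length)) := fun u a b => by
    rw [pow_add, pow_add]
    exact Nat.mul_lt_mul'' Nat.lt_two_pow_self (Nat.mul_lt_mul'' (lt_two_pow_bits a) (lt_two_pow_bits b))
  rw [Nat.mod_eq_of_lt, Nat.mod_eq_of_lt]
  · exact (key _ _ _).trans_le (Nat.pow_le_pow_right two_pos (by omega))
  · exact (key _ _ _).trans_le (Nat.pow_le_pow_right two_pos (by omega))

end Poly

end ATSP

namespace ATSP

open Relation MultiDigraph Enc
open scoped Classical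

/-! Reading vertebrate pairs -/

theorem vertexSet_eq {n : ℕ} (U : Finset (Fin n)) : Data.vertexSet U = enc (fun v => v ∈ U) := by
  refine congrArg Data.list (congrArg List.ofFn (funext fun v => ?_))
  exact congrArg Data.bit (decide_eq_decide.2 Iff.rfl)

theorem size_enc_apply_le {n : ℕ} {α : Type} [Enc α] (f : Fin n → α) (v : Fin n) :
    (enc (f v)).size ≤ (enc f).size := by
  have key : ∀ (l : List Data), ∀ a ∈ l, a.size ≤ (Data.list l).size := by
    intro l
    induction l with
    | nil => simp
    | cons b l ih =>
      intro a ha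
      simp only [Data.list, Data.size]
      rcases List.mem_cons.1 ha with rfl | h
      · omega
      · have := ih a h
        omega
  exact key _ _ (by simp)

theorem PolyBdd.eval {γ : Type} {i : γ → Data} {f : γ → ℕ} (h : PolyBdd i f) (Q : Polynomial ℕ) :
    PolyBdd i fun c => Q.eval (f c) :=
  let ⟨P, hP⟩ := h
  ⟨Q.comp P, fun c => by rw [Polynomial.eval_comp]; exact eval_le_eval Q (hP c)⟩

namespace StronglyLaminarInstance

variable (I : StronglyLaminarInstance)

theorem vertexWeight_of_singleton {j : Fin I.k} {v : Fin I.n} (h : I.L j = {v}) :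
    I.vertexWeight v = I.y j := by
  rw [vertexWeight, Finset.sum_filter, Finset.sum_eq_single j]
  · rw [if_pos h]
  · intro j' _ hne
    rw [if_neg fun h' => hne (I.L_injective (h'.trans h.symm))]
  · simp

theorem vertexWeight_eq_zero {v : Fin I.n} (h : ∀ j, I.L j ≠ {v}) : I.vertexWeight v = 0 := by
  rw [vertexWeight, Finset.sum_filter]
  exact Finset.sum_eq_zero fun j _ => if_neg (h j)

/-- Cross-multiplication reduces the comparison to natural numbers. The quantifiers treat vertices
without a singleton in the family, whose weight is 0; positivity of `a` excludes a positive left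
side against weight 0. -/
theorem mul_vertexWeight_le_iff {a b : ℕ} (ha : 0 < a) {u v : Fin I.n} :
    (a : ℚ) * I.vertexWeight u ≤ b * I.vertexWeight v ↔ ∀ j, I.L j = {u} → ∃ l, I.L l = {v} ∧
      a * ((I.y j).num.natAbs * (I.y l).den) ≤ b * ((I.y l).num.natAbs * (I.y j).den) := by
  have ha' : (0 : ℚ) < a := by exact_mod_cast ha
  have hy : ∀ j, I.y j = ((I.y j).num.natAbs : ℚ) / ((I.y j).den : ℚ) := by
    intro j
    have h1 : (((I.y j).num.natAbs : ℤ) : ℚ) = ((I.y j).num : ℚ) := by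
      rw [Int.natAbs_of_nonneg (Rat.num_nonneg.2 (I.y_pos j).le)]
    rw [← Int.cast_natCast, h1, Rat.num_div_den]
  have key : ∀ j l, ((a : ℚ) * I.y j ≤ b * I.y l ↔
      a * ((I.y j).num.natAbs * (I.y l).den) ≤ b * ((I.y l).num.natAbs * (I.y j).den)) := by
    intro j l
    have h1 : (0 : ℚ) < (I.y j).den := by exact_mod_cast (I.y j).den_pos
    have h2 : (0 : ℚ) < (I.y l).den := by exact_mod_cast (I.y l).den_pos
    conv_lhs => rw [hy j, hy l]
    rw [mul_div_assoc', mul_div_assoc', div_le_div_iff₀ h1 h2]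
    rw [← Nat.cast_le (α := ℚ)]
    push_cast
    rw [mul_assoc, mul_assoc]
  constructor
  · intro h j hj
    rw [I.vertexWeight_of_singleton hj] at h
    by_cases hl : ∃ l, I.L l = {v}
    · obtain ⟨l, hl⟩ := hl
      rw [I.vertexWeight_of_singleton hl] at h
      exact ⟨l, hl, (key j l).1 h⟩
    · rw [I.vertexWeight_eq_zero (not_exists.1 hl), mul_zero] at h
      exact absurd h (not_le.2 (mul_pos ha' (I.y_pos j)))
  · intro h
    by_cases hj : ∃ j, I.L j = {u}
    · obtain ⟨j, hj⟩ := hj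
      obtain ⟨l, hl, h'⟩ := h j hj
      rw [I.vertexWeight_of_singleton hj, I.vertexWeight_of_singleton hl]
      exact (key j l).2 h'
    · rw [I.vertexWeight_eq_zero (not_exists.1 hj), mul_zero]
      exact mul_nonneg (Nat.cast_nonneg _) (I.vertexWeight_nonneg v)

end StronglyLaminarInstance

namespace VertebratePair

theorem poly_n : Poly encode fun J => J.n := PT.refl.left.left

theorem poly_edges : PT encode fun J => Data.list (List.ofFn fun e =>
    .cons (.cons (.unary (J.G.tail e)) (.unary (J.G.head e))) (.rat (J.x e))) := PT.refl.left.right.left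

theorem poly_sets : PT encode fun J => Data.list (List.ofFn fun j =>
    .cons (.vertexSet (J.L j)) (.rat (J.y j))) := PT.refl.left.right.right

theorem poly_m : Poly encode fun J => J.m := poly_edges.listLength.congr fun J => by simp

theorem poly_k : Poly encode fun J => J.k := poly_sets.listLength.congr fun J => by simp

theorem polyGraph : PolyGraph encode fun J => J.G where
  n := poly_n
  m := poly_m
  tail := Poly.tab poly_m (poly_edges.up.getOfFn PT.var).left.left
  head := Poly.tab poly_m (poly_edges.up.getOfFn PT.var).left.right

theorem poly_L : Poly encode fun J => (fun j v => v ∈ J.L j) :=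
  Poly.tab poly_k ((poly_sets.up.getOfFn PT.var).left.congr fun _ => vertexSet_eq _)

theorem poly_VB : Poly encode fun J => (fun v => v ∈ J.VB) :=
  PT.congr (o := fun J => Data.vertexSet J.VB) PT.refl.right.left fun _ => vertexSet_eq _

theorem poly_EB : Poly encode fun J => J.EB := PT.refl.right.right

section

variable {γ : Type} {i : γ → Data} {J : γ → VertebratePair}

theorem poly_singleton (hJ : PT i fun c => (J c).encode) {j : ∀ c, Fin (J c).k} (hj : Poly i j)
    {v : ∀ c, Fin (J c).n} (hv : Poly i v) : Poly i fun c => (J c).L (j c) = {v c} := by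
  refine (Poly.all (p := fun c w => w ∈ (J c).L (j c) ↔ w = v c) (poly_n.pull J hJ) (Poly.iff ((poly_L.pull J hJ).up.app₂ hj.up PT.var)
    (Poly.finEq PT.var hv.up))).iffProp fun c => ?_
  rw [Finset.ext_iff]
  simp only [Finset.mem_singleton]

theorem poly_num (hJ : PT i fun c => (J c).encode) {j : ∀ c, Fin (J c).k} (hj : Poly i j) :
    PT i fun c => Data.binary ((J c).y (j c)).num.natAbs :=
  ((poly_sets.pull J hJ).getOfFn hj).right.left

theorem poly_den (hJ : PT i fun c => (J c).encode) {j : ∀ c, Fin (J c).k} (hj : Poly i j) :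
    PT i fun c => Data.binary ((J c).y (j c)).den :=
  ((poly_sets.pull J hJ).getOfFn hj).right.right

theorem poly_weight_le (hJ : PT i fun c => (J c).encode) {a b : γ → ℕ} (ha : Poly i a) (hb : Poly i b)
    (hpos : ∀ c, 0 < a c) {u v : ∀ c, Fin (J c).n} (hu : Poly i u) (hv : Poly i v) :
    Poly i fun c => (a c : ℚ) * (J c).vertexWeight (u c) ≤ (b c : ℚ) * (J c).vertexWeight (v c) := by
  have hk := poly_k.pull J hJ
  refine (Poly.all hk (Poly.imp (poly_singleton hJ.up PT.var hu.up) (Poly.ex hk.up (Poly.and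
    (poly_singleton hJ.up.up PT.var hv.up.up) (Poly.mulLe ha.up.up hb.up.up (poly_num hJ.up.up PT.var.up)
      (poly_den hJ.up.up PT.var) (poly_num hJ.up.up PT.var) (poly_den hJ.up.up PT.var.up)))))).iffProp
    fun c => ((J c).mul_vertexWeight_le_iff (hpos c)).symm

end

theorem poly_allowed : Poly encode fun J => J.allowed := by
  refine Poly.tab poly_m (Poly.and (Poly.not (poly_VB.up.app (polyGraph.tail.up.app PT.var))) (Poly.and
    (Poly.not (poly_VB.up.app (polyGraph.head.up.app PT.var)))
    (Poly.all poly_k.up (Poly.imp ?_ (Poly.not (Poly.not (Poly.iff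
      (poly_L.up.up.app₂ PT.var (polyGraph.tail.up.up.app PT.var.up))
      (poly_L.up.up.app₂ PT.var (polyGraph.head.up.up.app PT.var.up)))))))))
  refine (Poly.ex (p := fun x a => ∃ b, a ∈ x.1.1.L x.2 ∧ b ∈ x.1.1.L x.2 ∧ a ≠ b) poly_n.up.up (Poly.ex poly_n.up.up.up (Poly.and (poly_L.up.up.up.up.app₂ PT.var.up.up PT.var.up)
    (Poly.and (poly_L.up.up.up.up.app₂ PT.var.up.up PT.var) (Poly.not (Poly.finEq PT.var.up PT.var)))))).iffProp
    fun x => ?_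
  exact Finset.one_lt_card_iff.symm

theorem poly_scaledWeight (q : ℕ) : Poly encode fun J => J.scaledWeight q := by
  have hQ : Poly encode fun J => q * J.n := Poly.mul (Poly.constNat q) poly_n
  suffices h : Poly (Ext encode fun J => Fin J.n) fun x => 1 + ∑ k : Fin (q * x.1.n),
      if ∀ u, u ∉ x.1.VB → ((k : ℕ) + 1) * x.1.vertexWeight u ≤ (q * x.1.n : ℕ) * x.1.vertexWeight x.2
      then 1 else 0 from
    Poly.tab poly_n (Poly.ite (poly_VB.up.app PT.var) (Poly.constNat 0) (h.sub _))
  refine Poly.add (Poly.constNat 1) (Poly.sumIte hQ.up (Poly.all poly_n.up.up (Poly.imp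
    (Poly.not (poly_VB.up.up.up.app PT.var)) ?_)) (Poly.constNat 1))
  refine (poly_weight_le PT.refl.up.up.up (Poly.add (Poly.finVal PT.var.up) (Poly.constNat 1))
    hQ.up.up.up (fun _ => Nat.succ_pos _) PT.var PT.var.up.up).iffProp fun x => ?_
  push_cast
  exact Iff.rfl

variable {sol : ∀ S : SubtourCoverInstance, Fin S.m → ℕ}

theorem polySetup (cyc : Prop) (d : ℕ) : PolySetup encode fun J => J.setup sol cyc d where
  G := polyGraph
  VB := poly_VB
  EB := poly_EB
  Ac := Poly.tab poly_m (Poly.and (Poly.constProp cyc) (poly_allowed.up.app PT.var))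
  ℓ := poly_scaledWeight d
  d := Poly.constNat d

theorem poly_run (cyc : Prop) {d : ℕ} (hd : 2 ≤ d)
    (hsol : ∀ S : SubtourCoverInstance, S.IsSolution (sol S))
    (hA : PT SubtourCoverInstance.encode fun S => .edgeMultiset (sol S)) {T : VertebratePair → ℕ}
    (hT : Poly encode T) : Poly encode fun J => (J.setup sol cyc d).run (T J) := by
  refine (polySetup cyc d).run (fun J => setup_valid hd hsol) ?_ ?_ hT
  · refine (hA.pull (fun x : {x : Σ J : VertebratePair, (Fin J.m → ℕ) //
      (x.1.setup sol cyc d).G.Eulerian x.2 ∧ ∀ e, x.2 e ≠ 0 → (x.1.setup sol cyc d).A e} =>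
      x.1.1.subtourCover x.1.2 x.2) ?_).congr fun x => ?_
    · exact PT.refl.left.cons ((polyGraph.pull (fun x => x.1.1) PT.refl.left).cycleCover
        (H := fun x : {x : Σ J : VertebratePair, (Fin J.m → ℕ) //
          (x.1.setup sol cyc d).G.Eulerian x.2 ∧ ∀ e, x.2 e ≠ 0 → (x.1.setup sol cyc d).A e} => x.1.2)
        PT.refl.right)
    · rw [setup_orc x.2.1 x.2.2]
      rfl
  -- The multiplicities in an answer are bounded by its size, which is polynomial in the size of `J`
  -- and of the cycle cover, whatever the multiplicities in `H`.
  · obtain ⟨Q, hQ⟩ := hA.size_bdd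
    have hm := PolyBdd.of_unary poly_m
    refine ⟨_, ((PolyBdd.size.add ((hm.mul ((hm.mul (.const 2)).add (.const 2))).add (.const 1))).add
      (.const 1)).eval Q, fun J H h h' e => ?_⟩
    rw [setup_orc h h']
    have h1 := size_enc_apply_le (sol (J.subtourCover H ⟨h, h'⟩)) e
    rw [size_enc_nat] at h1
    refine (Nat.le_of_lt ?_).trans ((hQ (J.subtourCover H ⟨h, h'⟩)).trans (eval_le_eval Q ?_))
    · exact lt_of_lt_of_le (by omega) h1
    · change J.encode.size + (enc (J.G.cycleCover H)).size + 1 ≤ _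
      have h2 : (enc (J.G.cycleCover H)).size ≤ J.m * (J.m * 2 + 2) + 1 :=
        size_enc_pi_le (B := J.m * 2 + 1) fun e => by
          rw [size_enc_nat]
          have := cycleCover_le (G := J.G) H e
          omega
      omega

end VertebratePair

/-! ### Choice of the parameters and conclusion. -/

/-- The left side tends to `4 * a + 1`. Its factor `1 + 2/d` stems from the weight lost by entities
and its factor `1 + 1/d` from rounding. -/
theorem exists_denominator {a b : ℝ} (h : 4 * a + 1 < b) :
    ∃ d : ℕ, 2 ≤ d ∧ (a * (4 + 2 / d) + (1 + 1 / d)) * (1 + 2 / d) * (1 + 1 / d) ≤ b := by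
  have h1 : Filter.Tendsto (fun d : ℕ => (1 : ℝ) / d) Filter.atTop (nhds 0) := tendsto_one_div_atTop_nhds_zero_nat
  have hf : Continuous fun t : ℝ => (a * (4 + 2 * t) + (1 + t)) * (1 + 2 * t) * (1 + t) := by fun_prop
  have h2 := (hf.tendsto 0).comp h1
  have h3 := h2.eventually_lt_const (u := b) (by linarith)
  obtain ⟨d, hd, hd2⟩ := (h3.and (Filter.eventually_ge_atTop 2)).exists
  refine ⟨d, hd2, ?_⟩
  have h4 : (2 : ℝ) / d = 2 * (1 / d) := by ring
  rw [h4]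
  exact hd.le

/-- The powers of `d / (d + 1)` tend to 0, so one of them is below `1 / (d + 1)`. -/
theorem exists_exponent (d : ℕ) : ∃ p, (d + 1) * d ^ p ≤ (d + 1) ^ p := by
  have hd : (0 : ℝ) < (d : ℝ) + 1 := by positivity
  obtain ⟨p, hp⟩ := exists_pow_lt_of_lt_one (x := 1 / ((d : ℝ) + 1)) (y := (d : ℝ) / (d + 1)) (by positivity)
    (by rw [div_lt_one hd]; linarith)
  refine ⟨p, ?_⟩
  rw [div_pow, div_lt_div_iff₀ (by positivity) hd] at hp
  have : ((d : ℝ) + 1) * d ^ p ≤ (d + 1) ^ p := by linarith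
  exact_mod_cast this

theorem VertebratePair.outsideWeight_nonneg (J : VertebratePair) : 0 ≤ J.outsideWeight :=
  Finset.sum_nonneg fun v _ => mul_nonneg zero_le_two (J.vertexWeight_nonneg v)

/-- The parameter `α` may be chosen to be `0` or at least `1 / 2`. -/
theorem exists_algorithm {α κ β η : ℝ} (hα : 0 ≤ α)
    {sol : ∀ S : SubtourCoverInstance, Fin S.m → ℕ} {cyc : Prop}
    (hA : PT SubtourCoverInstance.encode fun S => .edgeMultiset (sol S))
    (hsol : ∀ S : SubtourCoverInstance, S.IsSolution (sol S))
    (hcost : ∀ S : SubtourCoverInstance, S.CostBounds α κ β (sol S))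
    (hmode : (α = 0 ∧ ¬ cyc) ∨ (1 ≤ 2 * α ∧ cyc)) (hη : 4 * α + 1 < η) :
    ∃ A : Prog, IsPolyTimeVertebratePairAlgorithm κ (β + η) A := by
  obtain ⟨d, hd, hdη⟩ := exists_denominator hη
  obtain ⟨p, hp⟩ := exists_exponent d
  have hn := VertebratePair.poly_n
  have hn2 := Poly.pow hn 2
  have hw : Poly VertebratePair.encode fun J => (J.setup sol cyc d).wt Set.univ :=
    (Poly.sum (f := fun J v => J.scaledWeight d v) hn ((VertebratePair.poly_scaledWeight d).up.app PT.var)).congr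
      fun J => by simp [Setup.wt, VertebratePair.setup]
  -- The number of rounds is the bound of `run_done` plus one. It is polynomial because `d` and `p`
  -- are constants and the weights are unary; surplus rounds leave a finished state unchanged.
  have hT := Poly.add (Poly.add (Poly.mul (Poly.add (Poly.mul (Poly.mul (Poly.mul (Poly.pow
    (Poly.mul (Poly.constNat 2) hw) p) (Poly.constNat d)) hw) (Poly.add hn2 (Poly.constNat 1))) hn2)
    (Poly.add hn2 (Poly.constNat 1))) hn2) (Poly.constNat 1)
  obtain ⟨A, P, hrun⟩ := (VertebratePair.poly_run cyc hd hsol hA hT).right.right.right.left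
  refine ⟨A, P, fun J => ?_⟩
  obtain ⟨t, ht, htP⟩ := hrun J
  have hdone := Setup.run_done (VertebratePair.setup_valid (J := J) (cyc := cyc) hd hsol) hp (Nat.lt_succ_self _)
  have hfinal := Setup.run_final (VertebratePair.setup_valid (J := J) (cyc := cyc) hd hsol)
    (VertebratePair.setup_costValid hα (by omega) hcost hmode) hdone
  have h := VertebratePair.isSolution_of_final (by omega) hα hfinal
  refine ⟨_, t, ht, htP, h.1, h.2.trans ?_⟩
  have h0 : (0 : ℝ) ≤ J.outsideWeight := by exact_mod_cast J.outsideWeight_nonneg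
  have := mul_le_mul_of_nonneg_right hdη h0
  linarith

end ATSP

theorem theorem6p2 (α κ β : ℝ) (hα : 0 ≤ α) (hκ : 0 ≤ κ) (hβ : 0 ≤ β)
    (hA : ∃ A : ATSP.Prog, ATSP.IsSubtourCoverAlgorithm α κ β A)
    (ε : ℝ) (hε : 0 < ε) :
    ∃ A : ATSP.Prog, ATSP.IsPolyTimeVertebratePairAlgorithm κ (4 * α + β + 1 + ε) A := by
  obtain ⟨A, P, hA⟩ := hA
  choose sol t hrun ht hsol hcost using hA
  have hPT : ATSP.PT ATSP.SubtourCoverInstance.encode fun S => .edgeMultiset (sol S) :=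
    ⟨A, P, fun S => ⟨t S, hrun S, ht S⟩⟩
  rw [show 4 * α + β + 1 + ε = β + (4 * α + 1 + ε) by ring]
  -- For `2 * α < 1` the given algorithm also satisfies the bounds for `0` in place of `α`, and
  -- there is even slack since `1 < 4 * α + 1 + ε`.
  by_cases h : 1 ≤ 2 * α
  · exact ATSP.exists_algorithm (cyc := True) hα hPT hsol hcost (Or.inr ⟨h, trivial⟩) (by linarith)
  · exact ATSP.exists_algorithm (cyc := False) le_rfl hPT hsol
      (fun S => (hcost S).zero hα (by linarith) (hsol S)) (Or.inl ⟨rfl, id⟩) (by linarith)
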